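/- Fix $\rho>1$. Let $\mathcal W$ be the Banach space of functions $f(\lambda)=\sum_{n\in\mathbb Z}c_n\lambda^n$ with $\|f\|=\sum_n|c_n|\rho^{|n|}<\infty$, let $\mathcal W^{\ge 0}\subset\mathcal W$ be the subspace of those with $c_n=0$ for all $n<0$, and write $f^0=c_0$. For $R>0$ let $D^*(\infty,R)=\{z\in\mathbb C:|z|>R^{-1}\}$, let $\widetilde{D^*}(\infty,R)$ be its universal cover with base point $\widetilde z_0$, and let $\sigma$ be a generator of its group of deck transformations. A *DPW potential* on a domain $U$ is a 1-form $\xi=\begin{pmatrix}\alpha&\lambda^{-1}\beta\\ \gamma&-\alpha\end{pmatrix}$, where $\alpha,\beta,\gamma$ are holomorphic 1-forms in $z\in U$ with values in $\mathcal W^{\ge0}$. A *gauge* on $U$ is a map $G(z,\lambda)\in SL(2,\mathbb C)$, holomorphic in $z\in U$ and $|\lambda|<\rho$, with $G(z,0)$ upper triangular; it acts by $\xi\cdot G=G^{-1}\xi G+G^{-1}dG$, where $d$ is taken in $z$. Let $\epsilon>0$ and let $(\xi_t)_{t\in(-\epsilon,\epsilon)}$, $\xi_t=\begin{pmatrix}\alpha_t&\lambda^{-1}\beta_t\\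 \gamma_t&-\alpha_t\end{pmatrix}$, be a $C^1$ family of DPW potentials on $D^*(\infty,R)$, meaning that $(t,z)\mapsto\xi_t(z,\cdot)$ is $C^1$ with values in $\mathfrak{sl}(2,\mathcal W)$. Suppose that, for every $t$, the 1-forms $\alpha_t,\beta_t,\gamma_t$ have at $z=\infty$ a pole of multiplicity at most $1,2,1$ respectively (entrywise, $\xi_t$ has a pole of multiplicity at most $\begin{pmatrix}1&2\\1&1\end{pmatrix}$), and that $\xi_0=\begin{pmatrix}0&\lambda^{-1}\\0&0\end{pmatrix}dz$. Let $\Phi_t$ be a $C^1$ family of solutions of $d\Phi_t=\Phi_t\xi_t$ on $\widetilde{D^*}(\infty,R)$, meaning that $(t,z)\mapsto\Phi_t(z,\cdot)$ is $C^1$ with values in $SL(2,\mathcal W)$. Assume that $\Phi_0(\widetilde z_0,\cdot)$ is holomorphic in the annulus $\{\rho'^{-1}<|\lambda|<\rho'\}$ for some $\rho'>\rho$, and that for all $t\in(-\epsilon,\epsilon)$: 1. $\Phi_t$ solves the Monodromy Problem with respect to $\sigma$: the monodromy $M_t(\lambda)=\Phi_t(\sigma(\widetilde z_0),\lambda)\,\Phi_t(\widetilde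 z_0,\lambda)^{-1}$ satisfies $M_t(\lambda)\in SU(2)$ for $|\lambda|=1$, $M_t(1)=\pm I_2$ and $\frac{\partial M_t}{\partial\lambda}(1)=0$; 2. $\operatorname{Res}_\infty\gamma_t^0=0$; 3. $\operatorname{Re}\big(\operatorname{Res}_\infty(z\gamma_t^0)\big)=0$. Then for all $t$ small enough, $\infty$ is a removable singularity of $\xi_t$: there is a gauge $G_t$ on $D^*(\infty,R)$ such that $\xi_t\cdot G_t$ extends to a DPW potential holomorphic at $\infty$. Moreover $G_t$ can be taken of the form $$G_t(z,\lambda)=\begin{pmatrix}z&0\\ \lambda g_t(\lambda)&z^{-1}\end{pmatrix},\qquad g_t\in\mathcal W^{\ge0}.$$ -/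

import Mathlib

open Set Filter Topology

noncomputable section

namespace DPW

/-! ### The weighted Wiener algebra -/

/-- The sequences of Fourier coefficients `(c_n)` with `∑ |c_n| ρ^|n| < ∞`, for a fixed `ρ > 1`. -/
def wienerSubmodule (ρ : ℝ) [hρ : Fact (1 < ρ)] : Submodule ℂ (ℤ → ℂ) where
  carrier := {c | Summable fun n : ℤ => ‖c n‖ * ρ ^ |n|}
  zero_mem' := by simp [summable_zero]
  add_mem' := by
    intro a b ha hb
    have h0 : (0 : ℝ) ≤ ρ := (zero_lt_one.trans hρ.out).le
    refine Summable.of_nonneg_of_le (fun n => by positivity) (fun n => ?_) (Summable.add ha hb)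
    rw [← add_mul]
    exact mul_le_mul_of_nonneg_right (norm_add_le _ _) (by positivity)
  smul_mem' := by
    intro k a ha
    refine (Summable.mul_left ‖k‖ ha).congr (fun n => ?_)
    simp [mul_assoc]

/-- The space `𝓦` of functions `f(λ) = ∑ c_n λ^n` of the loop variable with
`‖f‖ = ∑ |c_n| ρ^|n| < ∞`, represented by their Fourier coefficients. -/
def Wiener (ρ : ℝ) [Fact (1 < ρ)] : Type := wienerSubmodule ρ

namespace Wiener

variable {ρ : ℝ} [hρ : Fact (1 < ρ)]

instance : AddCommGroup (Wiener ρ) := inferInstanceAs (AddCommGroup (wienerSubmodule ρ))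

instance : Module ℂ (Wiener ρ) := inferInstanceAs (Module ℂ (wienerSubmodule ρ))

/-- The `n`-th Fourier coefficient. -/
def coeff (f : Wiener ρ) (n : ℤ) : ℂ := f.1 n

theorem summable_coeff (f : Wiener ρ) : Summable fun n : ℤ => ‖f.coeff n‖ * ρ ^ |n| := f.2

theorem coeff_add (f g : Wiener ρ) (n : ℤ) : (f + g).coeff n = f.coeff n + g.coeff n := rfl

theorem coeff_smul (k : ℂ) (f : Wiener ρ) (n : ℤ) : (k • f).coeff n = k * f.coeff n := rfl

theorem coeff_zero (n : ℤ) : (0 : Wiener ρ).coeff n = 0 := rfl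

theorem ext_coeff {f g : Wiener ρ} (h : ∀ n, f.coeff n = g.coeff n) : f = g :=
  Subtype.ext (funext h)

instance : Norm (Wiener ρ) := ⟨fun f => ∑' n : ℤ, ‖f.coeff n‖ * ρ ^ |n|⟩

theorem norm_def (f : Wiener ρ) : ‖f‖ = ∑' n : ℤ, ‖f.coeff n‖ * ρ ^ |n| := rfl

theorem normCore : NormedSpace.Core ℂ (Wiener ρ) where
  norm_nonneg f := by
    have h0 : (0 : ℝ) ≤ ρ := (zero_lt_one.trans hρ.out).le
    exact tsum_nonneg fun n => by positivity
  norm_smul k f := by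
    simp only [norm_def, coeff_smul, norm_mul, mul_assoc, tsum_mul_left]
  norm_triangle f g := by
    have h0 : (0 : ℝ) ≤ ρ := (zero_lt_one.trans hρ.out).le
    simp only [norm_def]
    rw [← f.summable_coeff.tsum_add g.summable_coeff]
    refine Summable.tsum_le_tsum (fun n => ?_) (f + g).summable_coeff
      (f.summable_coeff.add g.summable_coeff)
    rw [← add_mul, coeff_add]
    exact mul_le_mul_of_nonneg_right (norm_add_le _ _) (by positivity)
  norm_eq_zero_iff f := by
    have h0 : (0 : ℝ) < ρ := zero_lt_one.trans hρ.out
    constructor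
    · intro h
      have h1 := (hasSum_zero_iff_of_nonneg (fun n => by positivity)).1
        (h ▸ f.summable_coeff.hasSum : HasSum (fun n : ℤ => ‖f.coeff n‖ * ρ ^ |n|) 0)
      refine ext_coeff fun n => ?_
      have h2 := congrFun h1 n
      have h3 : ρ ^ |n| ≠ 0 := (zpow_pos h0 _).ne'
      simpa [h3, coeff_zero] using h2
    · rintro rfl
      simp [norm_def, coeff_zero]

instance : NormedAddCommGroup (Wiener ρ) := NormedAddCommGroup.ofCore normCore

instance : NormedSpace ℂ (Wiener ρ) := NormedSpace.ofCore normCore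

/-- The value `f(λ) = ∑ c_n λ^n`. The series converges absolutely on the annulus
`ρ⁻¹ ≤ |λ| ≤ ρ`, and on the disk `|λ| ≤ ρ` if `f` has no negative Fourier coefficient. -/
def eval (f : Wiener ρ) (l : ℂ) : ℂ := ∑' n : ℤ, f.coeff n * l ^ n

/-- `f ∈ 𝓦^{≥0}`: all Fourier coefficients of negative index vanish. -/
def IsNonneg (f : Wiener ρ) : Prop := ∀ n : ℤ, n < 0 → f.coeff n = 0

end Wiener

variable {ρ : ℝ} [Fact (1 < ρ)]

/-- Value at `λ` of a matrix with entries in `𝓦`. -/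
def evalMatrix (A : Matrix (Fin 2) (Fin 2) (Wiener ρ)) (l : ℂ) : Matrix (Fin 2) (Fin 2) ℂ :=
  Matrix.of fun i j => (A i j).eval l

/-! ### Potentials and gauges -/

/-- `D^*(∞,R) = {z ∈ ℂ : |z| > R⁻¹}`. -/
def puncturedDiskInfty (R : ℝ) : Set ℂ := {z | R⁻¹ < ‖z‖}

/-- `(α, β, γ)` are the entries (with respect to `dz`) of a DPW potential on `U`: they are
holomorphic in `z ∈ U` with values in `𝓦^{≥0}`. -/
structure IsPotential (U : Set ℂ) (α β γ : ℂ → Wiener ρ) : Prop where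
  holo_α : DifferentiableOn ℂ α U
  holo_β : DifferentiableOn ℂ β U
  holo_γ : DifferentiableOn ℂ γ U
  nonneg_α : ∀ z ∈ U, (α z).IsNonneg
  nonneg_β : ∀ z ∈ U, (β z).IsNonneg
  nonneg_γ : ∀ z ∈ U, (γ z).IsNonneg

/-- The matrix `ξ(z,λ) = (α, λ⁻¹β; γ, -α)`, the coefficient of `dz` in the potential. -/
def potential (α β γ : ℂ → Wiener ρ) (z l : ℂ) : Matrix (Fin 2) (Fin 2) ℂ :=
  !![(α z).eval l, l⁻¹ * (β z).eval l; (γ z).eval l, -(α z).eval l]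

/-- A gauge on `U`: a map `G(z,λ)` into `SL(2,ℂ)`, holomorphic in `z ∈ U` and `λ ∈ 𝔻_ρ`, such that
`G(z,0)` is upper triangular. -/
structure IsGauge (ρ : ℝ) (U : Set ℂ) (G : ℂ → ℂ → Matrix (Fin 2) (Fin 2) ℂ) : Prop where
  holo : ∀ i j, DifferentiableOn ℂ (fun p : ℂ × ℂ => G p.1 p.2 i j) (U ×ˢ Metric.ball 0 ρ)
  det_eq_one : ∀ z ∈ U, ∀ l ∈ Metric.ball (0 : ℂ) ρ, (G z l).det = 1
  upper : ∀ z ∈ U, G z 0 1 0 = 0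

/-- The gauged potential `ξ · G = G⁻¹ ξ G + G⁻¹ dG` (coefficient of `dz`). -/
def gaugeAction (ξ G : ℂ → ℂ → Matrix (Fin 2) (Fin 2) ℂ) (z l : ℂ) : Matrix (Fin 2) (Fin 2) ℂ :=
  (G z l)⁻¹ * ξ z l * G z l + (G z l)⁻¹ * Matrix.of fun i j => deriv (fun x => G x l i j) z

/-- The matrix-valued 1-form `η(z,λ) dz` on `D^*(∞,R)` extends to a DPW potential which is
holomorphic at `∞`. In the coordinate `w = 1/z`, the extension is a potential on `|w| < R`,
and `dw = -z⁻² dz`. -/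
def ExtendsAtInfty (ρ : ℝ) [Fact (1 < ρ)] (R : ℝ) (η : ℂ → ℂ → Matrix (Fin 2) (Fin 2) ℂ) : Prop :=
  ∃ a b c : ℂ → Wiener ρ, IsPotential (Metric.ball 0 R) a b c ∧
    ∀ z ∈ puncturedDiskInfty R, ∀ l : ℂ, l ≠ 0 → ‖l‖ < ρ →
      η z l = (-(z ^ 2)⁻¹) • potential a b c z⁻¹ l

/-- The 1-form `f(z) dz` has a pole of multiplicity at most `m` at `z = ∞`. In the coordinate
`w = 1/z`, this form is `-w⁻² f(w⁻¹) dw`. -/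
def PoleAtInftyLE (m : ℕ) (f : ℂ → Wiener ρ) : Prop :=
  MeromorphicAt (fun w : ℂ => (-(w ^ 2)⁻¹) • f w⁻¹) 0 ∧
    ((-(m : ℤ) : ℤ) : WithTop ℤ) ≤ meromorphicOrderAt (fun w : ℂ => (-(w ^ 2)⁻¹) • f w⁻¹) 0

/-- The residue at `∞` of the 1-form `f(z) dz`, namely `-(2πi)⁻¹ ∮ f dz` over a large circle in the
positive direction. If `f` is holomorphic near `∞`, the integral is independent of the radius
as soon as the radius is large. -/
def residueInfty (f : ℂ → ℂ) : ℂ :=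
  limUnder atTop fun r : ℝ => -(2 * Real.pi * Complex.I)⁻¹ * ∮ z in C(0, r), f z

/-! ### Solutions and the Monodromy Problem

The universal cover of `D^*(∞,R)` is the half plane `Re ζ > -log R` with covering map
`z = exp ζ`; the group of deck transformations is generated by `σ(ζ) = ζ + 2πi`. -/

/-- The universal cover of `D^*(∞,R)`, with covering map `exp`. -/
def universalCover (R : ℝ) : Set ℂ := {ζ | -Real.log R < ζ.re}

/-- `Φ` is a solution of `dΦ = Φ ξ` on the universal cover of `D^*(∞,R)` with values in
`SL(2,ℂ)` for `λ` in the unit circle. -/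
structure IsSolution (R : ℝ) (ξ : ℂ → ℂ → Matrix (Fin 2) (Fin 2) ℂ)
    (Φ : ℂ → Matrix (Fin 2) (Fin 2) (Wiener ρ)) : Prop where
  det_eq_one : ∀ ζ ∈ universalCover R, ∀ l : ℂ, ‖l‖ = 1 → (evalMatrix (Φ ζ) l).det = 1
  hasDerivAt : ∀ ζ ∈ universalCover R, ∀ l : ℂ, ‖l‖ = 1 → ∀ i j,
    HasDerivAt (fun x => evalMatrix (Φ x) l i j)
      ((evalMatrix (Φ ζ) l * ξ (Complex.exp ζ) l) i j * Complex.exp ζ) ζ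

/-- The monodromy `𝓜(Φ,σ)(λ) = Φ(σ(ζ),λ) Φ(ζ,λ)⁻¹` with respect to the generator
`σ(ζ) = ζ + 2πi`, computed at the point `ζ`. For a solution it does not depend on `ζ`. -/
def monodromy (Φ : ℂ → Matrix (Fin 2) (Fin 2) (Wiener ρ)) (ζ l : ℂ) : Matrix (Fin 2) (Fin 2) ℂ :=
  evalMatrix (Φ (ζ + 2 * Real.pi * Complex.I)) l * (evalMatrix (Φ ζ) l)⁻¹

/-- The Monodromy Problem with respect to `σ`. -/
structure SolvesMonodromyProblem (Φ : ℂ → Matrix (Fin 2) (Fin 2) (Wiener ρ)) (ζ : ℂ) : Prop where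
  unitary : ∀ l : ℂ, ‖l‖ = 1 → monodromy Φ ζ l ∈ Matrix.specialUnitaryGroup (Fin 2) ℂ
  eq_pm_one : monodromy Φ ζ 1 = 1 ∨ monodromy Φ ζ 1 = -1
  deriv_eq_zero : ∀ i j, HasDerivAt (fun l => monodromy Φ ζ l i j) 0 1

/-- The loop `A(λ)` is holomorphic in the annulus `ρ'⁻¹ < |λ| < ρ'`. -/
def HolomorphicInAnnulus (ρ' : ℝ) (A : Matrix (Fin 2) (Fin 2) (Wiener ρ)) : Prop :=
  ∀ i j, ∃ F : ℂ → ℂ, DifferentiableOn ℂ F {l | ρ'⁻¹ < ‖l‖ ∧ ‖l‖ < ρ'} ∧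
    ∀ l : ℂ, ‖l‖ = 1 → evalMatrix A l i j = F l

end DPW

end

/-! ### Analysis in the weighted Wiener algebra -/

noncomputable section

namespace DPW

namespace Wiener

variable {ρ : ℝ} [hρ : Fact (1 < ρ)]

/-! Put $w=1/z$ and write the entries of $\xi_t$ as $A(w),\lambda^{-1}B(w),C(w)$; the pole
conditions make $A,B,C$ holomorphic at $w=0$ with $A(0)=C(0)=0$, and for small $t$ they are close to
$0,1,0$. Choosing $g$ with $B(0)g=-(1+A'(0))$ removes the pole of the diagonal of the gauged
potential. Its upper right entry is then regular as well, so the only singular part left is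
$(pz+q+r/z)\,dz$ in the lower left corner, with $p,q,r\in\mathcal W^{\ge0}$. The terms that $g$
contributes to that corner carry a factor $\lambda$, so the residue conditions read $p^0=0$ and
$\operatorname{Re}q^0=0$ (`exists_gaugeData`). What has to be shown is $p=q=r=0$.

Fix $\lambda$ on the unit circle and let $d$ be the largest of $|p|,|q|,|r|$ there. The regular part
of the potential can be integrated on a full disk around $w=0$ and creates no monodromy. Hence
$N=M-1$ satisfies $NV=V(2\pi iX)+o(d)$, where $V$ is uniformly bounded with its inverse and $X$ is
the residue matrix, with entries $q/\lambda,-r/\lambda^2,p,-q/\lambda$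
(`norm_monodromy_sub_residue_le`). It is essential that the error is small relative to $d$, and not
only relative to the size of the perturbation. Three things follow (`residue_estimates`). First,
$\|N\|$ is comparable to $d$. Second, $N$ lies in the real span of $SU(2)$ and has almost zero
trace, so $\operatorname{tr}N^2$ is negative up to a small error. Third, comparison with
$\operatorname{tr}(2\pi iX)^2$ gives $\operatorname{Re}\big((q^2-pr)/\lambda^2\big)>0$ wherever
$d>0$.

At $\lambda=1$ smallness excludes $M=-1$, so $M-1$ vanishes there to second order, and so do
$p,q,r$. Write $p=(\lambda-1)^2P$, $q=(\lambda-1)^2Q$, $r=(\lambda-1)^2S$. On the circle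
$(\lambda-1)^4/\lambda^2=|\lambda-1|^4$, so $h=Q^2-PS$ has $\operatorname{Re}h\ge0$ there, while
$\operatorname{Re}h(0)=\operatorname{Re}\,(q^0)^2\le0$. The maximum principle for $e^{-h}$ forces
$\operatorname{Re}h=0$ on the circle, and strict positivity then gives $p=q=r=0$
(`eq_zero_on_circle_of_re_pos`, `singular_part_eq_zero`). -/

theorem radius_pos : 0 < ρ := zero_lt_one.trans hρ.out

theorem one_le_weight (n : ℤ) : 1 ≤ ρ ^ |n| := by
  obtain ⟨k, hk⟩ := Int.eq_ofNat_of_zero_le (abs_nonneg n)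
  rw [hk]
  simpa using one_le_pow₀ hρ.out.le

/-- Rescaling the Fourier coefficients by the weights identifies `𝓦` with `ℓ¹`. -/
def toLp : Wiener ρ ≃ₗᵢ[ℂ] lp (fun _ : ℤ => ℂ) 1 where
  toFun f := ⟨fun n => f.coeff n * (ρ : ℂ) ^ |n|, by
    have h0 : (0 : ℝ) < ρ := radius_pos
    refine (memℓp_gen_iff (by simp)).2 ?_
    simpa [abs_of_pos h0] using f.summable_coeff⟩
  invFun f := ⟨fun n => f n * ((ρ : ℂ) ^ |n|)⁻¹, by
    have h0 : (0 : ℝ) < ρ := radius_pos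
    have h1 := (memℓp_gen_iff (by simp)).1 f.2
    refine Summable.congr (by simpa using h1) fun n => ?_
    have h2 : ρ ^ |n| ≠ 0 := (zpow_pos h0 _).ne'
    simp [abs_of_pos h0, h2]⟩
  map_add' f g := by
    ext n
    exact add_mul (f.coeff n) (g.coeff n) _
  map_smul' k f := by
    ext n
    simp [coeff_smul, mul_assoc]
  left_inv f := by
    refine ext_coeff fun n => ?_
    have h2 : (ρ : ℂ) ^ |n| ≠ 0 :=
      zpow_ne_zero _ (by exact_mod_cast (radius_pos (ρ := ρ)).ne')
    exact mul_inv_cancel_right₀ h2 _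
  right_inv f := by
    ext n
    have h2 : (ρ : ℂ) ^ |n| ≠ 0 :=
      zpow_ne_zero _ (by exact_mod_cast (radius_pos (ρ := ρ)).ne')
    exact inv_mul_cancel_right₀ h2 _
  norm_map' f := by
    have h0 : (0 : ℝ) < ρ := radius_pos
    rw [lp.norm_eq_tsum_rpow (by simp), norm_def]
    simp only [ENNReal.toReal_one, Real.rpow_one, ne_eq, one_ne_zero, not_false_eq_true, div_self]
    refine tsum_congr fun n => ?_
    change ‖f.coeff n * (ρ : ℂ) ^ |n|‖ = _
    simp [abs_of_pos h0]

/-- Completeness is what the Neumann series and the removable singularity results for $\mathcal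
W$-valued functions require. -/
instance : CompleteSpace (Wiener ρ) :=
  (toLp (ρ := ρ)).toIsometryEquiv.completeSpace

theorem norm_coeff_mul_le (f : Wiener ρ) (n : ℤ) : ‖f.coeff n‖ * ρ ^ |n| ≤ ‖f‖ := by
  have h0 : (0 : ℝ) < ρ := radius_pos
  exact f.summable_coeff.le_tsum n fun m _ => by positivity

theorem norm_coeff_le (f : Wiener ρ) (n : ℤ) : ‖f.coeff n‖ ≤ ‖f‖ :=
  (le_mul_of_one_le_right (norm_nonneg _) (one_le_weight n)).trans (norm_coeff_mul_le f n)

/-- The `n`-th Fourier coefficient as a continuous linear form. -/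
def coeffL (n : ℤ) : Wiener ρ →L[ℂ] ℂ :=
  LinearMap.mkContinuous
    { toFun := fun f => f.coeff n
      map_add' := fun f g => coeff_add f g n
      map_smul' := fun k f => coeff_smul k f n } 1 fun f => by
        simpa using norm_coeff_le f n

@[simp] theorem coeffL_apply (n : ℤ) (f : Wiener ρ) : coeffL n f = f.coeff n := rfl

theorem norm_coeffL_le (n : ℤ) : ‖(coeffL n : Wiener ρ →L[ℂ] ℂ)‖ ≤ (ρ ^ |n|)⁻¹ := by
  have h0 : 0 < ρ ^ |n| := zpow_pos radius_pos _
  refine ContinuousLinearMap.opNorm_le_bound _ (by positivity) fun f => ?_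
  rw [coeffL_apply, inv_mul_eq_div, le_div_iff₀ h0]
  exact norm_coeff_mul_le f n

theorem summable_coeff_nat (f : Wiener ρ) : Summable fun n : ℕ => ‖f.coeff n‖ * ρ ^ n := by
  simpa [Function.comp_def] using
    f.summable_coeff.comp_injective (Nat.cast_injective (R := ℤ))

theorem tsum_coeff_nat_le (f : Wiener ρ) : ∑' n : ℕ, ‖f.coeff n‖ * ρ ^ n ≤ ‖f‖ := by
  have h0 : (0 : ℝ) < ρ := radius_pos
  have := tsum_comp_le_tsum_of_inj f.summable_coeff (fun n => by positivity)
    (Nat.cast_injective (R := ℤ))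
  rw [norm_def]
  simpa [Function.comp_def] using this

theorem norm_eval_le (f : Wiener ρ) {l : ℂ} (hl : ‖l‖ = 1) : ‖f.eval l‖ ≤ ‖f‖ := by
  have h0 : (0 : ℝ) < ρ := radius_pos
  have h1 : ∀ n : ℤ, ‖f.coeff n * l ^ n‖ ≤ ‖f.coeff n‖ * ρ ^ |n| := fun n => by
    rw [norm_mul, norm_zpow, hl, one_zpow]
    exact mul_le_mul_of_nonneg_left (one_le_weight n) (norm_nonneg _)
  have h2 := Summable.of_nonneg_of_le (fun _ => norm_nonneg _) h1 f.summable_coeff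
  exact (norm_tsum_le_tsum_norm h2).trans (Summable.tsum_le_tsum h1 h2 f.summable_coeff)

/-- The sum `∑_{n ≥ 0} c_n λ^n` as a continuous linear form, for `|λ| < ρ`. -/
def evalNonneg (l : ℂ) : Wiener ρ →L[ℂ] ℂ := ∑' n : ℕ, l ^ n • coeffL (n : ℤ)

/-- The weights bound the $n$-th term in operator norm by $(|\lambda|/\rho)^n$. As a continuous
linear form, evaluation passes through series and through complex differentiation in $z$. -/
theorem evalNonneg_apply (f : Wiener ρ) {l : ℂ} (hl : ‖l‖ < ρ) :
    evalNonneg l f = ∑' n : ℕ, f.coeff n * l ^ n := by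
  have h0 : (0 : ℝ) < ρ := radius_pos
  have hs : Summable fun n : ℕ => l ^ n • (coeffL (n : ℤ) : Wiener ρ →L[ℂ] ℂ) := by
    refine Summable.of_norm_bounded (g := fun n : ℕ => (‖l‖ / ρ) ^ n)
      (summable_geometric_of_lt_one (by positivity) ((div_lt_one h0).2 hl)) fun n => ?_
    rw [norm_smul, norm_pow, div_pow, div_eq_mul_inv]
    have := norm_coeffL_le (ρ := ρ) (n : ℤ)
    rw [Nat.abs_cast, zpow_natCast] at this
    gcongr
  have := (ContinuousLinearMap.apply ℂ ℂ f).map_tsum hs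
  simp only [ContinuousLinearMap.apply_apply] at this
  rw [evalNonneg, this]
  simp [mul_comm]

theorem eval_eq_tsum_nat {f : Wiener ρ} (hf : f.IsNonneg) (l : ℂ) :
    f.eval l = ∑' n : ℕ, f.coeff n * l ^ n := by
  rw [eval]
  refine ((Nat.cast_injective (R := ℤ)).tsum_eq ?_).symm.trans (by simp)
  intro n hn
  by_contra h
  refine hn ?_
  have : n < 0 := by
    by_contra h'
    exact h ⟨n.toNat, by simpa using h'⟩
  simp [hf n this]

theorem eval_eq_evalNonneg {f : Wiener ρ} (hf : f.IsNonneg) {l : ℂ} (hl : ‖l‖ < ρ) :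
    f.eval l = evalNonneg l f := by
  rw [eval_eq_tsum_nat hf, evalNonneg_apply f hl]

theorem eval_zero_eq_coeff {f : Wiener ρ} (hf : f.IsNonneg) : f.eval 0 = f.coeff 0 := by
  rw [eval_eq_tsum_nat hf, tsum_eq_single 0 (fun n hn => by simp [hn])]
  simp

theorem differentiableOn_eval {f : Wiener ρ} (hf : f.IsNonneg) :
    DifferentiableOn ℂ f.eval (Metric.ball 0 ρ) := by
  have : f.eval = fun l => ∑' n : ℕ, f.coeff n * l ^ n := funext (eval_eq_tsum_nat hf)
  rw [this]
  refine Complex.differentiableOn_tsum_of_summable_norm f.summable_coeff_nat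
    (fun n => by fun_prop) Metric.isOpen_ball fun n l hl => ?_
  rw [norm_mul, norm_pow]
  have : ‖l‖ ≤ ρ := by simpa using (mem_ball_zero_iff.1 hl).le
  gcongr

/-- A function in `𝓦^{≥0}` that vanishes on the unit circle is zero. -/
theorem eq_zero_of_eval_eq_zero {f : Wiener ρ} (hf : f.IsNonneg)
    (h : ∀ l : ℂ, ‖l‖ = 1 → f.eval l = 0) : f = 0 := by
  have h0 : (0 : ℝ) < ρ := radius_pos
  have hA : AnalyticOnNhd ℂ f.eval (Metric.ball 0 ρ) :=
    (differentiableOn_eval hf).analyticOnNhd Metric.isOpen_ball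
  have h1 : (1 : ℂ) ∈ Metric.ball (0 : ℂ) ρ := by simpa using hρ.out
  have hz : EqOn f.eval 0 (Metric.ball 0 ρ) := by
    refine hA.eqOn_zero_of_preconnected_of_frequently_eq_zero
      (convex_ball (0 : ℂ) ρ).isPreconnected h1 ?_
    -- The zeros $e^{ix}$, $x\to0^+$, accumulate at the interior point $1$ of the disk of radius
    -- $\rho>1$, as the identity theorem needs.
    have ht : Tendsto (fun x : ℝ => Complex.exp (x * Complex.I)) (𝓝[>] 0) (𝓝[≠] 1) := by
      refine tendsto_nhdsWithin_iff.2 ⟨?_, ?_⟩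
      · have : Continuous fun x : ℝ => Complex.exp (x * Complex.I) := by fun_prop
        have := this.tendsto 0
        simp only [Complex.ofReal_zero, zero_mul, Complex.exp_zero] at this
        exact this.mono_left nhdsWithin_le_nhds
      · filter_upwards [Ioo_mem_nhdsGT (show (0 : ℝ) < 1 by norm_num)] with x hx hx1
        have := congrArg Complex.im hx1
        rw [Complex.exp_ofReal_mul_I_im] at this
        exact (Real.sin_pos_of_pos_of_lt_pi hx.1 (by linarith [hx.2, Real.pi_gt_three])).ne'
          (by simpa using this)
    exact ht.frequently (Eventually.of_forall fun x => h _ (Complex.norm_exp_ofReal_mul_I x)).frequently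
  have hp : HasFPowerSeriesAt f.eval
      (FormalMultilinearSeries.ofScalars ℂ fun n : ℕ => f.coeff n) 0 := by
    rw [hasFPowerSeriesAt_iff]
    filter_upwards [Metric.ball_mem_nhds (0 : ℂ) h0] with l hl
    have hs : Summable fun n : ℕ => f.coeff n * l ^ n := by
      refine Summable.of_norm_bounded f.summable_coeff_nat fun n => ?_
      rw [norm_mul, norm_pow]
      have : ‖l‖ ≤ ρ := by simpa using (mem_ball_zero_iff.1 hl).le
      gcongr
    have := hs.hasSum
    rw [← eval_eq_tsum_nat hf] at this
    simpa [FormalMultilinearSeries.coeff_ofScalars, mul_comm] using this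
  have hp0 := (hp.congr (Filter.eventuallyEq_of_mem (Metric.ball_mem_nhds (0 : ℂ) h0) hz)).eq_zero
  refine ext_coeff fun n => ?_
  rw [coeff_zero]
  by_cases hn : n < 0
  · exact hf n hn
  · lift n to ℕ using by omega
    have := congrArg (fun p : FormalMultilinearSeries ℂ ℂ ℂ => p.coeff n) hp0
    exact FormalMultilinearSeries.coeff_ofScalars.symm.trans (this.trans rfl)

theorem IsNonneg.add {f g : Wiener ρ} (hf : f.IsNonneg) (hg : g.IsNonneg) :
    (f + g).IsNonneg := fun n hn => by rw [coeff_add, hf n hn, hg n hn, add_zero]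

theorem IsNonneg.smul {f : Wiener ρ} (hf : f.IsNonneg) (k : ℂ) : (k • f).IsNonneg :=
  fun n hn => by rw [coeff_smul, hf n hn, mul_zero]

theorem IsNonneg.neg {f : Wiener ρ} (hf : f.IsNonneg) : (-f).IsNonneg := by
  simpa using hf.smul (-1)

theorem IsNonneg.sub {f g : Wiener ρ} (hf : f.IsNonneg) (hg : g.IsNonneg) :
    (f - g).IsNonneg := by
  simpa [sub_eq_add_neg] using hf.add hg.neg

theorem isNonneg_tsum {ι : Type*} {F : ι → Wiener ρ} (hs : Summable F)
    (hF : ∀ i, (F i).IsNonneg) : (∑' i, F i).IsNonneg := fun n hn => by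
  rw [← coeffL_apply, (coeffL n).map_tsum hs]
  simp [hF _ n hn]

/-- The constant function `1`. -/
instance : One (Wiener ρ) := ⟨⟨Pi.single 0 1, by
  refine summable_of_ne_finset_zero (s := {0}) fun n hn => ?_
  have : n ≠ 0 := by simpa using hn
  simp [this]⟩⟩

theorem coeff_one (n : ℤ) : (1 : Wiener ρ).coeff n = (Pi.single 0 1 : ℤ → ℂ) n := rfl

theorem isNonneg_one : (1 : Wiener ρ).IsNonneg := fun n hn => by
  rw [coeff_one]; simp [hn.ne]

theorem eval_one (l : ℂ) : (1 : Wiener ρ).eval l = 1 := by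
  rw [eval, tsum_eq_single 0 (fun n hn => by simp [coeff_one, hn])]
  simp [coeff_one]

theorem norm_one' : ‖(1 : Wiener ρ)‖ = 1 := by
  rw [norm_def, tsum_eq_single 0 (fun n hn => by simp [coeff_one, hn])]
  simp [coeff_one]

theorem summable_shift (f : Wiener ρ) :
    Summable fun n : ℤ => ‖f.coeff (n - 1)‖ * ρ ^ |n - 1| :=
  f.summable_coeff.comp_injective (sub_left_injective (b := (1 : ℤ)))

theorem shift_bound (f : Wiener ρ) (n : ℤ) :
    ‖f.coeff (n - 1)‖ * ρ ^ |n| ≤ ρ * (‖f.coeff (n - 1)‖ * ρ ^ |n - 1|) := by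
  have h0 : (0 : ℝ) < ρ := radius_pos
  have h1 : ρ ^ |n| ≤ ρ ^ (1 + |n - 1|) := by
    refine zpow_le_zpow_right₀ hρ.out.le ?_
    have := abs_add_le 1 (n - 1)
    simpa using this
  rw [zpow_add₀ h0.ne', zpow_one] at h1
  calc _ ≤ ‖f.coeff (n - 1)‖ * (ρ * ρ ^ |n - 1|) := by gcongr
    _ = _ := by ring

/-- Multiplication by `λ`. -/
def shift : Wiener ρ →L[ℂ] Wiener ρ :=
  LinearMap.mkContinuous
    { toFun := fun f => ⟨fun n => f.coeff (n - 1), by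
        have h0 : (0 : ℝ) < ρ := radius_pos
        exact Summable.of_nonneg_of_le (fun n => by positivity) (shift_bound f)
          (f.summable_shift.mul_left ρ)⟩
      map_add' := fun f g => rfl
      map_smul' := fun k f => rfl } ρ fun f => by
        have h0 : (0 : ℝ) < ρ := radius_pos
        rw [norm_def, norm_def]
        refine (Summable.tsum_le_tsum (shift_bound f) ?_ (f.summable_shift.mul_left ρ)).trans ?_
        · exact Summable.of_nonneg_of_le (fun n => by positivity) (shift_bound f)
            (f.summable_shift.mul_left ρ)
        · rw [tsum_mul_left]
          refine mul_le_mul_of_nonneg_left ?_ h0.le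
          exact ((Equiv.subRight (1 : ℤ)).tsum_eq fun n => ‖f.coeff n‖ * ρ ^ |n|).le

theorem coeff_shift (f : Wiener ρ) (n : ℤ) : (shift f).coeff n = f.coeff (n - 1) := rfl

theorem norm_shift_le : ‖(shift : Wiener ρ →L[ℂ] Wiener ρ)‖ ≤ ρ :=
  LinearMap.mkContinuous_norm_le _ radius_pos.le _

theorem IsNonneg.shift {f : Wiener ρ} (hf : f.IsNonneg) : (shift f).IsNonneg := fun n hn => by
  rw [coeff_shift, hf _ (by omega)]

theorem IsNonneg.shift_pow {f : Wiener ρ} (hf : f.IsNonneg) (k : ℕ) :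
    ((Wiener.shift ^ k) f).IsNonneg := by
  induction k with
  | zero => simpa using hf
  | succ k ih => rw [pow_succ']; exact ih.shift

theorem coeff_zero_shift {f : Wiener ρ} (hf : f.IsNonneg) : (shift f).coeff 0 = 0 := by
  rw [coeff_shift, hf _ (by omega)]

theorem evalNonneg_shift {f : Wiener ρ} (hf : f.IsNonneg) {l : ℂ} (hl : ‖l‖ < ρ) :
    evalNonneg l (shift f) = l * evalNonneg l f := by
  have h0 : (0 : ℝ) < ρ := radius_pos
  have hs : Summable fun n : ℕ => (shift f).coeff n * l ^ n := by
    refine Summable.of_norm_bounded (shift f).summable_coeff_nat fun n => ?_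
    rw [norm_mul, norm_pow]
    gcongr
  rw [evalNonneg_apply _ hl, evalNonneg_apply _ hl, hs.tsum_eq_zero_add, ← tsum_mul_left]
  simp [coeff_shift, hf (-1) (by omega), pow_succ]
  exact tsum_congr fun n => by ring

theorem evalNonneg_shift_pow {f : Wiener ρ} (hf : f.IsNonneg) {l : ℂ} (hl : ‖l‖ < ρ) (k : ℕ) :
    evalNonneg l ((shift ^ k) f) = l ^ k * evalNonneg l f := by
  induction k with
  | zero => simp
  | succ k ih =>
    rw [pow_succ', mul_apply_eq_comp, evalNonneg_shift (hf.shift_pow k) hl, ih]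
    ring

/-- Multiplication by an element of `𝓦^{≥0}`. -/
def mulL (g : Wiener ρ) : Wiener ρ →L[ℂ] Wiener ρ := ∑' n : ℕ, g.coeff n • shift ^ n

theorem norm_mulL_term_le (g : Wiener ρ) (n : ℕ) :
    ‖g.coeff n • (shift : Wiener ρ →L[ℂ] Wiener ρ) ^ n‖ ≤ ‖g.coeff n‖ * ρ ^ n := by
  have h1 : ‖(shift : Wiener ρ →L[ℂ] Wiener ρ) ^ n‖ ≤ ρ ^ n := by
    induction n with
    | zero => rw [pow_zero, pow_zero]; exact ContinuousLinearMap.norm_id_le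
    | succ n ih =>
      rw [pow_succ, pow_succ]
      exact (norm_mul_le _ _).trans
        (mul_le_mul ih norm_shift_le (norm_nonneg _) (pow_nonneg radius_pos.le _))
  rw [norm_smul]
  gcongr

theorem summable_mulL (g : Wiener ρ) :
    Summable fun n : ℕ => g.coeff n • (shift : Wiener ρ →L[ℂ] Wiener ρ) ^ n :=
  Summable.of_norm_bounded g.summable_coeff_nat g.norm_mulL_term_le

theorem norm_mulL_le (g : Wiener ρ) : ‖mulL g‖ ≤ ‖g‖ :=
  (tsum_of_norm_bounded g.summable_coeff_nat.hasSum g.norm_mulL_term_le).trans g.tsum_coeff_nat_le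

theorem mulL_sub (f g : Wiener ρ) : mulL (f - g) = mulL f - mulL g := by
  rw [mulL, mulL, mulL, ← f.summable_mulL.tsum_sub g.summable_mulL]
  refine tsum_congr fun n => ?_
  rw [← sub_smul]
  congr 1

theorem mulL_one : mulL (1 : Wiener ρ) = 1 := by
  rw [mulL, tsum_eq_single 0 (fun n hn => by simp [coeff_one, hn])]
  simp [coeff_one]

theorem mulL_apply (g f : Wiener ρ) : mulL g f = ∑' n : ℕ, g.coeff n • (shift ^ n) f := by
  rw [mulL]
  have := (ContinuousLinearMap.apply ℂ (Wiener ρ) f).map_tsum g.summable_mulL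
  simpa using this

theorem summable_mulL_apply (g f : Wiener ρ) :
    Summable fun n : ℕ => g.coeff n • ((shift : Wiener ρ →L[ℂ] Wiener ρ) ^ n) f := by
  exact g.summable_mulL.map (ContinuousLinearMap.apply ℂ (Wiener ρ) f)
    (ContinuousLinearMap.continuous _)

theorem IsNonneg.mulL {f : Wiener ρ} (hf : f.IsNonneg) (g : Wiener ρ) :
    (Wiener.mulL g f).IsNonneg := by
  rw [mulL_apply]
  exact isNonneg_tsum (summable_mulL_apply g f) fun n => (hf.shift_pow n).smul _

/-- Only `f` has to lie in $\mathcal W^{\ge0}$: multiplying by $\lambda$ must not move a negative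
power into the range of the sum, and `mulL` ignores the negative coefficients of `g` anyway. -/
theorem evalNonneg_mulL (g : Wiener ρ) {f : Wiener ρ} (hf : f.IsNonneg) {l : ℂ} (hl : ‖l‖ < ρ) :
    evalNonneg l (mulL g f) = evalNonneg l g * evalNonneg l f := by
  rw [mulL_apply, (evalNonneg l).map_tsum (summable_mulL_apply g f), evalNonneg_apply g hl,
    ← tsum_mul_right]
  refine tsum_congr fun n => ?_
  rw [map_smul, evalNonneg_shift_pow hf hl, smul_eq_mul]
  ring

theorem norm_lt_radius {l : ℂ} (hl : ‖l‖ = 1) : ‖l‖ < ρ := hl ▸ hρ.out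

/-- Elements of $\mathcal W^{\ge0}$ are determined by their values on the unit circle, where
evaluation is multiplicative. -/
theorem mulL_comm {f g : Wiener ρ} (hf : f.IsNonneg) (hg : g.IsNonneg) :
    mulL f g = mulL g f := by
  refine sub_eq_zero.1 (eq_zero_of_eval_eq_zero ((hg.mulL f).sub (hf.mulL g)) fun l hl => ?_)
  have hl' : ‖l‖ < ρ := norm_lt_radius hl
  rw [eval_eq_evalNonneg ((hg.mulL f).sub (hf.mulL g)) hl', map_sub, evalNonneg_mulL f hg hl',
    evalNonneg_mulL g hf hl', mul_comm, sub_self]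

/-- Elements of `𝓦^{≥0}` close to `1` are invertible in `𝓦^{≥0}`. -/
theorem exists_mulL_eq {b v : Wiener ρ} (hv : v.IsNonneg)
    (h : ‖1 - b‖ < 1) : ∃ g : Wiener ρ, g.IsNonneg ∧ mulL b g = v := by
  -- Multiplication by `b` is inverted by the Neumann series of `x`, whose terms all preserve
  -- $\mathcal W^{\ge0}$.
  set x : Wiener ρ →L[ℂ] Wiener ρ := mulL (1 - b) with hx
  have hx1 : ‖x‖ < 1 := (norm_mulL_le _).trans_lt h
  have hs : Summable fun n : ℕ => x ^ n := summable_geometric_of_norm_lt_one hx1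
  have hbx : mulL b = 1 - x := by rw [hx, mulL_sub, mulL_one, sub_sub_cancel]
  refine ⟨(∑' n : ℕ, x ^ n) v, ?_, ?_⟩
  · have h1 := (ContinuousLinearMap.apply ℂ (Wiener ρ) v).map_tsum hs
    have h2 := hs.map (ContinuousLinearMap.apply ℂ (Wiener ρ) v) (ContinuousLinearMap.continuous _)
    simp only [ContinuousLinearMap.apply_apply] at h1
    rw [h1]
    refine isNonneg_tsum (by simpa [Function.comp_def] using h2) fun n => ?_
    induction n with
    | zero => simpa using hv
    | succ n ih => rw [pow_succ']; exact ih.mulL _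
  · rw [hbx, ← mul_apply_eq_comp, mul_neg_geom_series x hx1]
    rfl

end Wiener

end DPW

end

/-! ### Linear equations with holomorphic coefficients -/

noncomputable section

namespace DPW

section LinearODE

variable {𝒜 : Type*} [NormedRing 𝒜] [NormedAlgebra ℂ 𝒜]

/-- Taylor coefficients of the solution of `Q' = -κ Q`, `Q(0) = 1`, where `κ(w) = ∑ k_n w^n`. -/
def solutionCoeff (k : ℕ → 𝒜) : ℕ → 𝒜
  | 0 => 1
  | n + 1 => -(((n : ℂ) + 1)⁻¹ • ∑ i : Fin (n + 1), k (n - i) * solutionCoeff k i)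

theorem solutionCoeff_zero (k : ℕ → 𝒜) : solutionCoeff k 0 = 1 := by rw [solutionCoeff]

theorem solutionCoeff_succ (k : ℕ → 𝒜) (n : ℕ) :
    ((n : ℂ) + 1) • solutionCoeff k (n + 1) =
      -∑ p ∈ Finset.HasAntidiagonal.antidiagonal n, k p.1 * solutionCoeff k p.2 := by
  have h : ((n : ℂ) + 1) ≠ 0 := by exact_mod_cast n.succ_ne_zero
  rw [solutionCoeff, smul_neg, smul_inv_smul₀ h, ← Finset.Nat.sum_antidiagonal_swap,
    Finset.Nat.sum_antidiagonal_eq_sum_range_succ_mk, Finset.sum_range]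
  rfl

/-- The convolution has $n+1$ terms of size at most $e/s^n$, which cancels the factor $n+1$ of the
recursion; since $es\le1$, the induction closes. The second bound keeps the factor $es$ and is what
makes the solution close to $1$. -/
theorem norm_solutionCoeff_le [NormOneClass 𝒜] {k : ℕ → 𝒜} {s e : ℝ} (hs : 0 < s) (he : 0 ≤ e)
    (hk : ∀ n, ‖k n‖ ≤ e / s ^ n) (hes : e * s ≤ 1) (n : ℕ) :
    ‖solutionCoeff k n‖ ≤ (s ^ n)⁻¹ ∧ ‖solutionCoeff k (n + 1)‖ ≤ e * s * (s ^ (n + 1))⁻¹ := by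
  have key : ∀ n, (∀ m ≤ n, ‖solutionCoeff k m‖ ≤ (s ^ m)⁻¹) →
      ‖solutionCoeff k (n + 1)‖ ≤ e * s * (s ^ (n + 1))⁻¹ := by
    intro n hn
    have h1 : ‖((n : ℂ) + 1) • solutionCoeff k (n + 1)‖ ≤ ((n : ℝ) + 1) * (e / s ^ n) := by
      rw [solutionCoeff_succ, norm_neg]
      refine (norm_sum_le_of_le (f := fun p : ℕ × ℕ => k p.1 * solutionCoeff k p.2)
        (n := fun _ => e / s ^ n) _ (fun p hp => ?_)).trans (le_of_eq ?_)
      · have hp' := Finset.HasAntidiagonal.mem_antidiagonal.1 hp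
        calc ‖k p.1 * solutionCoeff k p.2‖ ≤ e / s ^ p.1 * (s ^ p.2)⁻¹ :=
              (norm_mul_le _ _).trans (mul_le_mul (hk _) (hn _ (by omega)) (norm_nonneg _)
                (by positivity))
          _ = e / s ^ n := by rw [← hp', pow_add]; field_simp
      · simp
    rw [norm_smul] at h1
    have h2 : ‖(n : ℂ) + 1‖ = (n : ℝ) + 1 := by exact_mod_cast Complex.norm_natCast (n + 1)
    rw [h2] at h1
    have h3 := le_of_mul_le_mul_left h1 (by positivity)
    calc _ ≤ _ := h3
      _ = _ := by rw [pow_succ]; field_simp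
  have all : ∀ n, ∀ m ≤ n, ‖solutionCoeff k m‖ ≤ (s ^ m)⁻¹ := by
    intro n
    induction n with
    | zero =>
      intro m hm
      obtain rfl : m = 0 := by omega
      simp [solutionCoeff_zero]
    | succ n ih =>
      intro m hm
      rcases hm.lt_or_eq with h | rfl
      · exact ih m (by omega)
      · exact (key n ih).trans (mul_le_of_le_one_left (by positivity) hes)
  exact ⟨all n n le_rfl, key n (all n)⟩

variable [CompleteSpace 𝒜] [NormOneClass 𝒜]

/-- Solvability of the linear equation `Q' = -κ Q` on a disk, with a bound on the solution. -/
theorem exists_linear_ode_solution {κ : ℂ → 𝒜} {s e : ℝ} (hs : 0 < s) (he : 0 ≤ e)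
    (hκ : DiffContOnCl ℂ κ (Metric.ball 0 s)) (hb : ∀ w ∈ Metric.sphere (0 : ℂ) s, ‖κ w‖ ≤ e)
    (hes : e * s ≤ 1) :
    ∃ Q : ℂ → 𝒜, ∀ w ∈ Metric.ball (0 : ℂ) s, HasDerivAt Q (-(κ w * Q w)) w ∧
      ‖Q w - 1‖ ≤ e * s * (1 - ‖w‖ / s)⁻¹ := by
  set k : ℕ → 𝒜 := fun n => ((n.factorial : ℂ))⁻¹ • iteratedDeriv n κ 0 with hkdef
  have hk : ∀ n, ‖k n‖ ≤ e / s ^ n := fun n => by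
    have h1 := Complex.norm_iteratedDeriv_le_of_forall_mem_sphere_norm_le n hs hκ hb
    have h2 : (0 : ℝ) < n.factorial := by exact_mod_cast n.factorial_pos
    rw [hkdef]
    simp only [norm_smul, norm_inv, Complex.norm_natCast]
    rw [inv_mul_le_iff₀ h2]
    calc _ ≤ _ := h1
      _ = _ := by ring
  have hsum : ∀ w ∈ Metric.ball (0 : ℂ) s, HasSum (fun n => w ^ n • k n) (κ w) := fun w hw => by
    have := Complex.hasSum_taylorSeries_on_ball hκ.differentiableOn hw
    simp only [sub_zero] at this
    have e1 : (fun n : ℕ => w ^ n • k n) =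
        fun n : ℕ => (n.factorial : ℂ)⁻¹ • w ^ n • iteratedDeriv n κ 0 :=
      funext fun n => smul_comm _ _ _
    rw [e1]
    exact this
  set q := solutionCoeff k with hq
  have hqb : ∀ n, ‖q n‖ ≤ (s ^ n)⁻¹ := fun n => (norm_solutionCoeff_le hs he hk hes n).1
  have hqb' : ∀ n, ‖q (n + 1)‖ ≤ e * s * (s ^ (n + 1))⁻¹ :=
    fun n => (norm_solutionCoeff_le hs he hk hes n).2
  have hterm : ∀ w : ℂ, ∀ n, ‖w ^ n • q n‖ ≤ (‖w‖ / s) ^ n := fun w n => by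
    rw [norm_smul, norm_pow, div_pow, div_eq_mul_inv]
    have := hqb n
    gcongr
  have hlt : ∀ w ∈ Metric.ball (0 : ℂ) s, ‖w‖ / s < 1 := fun w hw =>
    (div_lt_one hs).2 (mem_ball_zero_iff.1 hw)
  have hqs : ∀ w ∈ Metric.ball (0 : ℂ) s, Summable fun n => ‖w ^ n • q n‖ := fun w hw =>
    Summable.of_nonneg_of_le (fun _ => norm_nonneg _) (hterm w)
      (summable_geometric_of_lt_one (by positivity) (hlt w hw))
  refine ⟨fun w => ∑' n, w ^ n • q n, fun w hw => ⟨?_, ?_⟩⟩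
  -- Termwise differentiation needs a summable bound uniform near `w`, hence the intermediate
  -- radius.
  · obtain ⟨r, hwr, hrs⟩ := exists_between (mem_ball_zero_iff.1 hw)
    have hr0 : 0 < r := (norm_nonneg _).trans_lt hwr
    have hu : Summable fun n : ℕ => (n : ℝ) * (r / s) ^ n * r⁻¹ := by
      have := summable_pow_mul_geometric_of_norm_lt_one (R := ℝ) 1 (r := r / s) (by
        rw [Real.norm_of_nonneg (by positivity)]; exact (div_lt_one hs).2 hrs)
      simpa using this.mul_right r⁻¹
    have hd := hasDerivAt_tsum_of_isPreconnected (g := fun n (z : ℂ) => z ^ n • q n)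
      (g' := fun n (z : ℂ) => ((n : ℂ) * z ^ (n - 1)) • q n) hu
      (Metric.isOpen_ball (x := (0 : ℂ)) (ε := r)) (convex_ball (0 : ℂ) r).isPreconnected
      (fun n y _ => (hasDerivAt_pow n y).smul_const _) (fun n y hy => by
        rw [norm_smul, norm_mul, norm_pow, Complex.norm_natCast]
        rcases n with _ | n
        · simp
        · have hy' := (mem_ball_zero_iff.1 hy).le
          have := hqb (n + 1)
          calc _ ≤ ((n + 1 : ℕ) : ℝ) * r ^ (n + 1 - 1) * (s ^ (n + 1))⁻¹ := by gcongr
            _ = _ := by rw [div_pow, Nat.add_sub_cancel, pow_succ r]; field_simp)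
      (mem_ball_zero_iff.2 hwr) (hqs w hw).of_norm (mem_ball_zero_iff.2 hwr)
    refine hd.congr_deriv ?_
    have hks : Summable fun n => ‖w ^ n • k n‖ := by
      refine Summable.of_nonneg_of_le (fun _ => norm_nonneg _) (fun n => ?_)
        ((summable_geometric_of_lt_one (by positivity) (hlt w hw)).mul_left e)
      rw [norm_smul, norm_pow, div_pow]
      calc _ ≤ ‖w‖ ^ n * (e / s ^ n) := by have := hk n; gcongr
        _ = _ := by ring
    have hg' : Summable fun n : ℕ => ((n : ℂ) * w ^ (n - 1)) • q n := by
      refine Summable.of_norm_bounded hu fun n => ?_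
      rw [norm_smul, norm_mul, norm_pow, Complex.norm_natCast]
      rcases n with _ | n
      · simp
      · have := hqb (n + 1)
        calc _ ≤ ((n + 1 : ℕ) : ℝ) * r ^ (n + 1 - 1) * (s ^ (n + 1))⁻¹ := by gcongr
          _ = _ := by rw [div_pow, Nat.add_sub_cancel, pow_succ r]; field_simp
    rw [hg'.tsum_eq_zero_add, ← (hsum w hw).tsum_eq,
      tsum_mul_tsum_eq_tsum_sum_antidiagonal_of_summable_norm hks (hqs w hw), ← tsum_neg]
    simp only [Nat.cast_zero, zero_mul, zero_smul, zero_add, Nat.add_sub_cancel]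
    refine tsum_congr fun n => ?_
    rw [mul_comm, mul_smul, Nat.cast_succ, hq, solutionCoeff_succ, smul_neg, Finset.smul_sum]
    congr 1
    refine Finset.sum_congr rfl fun p hp => ?_
    rw [smul_mul_smul_comm, ← pow_add, Finset.HasAntidiagonal.mem_antidiagonal.1 hp]
  · have h1 := (hqs w hw).of_norm.tsum_eq_zero_add
    simp only [pow_zero, one_smul] at h1
    have hq0 : q 0 = 1 := solutionCoeff_zero k
    change ‖(∑' n, w ^ n • q n) - 1‖ ≤ _
    rw [h1, hq0, add_sub_cancel_left]
    refine tsum_of_norm_bounded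
      ((hasSum_geometric_of_lt_one (by positivity) (hlt w hw)).mul_left (e * s)) fun n => ?_
    rw [norm_smul, norm_pow]
    have h2 := hqb' n
    have h3 := (hlt w hw).le
    calc _ ≤ ‖w‖ ^ (n + 1) * (e * s * (s ^ (n + 1))⁻¹) := by gcongr
      _ = e * s * (‖w‖ / s) ^ n * (‖w‖ / s) := by rw [div_pow, pow_succ, pow_succ]; field_simp
      _ ≤ e * s * (‖w‖ / s) ^ n * 1 := by gcongr
      _ = _ := mul_one _

end LinearODE

/-! ### First order expansion of monodromy -/

section Perturbation

variable {𝒜 : Type*} [NormedRing 𝒜] [NormedAlgebra ℂ 𝒜]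

/-- A solution of `Θ' = Θ k` with small `k` stays close to its initial value. -/
theorem norm_sub_le_of_deriv_eq_mul {Θ k : ℂ → 𝒜} {K : Set ℂ} {ζ₀ : ℂ} {D e : ℝ}
    (hK : IsCompact K) (hconv : Convex ℝ K) (hζ₀ : ζ₀ ∈ K) (hD : ∀ ζ ∈ K, ‖ζ - ζ₀‖ ≤ D)
    (hΘ : ∀ ζ ∈ K, HasDerivAt Θ (Θ ζ * k ζ) ζ) (hk : ∀ ζ ∈ K, ‖k ζ‖ ≤ e) (he : 0 ≤ e)
    (heD : e * D ≤ 1 / 2) {ζ : ℂ} (hζ : ζ ∈ K) :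
    ‖Θ ζ - Θ ζ₀‖ ≤ 2 * e * D * ‖Θ ζ₀‖ := by
  have hc : ContinuousOn (fun ζ => ‖Θ ζ‖) K := fun ζ hζ =>
    (hΘ ζ hζ).continuousAt.norm.continuousWithinAt
  -- In place of a Gronwall argument, the increment is bounded by the maximum of $\|\Theta\|$ on
  -- `K`, which is then absorbed because $eD\le1/2$.
  obtain ⟨ζ₁, hζ₁, hmax⟩ := hK.exists_isMaxOn ⟨ζ₀, hζ₀⟩ hc
  have hmax' : ∀ ζ ∈ K, ‖Θ ζ‖ ≤ ‖Θ ζ₁‖ := fun ζ hζ => hmax hζ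
  have hb : ∀ ζ ∈ K, ‖Θ ζ - Θ ζ₀‖ ≤ e * D * ‖Θ ζ₁‖ := fun ζ hζ => by
    have := hconv.norm_image_sub_le_of_norm_hasDerivWithin_le (C := ‖Θ ζ₁‖ * e)
      (fun x hx => (hΘ x hx).hasDerivWithinAt) (fun x hx => (norm_mul_le _ _).trans
        (mul_le_mul (hmax' x hx) (hk x hx) (norm_nonneg _) (norm_nonneg _))) hζ₀ hζ
    have h2 := mul_le_mul_of_nonneg_left (hD ζ hζ) (mul_nonneg (norm_nonneg (Θ ζ₁)) he)
    linarith
  have h1 := hb ζ₁ hζ₁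
  have h2 : ‖Θ ζ₁‖ ≤ ‖Θ ζ₀‖ + ‖Θ ζ₁ - Θ ζ₀‖ := by
    simpa using norm_add_le (Θ ζ₀) (Θ ζ₁ - Θ ζ₀)
  have h3 := mul_le_mul_of_nonneg_right heD (norm_nonneg (Θ ζ₁))
  have h4 : ‖Θ ζ₁‖ ≤ 2 * ‖Θ ζ₀‖ := by linarith
  have hD0 : 0 ≤ e * D := mul_nonneg he ((norm_nonneg _).trans (hD ζ hζ))
  have h5 := mul_le_mul_of_nonneg_left h4 hD0
  linarith [hb ζ hζ]

/-- First order expansion of the monodromy of `Θ` when `Θ Q` has derivative `Θ S Q`, with `S` the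
derivative of `J` and `Q` close to `1`. -/
theorem norm_monodromy_sub_le [NormOneClass 𝒜] {Θ k Q S J : ℂ → 𝒜} {K : Set ℂ} {ζ₀ ζ₁ : ℂ}
    {D e σ : ℝ} {N : 𝒜}
    (hK : IsCompact K) (hconv : Convex ℝ K) (hζ₀ : ζ₀ ∈ K) (hζ₁ : ζ₁ ∈ K)
    (hD : ∀ ζ ∈ K, ‖ζ - ζ₀‖ ≤ D)
    (hΘ : ∀ ζ ∈ K, HasDerivAt Θ (Θ ζ * k ζ) ζ) (hk : ∀ ζ ∈ K, ‖k ζ‖ ≤ e) (he : 0 ≤ e)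
    (he1 : e ≤ 1 / 2) (heD : e * D ≤ 1 / 2)
    (hT : ∀ ζ ∈ K, HasDerivAt (fun ζ => Θ ζ * Q ζ) (Θ ζ * S ζ * Q ζ) ζ)
    (hJ : ∀ ζ ∈ K, HasDerivAt J (S ζ) ζ) (hS : ∀ ζ ∈ K, ‖S ζ‖ ≤ σ) (hσ : 0 ≤ σ)
    (hQ : ∀ ζ ∈ K, ‖Q ζ - 1‖ ≤ e) (hQ₁ : Q ζ₁ = Q ζ₀) (hN : Θ ζ₁ - Θ ζ₀ = N * Θ ζ₀) :
    ‖N * Θ ζ₀ - Θ ζ₀ * (J ζ₁ - J ζ₀)‖ ≤ (8 * D ^ 2 + 4 * D) * e * σ * ‖Θ ζ₀‖ := by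
  have hD0 : 0 ≤ D := (norm_nonneg _).trans (hD ζ₀ hζ₀)
  set v := ‖Θ ζ₀‖ with hv
  have hv0 : 0 ≤ v := norm_nonneg _
  -- The derivative of $\Theta Q-\Theta(\zeta_0)J$ is
  -- $(\Theta-\Theta(\zeta_0))SQ+\Theta(\zeta_0)S(Q-1)$. Each term contains both $S$ and a small
  -- factor, so the error is of order $e\sigma$.
  have hE : ‖(Θ ζ₁ * Q ζ₁ - Θ ζ₀ * J ζ₁) - (Θ ζ₀ * Q ζ₀ - Θ ζ₀ * J ζ₀)‖ ≤
      (4 * D + 1) * e * σ * v * D := by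
    have h1 := hconv.norm_image_sub_le_of_norm_hasDerivWithin_le
      (f := fun ζ => Θ ζ * Q ζ - Θ ζ₀ * J ζ) (C := (4 * D + 1) * e * σ * v)
      (fun x hx => ((hT x hx).sub ((hJ x hx).const_mul (Θ ζ₀))).hasDerivWithinAt)
      (fun x hx => ?_) hζ₀ hζ₁
    · refine h1.trans (mul_le_mul_of_nonneg_left (hD _ hζ₁) (by positivity))
    · have e1 : Θ x * S x * Q x - Θ ζ₀ * S x =
          (Θ x - Θ ζ₀) * S x * Q x + Θ ζ₀ * S x * (Q x - 1) := by noncomm_ring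
      rw [e1]
      have hQ2 : ‖Q x‖ ≤ 2 := by
        have := norm_add_le (1 : 𝒜) (Q x - 1)
        rw [add_sub_cancel, norm_one] at this
        linarith [hQ x hx]
      have hΘx := norm_sub_le_of_deriv_eq_mul hK hconv hζ₀ hD hΘ hk he heD hx
      calc _ ≤ ‖Θ x - Θ ζ₀‖ * ‖S x‖ * ‖Q x‖ + ‖Θ ζ₀‖ * ‖S x‖ * ‖Q x - 1‖ := by
            refine (norm_add_le _ _).trans (add_le_add ?_ ?_)
            · exact (norm_mul_le _ _).trans
                (mul_le_mul_of_nonneg_right (norm_mul_le _ _) (norm_nonneg _))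
            · exact (norm_mul_le _ _).trans
                (mul_le_mul_of_nonneg_right (norm_mul_le _ _) (norm_nonneg _))
        _ ≤ (2 * e * D * v) * σ * 2 + v * σ * e := by
            have := hS x hx
            have := hQ x hx
            gcongr
        _ = _ := by ring
  set E := (Θ ζ₁ * Q ζ₁ - Θ ζ₀ * J ζ₁) - (Θ ζ₀ * Q ζ₀ - Θ ζ₀ * J ζ₀) with hEdef
  have hNQ : N * Θ ζ₀ * Q ζ₀ = Θ ζ₀ * (J ζ₁ - J ζ₀) + E := by
    rw [hEdef, ← hN, hQ₁]; noncomm_ring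
  have hJd : ‖J ζ₁ - J ζ₀‖ ≤ σ * D :=
    (hconv.norm_image_sub_le_of_norm_hasDerivWithin_le
      (fun x hx => (hJ x hx).hasDerivWithinAt) hS hζ₀ hζ₁).trans
      (mul_le_mul_of_nonneg_left (hD _ hζ₁) hσ)
  -- This avoids inverting $Q(\zeta_0)$: the last term is at most half of $\|N\Theta(\zeta_0)\|$ and
  -- is absorbed on the left.
  have hdec : N * Θ ζ₀ = N * Θ ζ₀ * Q ζ₀ - N * Θ ζ₀ * (Q ζ₀ - 1) := by noncomm_ring
  have h1 : ‖N * Θ ζ₀ * (Q ζ₀ - 1)‖ ≤ ‖N * Θ ζ₀‖ * e :=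
    (norm_mul_le _ _).trans (mul_le_mul_of_nonneg_left (hQ _ hζ₀) (norm_nonneg _))
  have h2 : ‖N * Θ ζ₀ * Q ζ₀‖ ≤ v * (σ * D) + ‖E‖ := by
    rw [hNQ]
    exact (norm_add_le _ _).trans (add_le_add ((norm_mul_le _ _).trans
      (mul_le_mul_of_nonneg_left hJd hv0)) le_rfl)
  have h3 : ‖N * Θ ζ₀‖ ≤ ‖N * Θ ζ₀ * Q ζ₀‖ + ‖N * Θ ζ₀ * (Q ζ₀ - 1)‖ := by
    conv_lhs => rw [hdec]
    exact norm_sub_le _ _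
  have h4 : ‖N * Θ ζ₀‖ * e ≤ ‖N * Θ ζ₀‖ * (1 / 2) :=
    mul_le_mul_of_nonneg_left he1 (norm_nonneg _)
  have h5 : ‖N * Θ ζ₀‖ ≤ 2 * (v * (σ * D) + ‖E‖) := by linarith
  have h6 : N * Θ ζ₀ - Θ ζ₀ * (J ζ₁ - J ζ₀) = E - N * Θ ζ₀ * (Q ζ₀ - 1) := by
    rw [eq_sub_iff_add_eq, sub_add_eq_add_sub, sub_eq_iff_eq_add', ← hNQ]; noncomm_ring
  rw [h6]
  have h7 := mul_le_mul_of_nonneg_right h5 he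
  have h8 := mul_le_mul_of_nonneg_left he1 (norm_nonneg E)
  calc _ ≤ ‖E‖ + ‖N * Θ ζ₀ * (Q ζ₀ - 1)‖ := norm_sub_le _ _
    _ ≤ 2 * ((4 * D + 1) * e * σ * v * D) + 2 * v * σ * D * e := by linarith
    _ = _ := by ring

end Perturbation

end DPW

end

/-! ### Two by two matrices and positivity -/

noncomputable section

open scoped Matrix.Norms.Operator ComplexConjugate

namespace DPW

section TwoByTwo

theorem norm_entry_le (A : Matrix (Fin 2) (Fin 2) ℂ) (i j : Fin 2) : ‖A i j‖ ≤ ‖A‖ := by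
  have h : ‖A i j‖₊ ≤ ‖A‖₊ := by
    rw [Matrix.linfty_opNNNorm_def]
    exact (Finset.single_le_sum (f := fun j => ‖A i j‖₊) (fun _ _ => zero_le)
      (Finset.mem_univ j)).trans
      (Finset.le_sup (f := fun i => ∑ j, ‖A i j‖₊) (Finset.mem_univ i))
  exact_mod_cast h

theorem norm_le_of_rows {A : Matrix (Fin 2) (Fin 2) ℂ} {c : ℝ}
    (h : ∀ i, ‖A i 0‖ + ‖A i 1‖ ≤ c) : ‖A‖ ≤ c := by
  have hc : 0 ≤ c := (by positivity : 0 ≤ ‖A 0 0‖ + ‖A 0 1‖).trans (h 0)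
  lift c to NNReal using hc
  have : ‖A‖₊ ≤ c := by
    rw [Matrix.linfty_opNNNorm_def]
    refine Finset.sup_le fun i _ => ?_
    rw [Fin.sum_univ_two]
    exact_mod_cast h i
  exact_mod_cast this

theorem norm_le_of_entries {A : Matrix (Fin 2) (Fin 2) ℂ} {c : ℝ}
    (h : ∀ i j, ‖A i j‖ ≤ c) : ‖A‖ ≤ 2 * c :=
  norm_le_of_rows fun i => by linarith [h i 0, h i 1]

theorem hasDerivAt_matrix {A : ℂ → Matrix (Fin 2) (Fin 2) ℂ} {A' : Matrix (Fin 2) (Fin 2) ℂ}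
    {x : ℂ} (h : ∀ i j, HasDerivAt (fun y => A y i j) (A' i j) x) : HasDerivAt A A' x := by
  have e : ∀ B : Matrix (Fin 2) (Fin 2) ℂ,
      B = ∑ i, ∑ j, B i j • Matrix.single i j (1 : ℂ) := fun B => by
    conv_lhs => rw [Matrix.matrix_eq_sum_single B]
    simp [Matrix.smul_single]
  have hA : A = fun y => ∑ i, ∑ j, A y i j • Matrix.single i j (1 : ℂ) := funext fun y => e _
  rw [hA, e A']
  exact HasDerivAt.fun_sum fun i _ => HasDerivAt.fun_sum fun j _ => (h i j).smul_const _

/-- If a matrix `N` in the real span of `SU(2)` is conjugate, up to a small error, to `2πi X`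
with `X` traceless, then `tr X²` has positive real part. -/
theorem re_pos_of_conj_near {N V V' E : Matrix (Fin 2) (Fin 2) ℂ} {x y w : ℂ} {K d τ : ℝ}
    (hVV' : V * V' = 1) (hK : ‖V‖ * ‖V'‖ ≤ K)
    (hN0 : N 1 1 = conj (N 0 0)) (hN1 : N 1 0 = -conj (N 0 1))
    (hx : ‖x‖ ≤ d) (hy : ‖y‖ ≤ d) (hw : ‖w‖ ≤ d) (hd : ‖x‖ = d ∨ ‖y‖ = d ∨ ‖w‖ = d)
    (hE : V' * N * V = (2 * Real.pi * Complex.I : ℂ) • !![x, y; w, -x] + E)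
    (hEn : ‖E‖ ≤ τ * d) (hτ : 100 * K ^ 2 * τ ≤ 1) :
    d ≤ K * ‖N‖ ∧ (0 < d → 0 < (x ^ 2 + y * w).re) := by
  have hd0 : 0 ≤ d := (norm_nonneg _).trans hx
  have hK1 : 1 ≤ K := by
    have := norm_mul_le V V'
    rw [hVV', norm_one] at this
    linarith
  have hE' : ∀ i j, ‖E i j‖ ≤ τ * d := fun i j => (norm_entry_le E i j).trans hEn
  set Y := V' * N * V with hY
  have hpi := Real.pi_gt_three
  have hpi4 := Real.pi_lt_four
  have hY00 : Y 0 0 = 2 * Real.pi * Complex.I * x + E 0 0 := by rw [hE]; simp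
  have hY01 : Y 0 1 = 2 * Real.pi * Complex.I * y + E 0 1 := by rw [hE]; simp
  have hY10 : Y 1 0 = 2 * Real.pi * Complex.I * w + E 1 0 := by rw [hE]; simp
  have hY11 : Y 1 1 = -(2 * Real.pi * Complex.I * x) + E 1 1 := by rw [hE]; simp
  have htd : 0 ≤ τ * d := (norm_nonneg _).trans hEn
  have hYN : ‖Y‖ ≤ K * ‖N‖ := by
    calc ‖Y‖ ≤ ‖V'‖ * ‖N‖ * ‖V‖ := (norm_mul_le _ _).trans
          (mul_le_mul_of_nonneg_right (norm_mul_le _ _) (norm_nonneg _))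
      _ = ‖V‖ * ‖V'‖ * ‖N‖ := by ring
      _ ≤ _ := by gcongr
  have hKsq : 1 ≤ K ^ 2 := one_le_pow₀ hK1
  have hτd : 100 * (τ * d) ≤ d := by
    have h1 : K ^ 2 * (100 * (τ * d)) ≤ d := by
      have := mul_le_mul_of_nonneg_right hτ hd0
      linarith
    nlinarith
  -- The largest entry of $2\pi iX$ has modulus at least $2\pi d$, and the error is at most $d/100$.
  have hdY : d ≤ ‖Y‖ := by
    have h2 : ‖(2 * Real.pi * Complex.I : ℂ)‖ = 2 * Real.pi := by
      simp [abs_of_pos Real.pi_pos]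
    have aux : ∀ (i j : Fin 2) (u : ℂ), ‖u‖ = d → Y i j = 2 * Real.pi * Complex.I * u + E i j →
        d ≤ ‖Y‖ := fun i j u hu h => by
      have h3 := norm_entry_le Y i j
      have h4 : ‖2 * Real.pi * Complex.I * u‖ ≤ ‖Y i j‖ + ‖E i j‖ := by
        have : 2 * Real.pi * Complex.I * u = Y i j - E i j := by rw [h]; ring
        rw [this]; exact norm_sub_le _ _
      rw [norm_mul, h2, hu] at h4
      have := hE' i j
      nlinarith
    rcases hd with h | h | h
    · exact aux 0 0 x h hY00
    · exact aux 0 1 y h hY01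
    · exact aux 1 0 w h hY10
  refine ⟨hdY.trans hYN, fun hdpos => ?_⟩
  -- The traces of $N$ and $N^2$ are conjugation invariant. The first shows that
  -- $\operatorname{Re}n$ is small because $X$ is traceless; the second relates $x^2+yw$ to $N$.
  have htr : Y 0 0 + Y 1 1 = N 0 0 + N 1 1 := by
    have : Y.trace = N.trace := by
      rw [hY, Matrix.trace_mul_comm, ← mul_assoc, hVV', one_mul]
    simpa [Matrix.trace_fin_two] using this
  have htr2 : Y 0 0 ^ 2 + 2 * (Y 0 1 * Y 1 0) + Y 1 1 ^ 2 =
      N 0 0 ^ 2 + 2 * (N 0 1 * N 1 0) + N 1 1 ^ 2 := by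
    have : (Y * Y).trace = (N * N).trace := by
      have e : Y * Y = V' * (N * (V * V') * N * V) := by rw [hY]; simp only [mul_assoc]
      rw [e, Matrix.trace_mul_comm, hVV', mul_one]
      simp only [mul_assoc, hVV', mul_one]
    simp only [Matrix.trace_fin_two, Matrix.mul_apply, Fin.sum_univ_two] at this
    linear_combination this
  set n := N 0 0 with hn
  set m := N 0 1 with hm
  rw [hN0] at htr htr2
  rw [hN1] at htr2
  have hNn : ‖N‖ ≤ ‖n‖ + ‖m‖ := norm_le_of_rows fun i => by
    fin_cases i
    · exact le_rfl
    · simp [hN0, hN1, add_comm]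
  set e00 := E 0 0
  set e01 := E 0 1
  set e10 := E 1 0
  set e11 := E 1 1
  have h00 : ‖e00‖ ≤ τ * d := hE' 0 0
  have h01 : ‖e01‖ ≤ τ * d := hE' 0 1
  have h10 : ‖e10‖ ≤ τ * d := hE' 1 0
  have h11 : ‖e11‖ ≤ τ * d := hE' 1 1
  rw [hY00, hY11] at htr
  rw [hY00, hY01, hY10, hY11] at htr2
  set err : ℂ := 4 * Real.pi * Complex.I * (x * (e00 - e11) + (y * e10 + w * e01)) +
    (e00 ^ 2 + e11 ^ 2 + 2 * (e01 * e10)) with herr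
  have hI : Complex.I ^ 2 = -1 := Complex.I_sq
  have hmain : (8 * Real.pi ^ 2 : ℂ) * (x ^ 2 + y * w) =
      err - (n ^ 2 + 2 * (m * -conj m) + conj n ^ 2) := by
    rw [herr]
    linear_combination -htr2 + (8 * Real.pi ^ 2 * (x ^ 2 + y * w)) * hI
  have hre := congrArg Complex.re hmain
  have hnre : 2 * n.re = (e00 + e11).re := by
    have := congrArg Complex.re htr
    simp at this ⊢
    linarith
  have hnre' : |2 * n.re| ≤ 2 * (τ * d) := by
    rw [hnre]
    exact (Complex.abs_re_le_norm _).trans ((norm_add_le _ _).trans (by linarith))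
  have herrn : ‖err‖ ≤ 64 * d * (τ * d) + 4 * (τ * d) ^ 2 := by
    have h4 : ‖(4 * Real.pi * Complex.I : ℂ)‖ ≤ 16 := by
      simp [abs_of_pos Real.pi_pos]
      linarith
    have hprod : ∀ {u v : ℂ} {a b : ℝ}, ‖u‖ ≤ a → ‖v‖ ≤ b → ‖u * v‖ ≤ a * b := fun hu hv => by
      rw [norm_mul]
      exact mul_le_mul hu hv (norm_nonneg _) ((norm_nonneg _).trans hu)
    have h5 : ‖x * (e00 - e11) + (y * e10 + w * e01)‖ ≤ 4 * d * (τ * d) := by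
      refine (norm_add_le _ _).trans ?_
      have a1 := hprod hx ((norm_sub_le e00 e11).trans (add_le_add h00 h11))
      have a2 := hprod hy h10
      have a3 := hprod hw h01
      have a4 := norm_add_le (y * e10) (w * e01)
      linarith
    have h6 : ‖e00 ^ 2 + e11 ^ 2 + 2 * (e01 * e10)‖ ≤ 4 * (τ * d) ^ 2 := by
      have a1 := hprod h00 h00
      have a2 := hprod h11 h11
      have a3 : ‖2 * (e01 * e10)‖ ≤ 2 * ((τ * d) * (τ * d)) :=
        hprod (by simp) (hprod h01 h10)
      rw [← sq] at a1 a2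
      refine (norm_add₃_le).trans ?_
      linarith
    refine (norm_add_le _ _).trans ?_
    have := hprod h4 h5
    linarith
  have hreerr := (Complex.abs_re_le_norm err).trans herrn
  have hr1 : ((8 * Real.pi ^ 2 : ℂ) * (x ^ 2 + y * w)).re =
      8 * Real.pi ^ 2 * (x ^ 2 + y * w).re := by
    rw [← Complex.re_ofReal_mul]
    congr 2
    push_cast
    ring
  -- This is $\operatorname{tr}N^2$. Once $\operatorname{Re}n$ is negligible it is about
  -- $-2(|n|^2+|m|^2)$, which is the source of the positivity.
  have hr2 : (n ^ 2 + 2 * (m * -conj m) + conj n ^ 2).re =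
      (2 * n.re) ^ 2 - 2 * (‖n‖ ^ 2 + ‖m‖ ^ 2) := by
    rw [Complex.sq_norm, Complex.sq_norm, Complex.normSq_apply, Complex.normSq_apply]
    simp [sq]
    ring
  rw [Complex.sub_re, hr1, hr2] at hre
  have hNlow : ‖N‖ ^ 2 ≤ 2 * (‖n‖ ^ 2 + ‖m‖ ^ 2) := by
    have := pow_le_pow_left₀ (norm_nonneg N) hNn 2
    nlinarith [sq_nonneg (‖n‖ - ‖m‖)]
  have hdN : d ^ 2 ≤ K ^ 2 * ‖N‖ ^ 2 := by
    rw [← mul_pow]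
    exact pow_le_pow_left₀ hd0 (hdY.trans hYN) 2
  have hsq : (2 * n.re) ^ 2 ≤ (2 * (τ * d)) ^ 2 := sq_le_sq' (abs_le.1 hnre').1 (abs_le.1 hnre').2
  have hτd2 : (τ * d) ^ 2 ≤ τ * d * d / 100 := by nlinarith
  have hKτ : K ^ 2 * (100 * (τ * d * d)) ≤ d ^ 2 := by
    have := mul_le_mul_of_nonneg_right hτ (sq_nonneg d)
    linarith
  have hfin : 0 < K ^ 2 * (8 * Real.pi ^ 2 * (x ^ 2 + y * w).re) := by
    have hl : ‖N‖ ^ 2 - 65 * (τ * d * d) ≤ 8 * Real.pi ^ 2 * (x ^ 2 + y * w).re := by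
      have h1 := (abs_le.1 hreerr).1
      have h2 : 0 ≤ τ * d * d := mul_nonneg htd hd0
      linarith
    have h3 := mul_le_mul_of_nonneg_left hl (by positivity : 0 ≤ K ^ 2)
    have h4 : 0 < d ^ 2 := by positivity
    linarith
  have h9 : 0 < K ^ 2 := by linarith
  exact pos_of_mul_pos_right (pos_of_mul_pos_right hfin h9.le) (by positivity)

end TwoByTwo

/-! ### Maximum principle argument in the loop variable -/

section FunctionTheory

theorem sq_dslope_eq {f : ℂ → ℂ} {a : ℂ} (h0 : f a = 0) (h1 : deriv f a = 0) (l : ℂ) :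
    f l = (l - a) ^ 2 * dslope (dslope f a) a l := by
  have e1 := sub_smul_dslope f a l
  have e2 := sub_smul_dslope (dslope f a) a l
  rw [dslope_same, h1, sub_zero, smul_eq_mul] at e2
  rw [h0, sub_zero, smul_eq_mul] at e1
  rw [← e1, ← e2]
  ring

/-- Differentiation along $\lambda=e^{ix}$ suffices, since it multiplies the complex derivative at
$1$ by $i\neq0$; this matters because the bound is only available on the circle. The finite family
is there because the dominating matrix entry may change with $\lambda$. -/
theorem deriv_eq_zero_of_norm_le_on_circle {f : ℂ → ℂ} {ι : Type*} [Finite ι] {N : ι → ℂ → ℂ}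
    {C : ℝ} (hf : DifferentiableAt ℂ f 1) (hf1 : f 1 = 0) (hN : ∀ i, HasDerivAt (N i) 0 1)
    (hN1 : ∀ i, N i 1 = 0) (hle : ∀ l : ℂ, ‖l‖ = 1 → ∃ i, ‖f l‖ ≤ C * ‖N i l‖) :
    deriv f 1 = 0 := by
  have hc0 : Complex.exp (((0 : ℝ) : ℂ) * Complex.I) = 1 := by simp
  have hc : HasDerivAt (fun x : ℝ => Complex.exp (x * Complex.I)) Complex.I 0 := by
    have h := ((Complex.ofRealCLM.hasDerivAt (x := (0 : ℝ))).mul_const Complex.I).cexp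
    simpa using h
  have h1 : HasDerivAt (fun x : ℝ => f (Complex.exp (x * Complex.I))) (deriv f 1 * Complex.I) 0 := by
    have hf' : HasDerivAt f (deriv f 1) (Complex.exp (((0 : ℝ) : ℂ) * Complex.I)) := by
      rw [hc0]; exact hf.hasDerivAt
    exact hf'.comp (0 : ℝ) hc
  have h2 : HasDerivAt (fun x : ℝ => f (Complex.exp (x * Complex.I))) 0 0 := by
    rw [hasDerivAt_iff_isLittleO]
    simp only [smul_zero, sub_zero, hc0, hf1]
    have hNi : ∀ i, (fun x : ℝ => N i (Complex.exp (x * Complex.I))) =o[𝓝 0] fun x : ℝ => x := by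
      intro i
      have hN' : HasDerivAt (N i) 0 (Complex.exp (((0 : ℝ) : ℂ) * Complex.I)) := by
        rw [hc0]; exact hN i
      have h3 := hN'.comp (0 : ℝ) hc
      rw [zero_mul, hasDerivAt_iff_isLittleO] at h3
      simpa [hN1] using h3
    rw [Asymptotics.isLittleO_iff]
    intro c hc'
    have hC : 0 < c / (|C| + 1) := by positivity
    have := eventually_all.2 fun i => Asymptotics.isLittleO_iff.1 (hNi i) hC
    filter_upwards [this] with x hx
    obtain ⟨i, hi⟩ := hle _ (Complex.norm_exp_ofReal_mul_I x)
    calc _ ≤ C * ‖N i (Complex.exp (x * Complex.I))‖ := hi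
      _ ≤ (|C| + 1) * (c / (|C| + 1) * ‖x‖) := by
          have := le_abs_self C
          gcongr
          · linarith
          · exact hx i
      _ = c * ‖x‖ := by field_simp
  have := h1.unique h2
  simpa using this

/-- Holomorphic functions `p, q, r` on a disk of radius `> 1` with a double zero at `1` vanish on
the unit circle if `q² - p r` satisfies a positivity condition there, and a normalization at `0`. -/
theorem eq_zero_on_circle_of_re_pos {p q r : ℂ → ℂ} {ρ : ℝ} (hρ : 1 < ρ)
    (hp : DifferentiableOn ℂ p (Metric.ball 0 ρ)) (hq : DifferentiableOn ℂ q (Metric.ball 0 ρ))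
    (hr : DifferentiableOn ℂ r (Metric.ball 0 ρ))
    (hp1 : p 1 = 0) (hq1 : q 1 = 0) (hr1 : r 1 = 0)
    (hp' : deriv p 1 = 0) (hq' : deriv q 1 = 0) (hr' : deriv r 1 = 0)
    (hp0 : p 0 = 0) (hq0 : (q 0).re = 0)
    (hpos : ∀ l : ℂ, ‖l‖ = 1 → ¬(p l = 0 ∧ q l = 0 ∧ r l = 0) →
      0 < ((q l ^ 2 - p l * r l) / l ^ 2).re) (l : ℂ) (hl : ‖l‖ = 1) :
    p l = 0 ∧ q l = 0 ∧ r l = 0 := by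
  have hnhds : Metric.ball (0 : ℂ) ρ ∈ 𝓝 (1 : ℂ) :=
    Metric.isOpen_ball.mem_nhds (by simpa using hρ)
  have hdd : ∀ {f : ℂ → ℂ}, DifferentiableOn ℂ f (Metric.ball 0 ρ) →
      DifferentiableOn ℂ (dslope (dslope f 1) 1) (Metric.ball 0 ρ) := fun hf =>
    (Complex.differentiableOn_dslope hnhds).2 ((Complex.differentiableOn_dslope hnhds).2 hf)
  set P := dslope (dslope p 1) 1
  set Q := dslope (dslope q 1) 1
  set S := dslope (dslope r 1) 1
  have hP : ∀ l, p l = (l - 1) ^ 2 * P l := sq_dslope_eq hp1 hp'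
  have hQ : ∀ l, q l = (l - 1) ^ 2 * Q l := sq_dslope_eq hq1 hq'
  have hS : ∀ l, r l = (l - 1) ^ 2 * S l := sq_dslope_eq hr1 hr'
  set h : ℂ → ℂ := fun l => Q l ^ 2 - P l * S l with hdef
  have hh : DifferentiableOn ℂ h (Metric.ball 0 ρ) :=
    ((hdd hq).pow 2).sub ((hdd hp).mul (hdd hr))
  -- On the unit circle $(\lambda-1)^2/\lambda=-|\lambda-1|^2$, so dividing by $\lambda^2$ turns the
  -- common factor $(\lambda-1)^4$ into a nonnegative real number.
  have hfac : ∀ l : ℂ, ‖l‖ = 1 →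
      ((q l ^ 2 - p l * r l) / l ^ 2).re = (‖l - 1‖ ^ 2) ^ 2 * (h l).re := fun l hl => by
    have hl0 : l ≠ 0 := by rintro rfl; simp at hl
    have hc : l * conj l = 1 := by rw [Complex.mul_conj, Complex.normSq_eq_norm_sq, hl]; simp
    have hn : ((‖l - 1‖ ^ 2 : ℝ) : ℂ) = -((l - 1) ^ 2 / l) := by
      rw [← Complex.normSq_eq_norm_sq, ← Complex.mul_conj, eq_neg_iff_add_eq_zero,
        eq_comm, ← mul_right_inj' hl0, map_sub, map_one]
      field_simp
      linear_combination (-(l - 1)) * hc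
    rw [← Complex.re_ofReal_mul, Complex.ofReal_pow, hn, hP, hQ, hS, hdef]
    congr 1
    field_simp
  have hposh : ∀ l : ℂ, ‖l‖ = 1 → l ≠ 1 → 0 ≤ (h l).re ∧
      (¬(p l = 0 ∧ q l = 0 ∧ r l = 0) → 0 < (h l).re) := fun l hl hl1 => by
    have hn : 0 < (‖l - 1‖ ^ 2) ^ 2 := by
      have := norm_pos_iff.2 (sub_ne_zero.2 hl1)
      positivity
    have hstr : ¬(p l = 0 ∧ q l = 0 ∧ r l = 0) → 0 < (h l).re := fun hnz => by
      have := hpos l hl hnz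
      rw [hfac l hl] at this
      exact pos_of_mul_pos_right this hn.le
    refine ⟨?_, hstr⟩
    by_cases hz : p l = 0 ∧ q l = 0 ∧ r l = 0
    · have h2 : (l - 1) ^ 2 ≠ 0 := pow_ne_zero _ (sub_ne_zero.2 hl1)
      have hP0 : P l = 0 := (mul_eq_zero.1 ((hP l).symm.trans hz.1)).resolve_left h2
      have hQ0 : Q l = 0 := (mul_eq_zero.1 ((hQ l).symm.trans hz.2.1)).resolve_left h2
      simp [hdef, hP0, hQ0]
    · exact (hstr hz).le
  have hclosed : Metric.closedBall (0 : ℂ) 1 ⊆ Metric.ball 0 ρ :=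
    Metric.closedBall_subset_ball hρ
  have hd : DiffContOnCl ℂ (fun l => Complex.exp (-h l)) (Metric.ball 0 1) := by
    have h1 : DifferentiableOn ℂ (fun l => Complex.exp (-h l)) (Metric.closedBall 0 1) :=
      (hh.mono hclosed).neg.cexp
    exact (by rw [closure_ball (0 : ℂ) one_ne_zero]; exact h1 :
      DifferentiableOn ℂ _ (closure (Metric.ball (0 : ℂ) 1))).diffContOnCl
  have hcirc : ∀ l : ℂ, ‖l‖ = 1 → 0 ≤ (h l).re := by
    intro l hl
    by_cases hl1 : l = 1
    · subst hl1
      -- The factor $|\lambda-1|^4$ degenerates at $1$, so the sign there is obtained as a limit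
      -- along the circle.
      have hcont : ContinuousAt h 1 := (hh.differentiableAt hnhds).continuousAt
      have hlim : Tendsto (fun x : ℝ => (h (Complex.exp (x * Complex.I))).re) (𝓝[>] 0)
          (𝓝 (h 1).re) := by
        have hE : Continuous fun x : ℝ => Complex.exp (x * Complex.I) := by fun_prop
        have hE0 := hE.tendsto 0
        simp only [Complex.ofReal_zero, zero_mul, Complex.exp_zero] at hE0
        exact (Complex.continuous_re.tendsto _).comp
          (hcont.tendsto.comp (hE0.mono_left nhdsWithin_le_nhds))
      refine ge_of_tendsto hlim ?_
      filter_upwards [Ioo_mem_nhdsGT (show (0 : ℝ) < 1 by norm_num)] with x hx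
      refine (hposh _ (Complex.norm_exp_ofReal_mul_I x) fun hx1 => ?_).1
      have := congrArg Complex.im hx1
      rw [Complex.exp_ofReal_mul_I_im] at this
      exact (Real.sin_pos_of_pos_of_lt_pi hx.1 (by linarith [hx.2, Real.pi_gt_three])).ne'
        (by simpa using this)
    · exact (hposh l hl hl1).1
  -- Since $(0-1)^2=1$, the normalizations give $P(0)=p(0)=0$ and $Q(0)=q(0)\in i\mathbb R$, so
  -- $h(0)$ is the square of an imaginary number.
  have hh0 : (h 0).re ≤ 0 := by
    have e1 := hP 0
    have e2 := hQ 0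
    rw [hp0] at e1
    have e3 : P 0 = 0 := by simpa using e1.symm
    have e4 : Q 0 = q 0 := by simpa using e2.symm
    simp only [hdef, e3, e4, sq, zero_mul, sub_zero, Complex.mul_re, hq0]
    nlinarith [sq_nonneg (q 0).im]
  have hle : ∀ l ∈ Metric.closedBall (0 : ℂ) 1, ‖Complex.exp (-h l)‖ ≤ 1 := fun l hl => by
    refine Complex.norm_le_of_forall_mem_frontier_norm_le Metric.isBounded_ball hd
      (fun z hz => ?_) (by rwa [closure_ball (0 : ℂ) one_ne_zero])
    rw [frontier_ball (0 : ℂ) one_ne_zero] at hz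
    rw [Complex.norm_exp, Complex.neg_re]
    simpa using hcirc z (by simpa using hz)
  have h0ge : 1 ≤ ‖Complex.exp (-h 0)‖ := by
    rw [Complex.norm_exp, Complex.neg_re]
    simpa using hh0
  -- The modulus of $e^{-h}$ is at most $1$ on the disk and at least $1$ at its centre, so it is
  -- constant up to the boundary.
  have hmax : IsMaxOn (norm ∘ fun l => Complex.exp (-h l)) (Metric.ball 0 1) 0 := fun z hz =>
    (hle z (Metric.ball_subset_closedBall hz)).trans h0ge
  have heq := Complex.norm_eqOn_closedBall_of_isMaxOn hd hmax
  have hzero : (h l).re = 0 := by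
    have h1 := heq (by simp [hl] : l ∈ Metric.closedBall (0 : ℂ) 1)
    have h2 : ‖Complex.exp (-h 0)‖ = 1 := le_antisymm (hle 0 (by simp)) h0ge
    simp only [Function.comp_apply, Function.const_apply, h2] at h1
    rw [Complex.norm_exp, Complex.neg_re, Real.exp_eq_one_iff, neg_eq_zero] at h1
    exact h1
  by_cases hl1 : l = 1
  · subst hl1
    exact ⟨hp1, hq1, hr1⟩
  · by_contra hz
    exact ((hposh l hl hl1).2 hz).ne' hzero

end FunctionTheory

end DPW

end

/-! ### Holomorphic extension and residues at infinity -/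

noncomputable section

namespace DPW

section Disk

variable {E : Type*} [NormedAddCommGroup E] [NormedSpace ℂ E]

theorem dslope_zero_eq (F : ℂ → E) (w : ℂ) : F w = F 0 + w • dslope F 0 w := by
  have := sub_smul_dslope F 0 w
  rw [sub_zero] at this
  rw [this, add_sub_cancel]

theorem differentiableOn_dslope_zero [CompleteSpace E] {F : ℂ → E} {R : ℝ} (hR : 0 < R)
    (hF : DifferentiableOn ℂ F (Metric.ball 0 R)) :
    DifferentiableOn ℂ (dslope F 0) (Metric.ball 0 R) :=
  (Complex.differentiableOn_dslope (Metric.ball_mem_nhds 0 hR)).2 hF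

/-- Closeness to the unperturbed potential is uniform only on compact subsets of the punctured disk.
The maximum principle carries it from a circle to the whole disk, including the point at infinity.
-/
theorem norm_le_on_closedBall {F : ℂ → E} {R s e : ℝ} (hs : 0 < s) (hsR : s < R)
    (hF : DifferentiableOn ℂ F (Metric.ball 0 R)) (h : ∀ w : ℂ, ‖w‖ = s → ‖F w‖ ≤ e)
    {w : ℂ} (hw : ‖w‖ ≤ s) : ‖F w‖ ≤ e := by
  have hd : DiffContOnCl ℂ F (Metric.ball 0 s) := by
    refine DifferentiableOn.diffContOnCl ?_
    rw [closure_ball (0 : ℂ) hs.ne']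
    exact hF.mono (Metric.closedBall_subset_ball hsR)
  refine Complex.norm_le_of_forall_mem_frontier_norm_le Metric.isBounded_ball hd
    (fun z hz => ?_) (by rw [closure_ball (0 : ℂ) hs.ne']; simpa using hw)
  rw [frontier_ball (0 : ℂ) hs.ne'] at hz
  exact h z (by simpa using hz)

/-- On $|w|=s$ the slope is $(F(w)-F(0))/w$; the maximum principle extends the bound inside. Each
Taylor coefficient extracted later costs one factor $2/s$. -/
theorem norm_dslope_le [CompleteSpace E] {F : ℂ → E} {R s e : ℝ} (hs : 0 < s) (hsR : s < R)
    (hF : DifferentiableOn ℂ F (Metric.ball 0 R)) (h : ∀ w : ℂ, ‖w‖ ≤ s → ‖F w‖ ≤ e)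
    {w : ℂ} (hw : ‖w‖ ≤ s) : ‖dslope F 0 w‖ ≤ 2 * e / s := by
  refine norm_le_on_closedBall hs hsR (differentiableOn_dslope_zero (hs.trans hsR) hF)
    (fun z hz => ?_) hw
  have hz0 : z ≠ 0 := by rintro rfl; rw [norm_zero] at hz; exact hs.ne hz
  have h1 := sub_smul_dslope F 0 z
  rw [sub_zero] at h1
  have h2 := congrArg norm h1
  rw [norm_smul, hz] at h2
  rw [le_div_iff₀ hs, mul_comm, h2]
  have := norm_sub_le (F z) (F 0)
  have := h z hz.le
  have := h 0 (by simpa using hs.le)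
  linarith

theorem inv_mem_ball {R : ℝ} (hR : 0 < R) {z : ℂ} (hz : z ∈ puncturedDiskInfty R) :
    z⁻¹ ∈ Metric.ball (0 : ℂ) R ∧ z ≠ 0 := by
  have hz' : R⁻¹ < ‖z‖ := hz
  have h0 : 0 < ‖z‖ := (inv_pos.2 hR).trans hz'
  refine ⟨?_, norm_pos_iff.1 h0⟩
  rw [mem_ball_zero_iff, norm_inv]
  exact inv_lt_of_inv_lt₀ hR hz'

theorem inv_mem_puncturedDiskInfty {R : ℝ} {w : ℂ} (hw : w ∈ Metric.ball (0 : ℂ) R)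
    (hw0 : w ≠ 0) : w⁻¹ ∈ puncturedDiskInfty R := by
  change R⁻¹ < ‖w⁻¹‖
  rw [norm_inv]
  exact (inv_lt_inv₀ ((norm_nonneg _).trans_lt (mem_ball_zero_iff.1 hw))
    (norm_pos_iff.2 hw0)).2 (mem_ball_zero_iff.1 hw)

end Disk

section Uniform

theorem eventually_norm_sub_lt {E : Type*} [NormedAddCommGroup E] {f : ℝ → ℂ → E} {U K : Set ℂ}
    {ε η : ℝ} (hε : 0 < ε) (hη : 0 < η) (hK : IsCompact K) (hKU : K ⊆ U)
    (hf : ContinuousOn (fun p : ℝ × ℂ => f p.1 p.2) (Ioo (-ε) ε ×ˢ U)) :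
    ∀ᶠ t in 𝓝 (0 : ℝ), ∀ z ∈ K, ‖f t z - f 0 z‖ < η := by
  have h0 : (0 : ℝ) ∈ Ioo (-ε) ε := ⟨by linarith, hε⟩
  obtain ⟨v, hv, h⟩ := hK.mem_uniformity_of_prod (f := f)
    (hf.mono (prod_mono_right hKU)) h0 (Metric.dist_mem_uniformity hη)
  rw [isOpen_Ioo.nhdsWithin_eq h0] at hv
  filter_upwards [hv] with t ht z hz
  rw [← dist_eq_norm]
  exact h t ht z hz

end Uniform

section Infinity

variable {ρ : ℝ} [hρ : Fact (1 < ρ)]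

/-- A form with at most a double pole at infinity is `F(1/z) dz` with `F` holomorphic at `0`. -/
theorem exists_extension_of_pole {m : ℕ} (hm : m ≤ 2) {R : ℝ} (hR : 0 < R) {f : ℂ → Wiener ρ}
    (hf : DifferentiableOn ℂ f (puncturedDiskInfty R)) (hp : PoleAtInftyLE m f)
    (hn : ∀ z ∈ puncturedDiskInfty R, (f z).IsNonneg) :
    ∃ F : ℂ → Wiener ρ, DifferentiableOn ℂ F (Metric.ball 0 R) ∧
      (∀ z ∈ puncturedDiskInfty R, f z = F z⁻¹) ∧ (m ≤ 1 → F 0 = 0) ∧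
      ∀ w ∈ Metric.ball (0 : ℂ) R, (F w).IsNonneg := by
  obtain ⟨hmer, hord⟩ := hp
  set g : ℂ → Wiener ρ := fun w => (-(w ^ 2)⁻¹) • f w⁻¹ with hg
  have hpm : MeromorphicAt (fun w : ℂ => -w ^ 2) 0 := by fun_prop
  -- Multiplying by $-w^2$ undoes $dz=-w^{-2}dw$ and raises the order by $2$, so $f(1/w)$ has order
  -- at least $2-m$ at $0$.
  have hpo : meromorphicOrderAt (fun w : ℂ => -w ^ 2) 0 = (2 : ℤ) := by
    rw [meromorphicOrderAt_eq_int_iff hpm]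
    refine ⟨fun _ => -1, analyticAt_const, by simp, Eventually.of_forall fun z => ?_⟩
    simp
  have hG : (fun w : ℂ => (-w ^ 2) • g w) =ᶠ[𝓝[≠] 0] fun w => f w⁻¹ := by
    filter_upwards [self_mem_nhdsWithin] with w hw
    have : w ≠ 0 := hw
    rw [hg]
    simp only [smul_smul]
    rw [show -w ^ 2 * -(w ^ 2)⁻¹ = 1 by field_simp, one_smul]
  have hGm : MeromorphicAt (fun w : ℂ => (-w ^ 2) • g w) 0 := hpm.smul hmer
  have hGo : (((2 : ℤ) - m : ℤ) : WithTop ℤ) ≤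
      meromorphicOrderAt (fun w : ℂ => (-w ^ 2) • g w) 0 := by
    have := meromorphicOrderAt_smul hpm hmer
    rw [show (fun w : ℂ => (-w ^ 2) • g w) = (fun w : ℂ => -w ^ 2) • g from rfl, this, hpo,
      sub_eq_add_neg, WithTop.coe_add]
    gcongr
  obtain ⟨c, hc, hc0⟩ : ∃ c, Tendsto (fun w => f w⁻¹) (𝓝[≠] (0 : ℂ)) (𝓝 c) ∧
      (m ≤ 1 → c = 0) := by
    by_cases h1 : m ≤ 1
    · refine ⟨0, Tendsto.congr' hG ?_, fun _ => rfl⟩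
      refine (tendsto_zero_iff_meromorphicOrderAt_pos hGm).2 (lt_of_lt_of_le ?_ hGo)
      exact_mod_cast (by omega : (0 : ℤ) < 2 - m)
    · obtain ⟨c, hc⟩ := (tendsto_nhds_iff_meromorphicOrderAt_nonneg hGm).2 (le_trans
        (by exact_mod_cast (by omega : (0 : ℤ) ≤ 2 - m)) hGo)
      exact ⟨c, Tendsto.congr' hG hc, fun h => absurd h h1⟩
  have hball : Metric.ball (0 : ℂ) R ∈ 𝓝 (0 : ℂ) := Metric.ball_mem_nhds 0 hR
  have hoff : ∀ w : ℂ, w ≠ 0 → Function.update (fun w : ℂ => f w⁻¹) 0 c w = f w⁻¹ :=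
    fun w hw => Function.update_of_ne hw _ _
  refine ⟨Function.update (fun w => f w⁻¹) 0 c, ?_, fun z hz => ?_, fun h => ?_, fun w hw => ?_⟩
  · refine (Complex.differentiableOn_compl_singleton_and_continuousAt_iff hball).1 ⟨?_, ?_⟩
    · have h1 : DifferentiableOn ℂ (fun w : ℂ => f w⁻¹) (Metric.ball 0 R \ {0}) :=
        hf.comp (fun w hw => (differentiableAt_inv hw.2).differentiableWithinAt)
          fun w hw => inv_mem_puncturedDiskInfty hw.1 hw.2
      exact h1.congr fun w hw => hoff w hw.2
    · exact continuousAt_update_same.2 hc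
  · rw [hoff _ (inv_ne_zero (inv_mem_ball hR hz).2), inv_inv]
  · rw [Function.update_self, hc0 h]
  · by_cases hw0 : w = 0
    · subst hw0
      rw [Function.update_self]
      intro n hn'
      have h1 : Tendsto (fun w : ℂ => (f w⁻¹).coeff n) (𝓝[≠] (0 : ℂ)) (𝓝 (c.coeff n)) :=
        ((Wiener.coeffL n).continuous.tendsto c).comp hc
      refine tendsto_nhds_unique h1 (tendsto_const_nhds.congr' ?_)
      filter_upwards [self_mem_nhdsWithin, mem_nhdsWithin_of_mem_nhds hball] with w hw hwR
      exact (hn _ (inv_mem_puncturedDiskInfty hwR hw) n hn').symm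
    · rw [hoff w hw0]
      exact hn _ (inv_mem_puncturedDiskInfty hw hw0)

theorem coeff_dslope {F : ℂ → Wiener ρ} {R : ℝ} (hR : 0 < R)
    (hF : DifferentiableOn ℂ F (Metric.ball 0 R)) (n : ℤ) (w : ℂ) :
    (dslope F 0 w).coeff n = dslope (fun w => (F w).coeff n) 0 w :=
  ((Wiener.coeffL n).dslope_comp F 0 w fun _ =>
    hF.differentiableAt (Metric.ball_mem_nhds 0 hR)).symm

theorem isNonneg_dslope {F : ℂ → Wiener ρ} {R : ℝ} (hR : 0 < R)
    (hF : DifferentiableOn ℂ F (Metric.ball 0 R))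
    (hn : ∀ w ∈ Metric.ball (0 : ℂ) R, (F w).IsNonneg) :
    ∀ w ∈ Metric.ball (0 : ℂ) R, (dslope F 0 w).IsNonneg := fun w hw n hn' => by
  rw [coeff_dslope hR hF]
  by_cases hw0 : w = 0
  · subst hw0
    rw [dslope_same]
    have : (fun w => (F w).coeff n) =ᶠ[𝓝 0] fun _ => 0 := by
      filter_upwards [Metric.ball_mem_nhds (0 : ℂ) hR] with w hw
      exact hn w hw n hn'
    rw [this.deriv_eq, deriv_const]
  · rw [dslope_of_ne _ hw0, slope_def_field, hn w hw n hn',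
      hn 0 (Metric.mem_ball_self hR) n hn']
    simp

/-- The residue at infinity of `F(1/z) dz`, with `F(0) = 0`, is `-F'(0)`. -/
theorem residueInfty_eq {R : ℝ} (hR : 0 < R) {f F : ℂ → ℂ}
    (hF : DifferentiableOn ℂ F (Metric.ball 0 R)) (hF0 : F 0 = 0)
    (hf : ∀ z ∈ puncturedDiskInfty R, f z = F z⁻¹) : residueInfty f = -deriv F 0 := by
  set F₁ := dslope F 0 with hF₁
  set F₂ := dslope F₁ 0 with hF₂
  have hd₁ : DifferentiableOn ℂ F₁ (Metric.ball 0 R) := differentiableOn_dslope_zero hR hF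
  have hd₂ : DifferentiableOn ℂ F₂ (Metric.ball 0 R) := differentiableOn_dslope_zero hR hd₁
  have hball : Metric.ball (0 : ℂ) R ∈ 𝓝 (0 : ℂ) := Metric.ball_mem_nhds 0 hR
  have hc₂ : ContinuousAt F₂ 0 := (hd₂.differentiableAt hball).continuousAt
  -- The second slope is bounded near $0$, so $f(z)-F'(0)/z=O(z^{-2})$ and its integral over the
  -- circle of radius $r$ is $O(1/r)$.
  obtain ⟨δ, hδ, hb⟩ := Metric.eventually_nhds_iff_ball.1
    ((hc₂.norm.eventually (gt_mem_nhds (lt_add_one ‖F₂ 0‖))).and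
      (Metric.ball_mem_nhds (0 : ℂ) hR))
  set B := ‖F₂ 0‖ + 1 with hB
  have hval : ∀ z : ℂ, δ⁻¹ < ‖z‖ → f z - deriv F 0 * z⁻¹ = (z⁻¹) ^ 2 * F₂ z⁻¹ ∧
      ‖F₂ z⁻¹‖ ≤ B ∧ z ∈ puncturedDiskInfty R := fun z hz => by
    obtain ⟨h1, h2⟩ := inv_mem_ball hδ (show z ∈ puncturedDiskInfty δ from hz)
    obtain ⟨h3, h4⟩ := hb _ h1
    have h5 : z ∈ puncturedDiskInfty R := by
      simpa using inv_mem_puncturedDiskInfty h4 (inv_ne_zero h2)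
    refine ⟨?_, h3.le, h5⟩
    have e1 := dslope_zero_eq F z⁻¹
    have e2 := dslope_zero_eq F₁ z⁻¹
    rw [hf z h5, e1, hF0, ← hF₁, e2, ← hF₂, hF₁, dslope_same]
    simp only [smul_eq_mul]
    ring
  have hfc : ContinuousOn f (puncturedDiskInfty R) := by
    have h1 : ContinuousOn (fun z : ℂ => F z⁻¹) (puncturedDiskInfty R) :=
      hF.continuousOn.comp (fun z hz => (continuousAt_inv₀ (inv_mem_ball hR hz).2).continuousWithinAt)
        fun z hz => (inv_mem_ball hR hz).1
    exact h1.congr hf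
  have hint : ∀ r : ℝ, δ⁻¹ < r →
      ‖-(2 * Real.pi * Complex.I)⁻¹ * (∮ z in C(0, r), f z) - -deriv F 0‖ ≤ B * r⁻¹ := by
    intro r hr
    have hr0 : 0 < r := (inv_pos.2 hδ).trans hr
    have hsph : ∀ z ∈ Metric.sphere (0 : ℂ) r, δ⁻¹ < ‖z‖ := fun z hz => by
      rw [mem_sphere_zero_iff_norm.1 hz]; exact hr
    have hz0 : ∀ z ∈ Metric.sphere (0 : ℂ) r, z ≠ 0 := fun z hz =>
      (inv_mem_ball hδ (hsph z hz)).2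
    have hi1 : CircleIntegrable f 0 r :=
      (hfc.mono fun z hz => (hval z (hsph z hz)).2.2).circleIntegrable hr0.le
    have hi2 : CircleIntegrable (fun z => deriv F 0 * z⁻¹) 0 r :=
      ContinuousOn.circleIntegrable hr0.le
        (continuousOn_const.mul (continuousOn_id.inv₀ hz0))
    have hI2 : (∮ z in C(0, r), deriv F 0 * z⁻¹) = deriv F 0 * (2 * Real.pi * Complex.I) := by
      rw [circleIntegral.integral_const_mul]
      congr 1
      simpa using circleIntegral.integral_sub_center_inv (0 : ℂ) hr0.ne'
    have hsub := circleIntegral.integral_sub hi1 hi2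
    have hbd : ‖∮ z in C(0, r), (f z - deriv F 0 * z⁻¹)‖ ≤ 2 * Real.pi * r * ((r⁻¹) ^ 2 * B) := by
      refine circleIntegral.norm_integral_le_of_norm_le_const hr0.le fun z hz => ?_
      obtain ⟨h1, h2, -⟩ := hval z (hsph z hz)
      rw [h1, norm_mul, norm_pow, norm_inv, mem_sphere_zero_iff_norm.1 hz]
      gcongr
    have h2pi : (2 * Real.pi * Complex.I : ℂ) ≠ 0 := Complex.two_pi_I_ne_zero
    have e : -(2 * Real.pi * Complex.I)⁻¹ * (∮ z in C(0, r), f z) - -deriv F 0 =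
        -(2 * Real.pi * Complex.I)⁻¹ * ∮ z in C(0, r), (f z - deriv F 0 * z⁻¹) := by
      rw [hsub, hI2]
      field_simp
      ring
    rw [e, norm_mul, norm_neg, norm_inv]
    have h3 : ‖(2 * Real.pi * Complex.I : ℂ)‖ = 2 * Real.pi := by simp [abs_of_pos Real.pi_pos]
    rw [h3, inv_mul_le_iff₀ (by positivity)]
    refine hbd.trans (le_of_eq ?_)
    field_simp
  have hlim : Tendsto (fun r : ℝ => -(2 * Real.pi * Complex.I)⁻¹ * ∮ z in C(0, r), f z) atTop
      (𝓝 (-deriv F 0)) := by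
    rw [tendsto_iff_norm_sub_tendsto_zero]
    have h0 : Tendsto (fun r : ℝ => B * r⁻¹) atTop (𝓝 0) := by
      simpa using tendsto_inv_atTop_zero.const_mul B
    refine squeeze_zero' (Eventually.of_forall fun _ => norm_nonneg _) ?_ h0
    filter_upwards [eventually_gt_atTop δ⁻¹] with r hr using hint r hr
  exact hlim.limUnder_eq

end Infinity

end DPW

end

/-! ### The gauged frame and its singular part -/

noncomputable section

open scoped Matrix.Norms.Operator ComplexConjugate

namespace DPW

section Frames

/-- The frame `G(z) P(z)⁻¹`, where `G` is the gauge and `P` the solution of the gauged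
potential in the unperturbed case. -/
def gaugeFrame (l g z w : ℂ) : Matrix (Fin 2) (Fin 2) ℂ := !![1, -z / l; l * (1 + g) * w, -g]

/-- The solution of the gauged unperturbed potential. -/
def baseFrame (l w : ℂ) : Matrix (Fin 2) (Fin 2) ℂ := !![0, 1 / l; -l, w]

/-- The inverse of `baseFrame`. -/
def baseFrameInv (l w : ℂ) : Matrix (Fin 2) (Fin 2) ℂ := !![w, -1 / l; l, 0]

/-- The holomorphic part (coefficient of `dw`) of the potential in the frame `gaugeFrame`. -/
def regularPart (l a b c w : ℂ) : Matrix (Fin 2) (Fin 2) ℂ :=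
  baseFrame l w * !![a, (b + 1) / l; c, -a] * baseFrameInv l w

/-- The singular part (coefficient of `dz`) of the potential in the frame `gaugeFrame`. -/
def singularPart (l p q r z w : ℂ) : Matrix (Fin 2) (Fin 2) ℂ :=
  (p * z + q + r * w) • !![w / l, -1 / l ^ 2; w ^ 2, -w / l]

/-- The residue of the singular part. -/
def singularResidue (l p q r : ℂ) : Matrix (Fin 2) (Fin 2) ℂ :=
  !![q / l, -r / l ^ 2; p, -(q / l)]

/-- With $z=e^\zeta$ one has $dz=z\,d\zeta$ and $dw=-w\,d\zeta$, which explains the weights; the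
added matrix is the $\zeta$-derivative of the frame. The hypotheses say that the gauge by $g$ yields
$a,b,c$ times $dw$ plus $(pz+q+rw)\,dz$ in the lower left corner. Conjugation by `baseFrame`
subtracts the unperturbed value $b=-1$, so the regular part is small. -/
theorem gauge_identity {l g z w a b c p q r A B C : ℂ} (hl : l ≠ 0) (hzw : z * w = 1)
    (hA : A = -(w ^ 2 * a) - w * (g * B + 1)) (hB : B = -b)
    (hC : C = 2 * l * g * w * A + l * g ^ 2 * w ^ 2 * B + l * g * w ^ 2 + p * w + q * w ^ 2 +
      r * w ^ 3 - w ^ 4 * c) :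
    z • (!![A, l⁻¹ * B; C, -A] * gaugeFrame l g z w) + !![0, -z / l; -(l * (1 + g) * w), 0] =
      gaugeFrame l g z w * (-w • regularPart l a b c w + z • singularPart l p q r z w) := by
  have hw : w ≠ 0 := right_ne_zero_of_mul_eq_one hzw
  obtain rfl : z = w⁻¹ := eq_inv_of_mul_eq_one_left hzw
  subst hC hA hB
  ext i j
  fin_cases i <;> fin_cases j <;>
    simp [gaugeFrame, regularPart, singularPart, baseFrame, baseFrameInv] <;>
    field_simp <;> ring

theorem norm_regularPart_le {l a b c w : ℂ} {s e : ℝ} (hl : ‖l‖ = 1) (hw : ‖w‖ ≤ s)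
    (ha : ‖a‖ ≤ e) (hb : ‖b + 1‖ ≤ e) (hc : ‖c‖ ≤ e) :
    ‖regularPart l a b c w‖ ≤ 2 * (1 + s) ^ 2 * e := by
  have hs : 0 ≤ s := (norm_nonneg _).trans hw
  have h1 : ‖baseFrame l w‖ ≤ 1 + s := norm_le_of_rows fun i => by
    fin_cases i <;> simp [baseFrame, hl, hs, hw]
  have h2 : ‖baseFrameInv l w‖ ≤ 1 + s := norm_le_of_rows fun i => by
    fin_cases i <;> simp [baseFrameInv, hl, hs, hw, add_comm]
  have h3 : ‖(!![a, (b + 1) / l; c, -a] : Matrix (Fin 2) (Fin 2) ℂ)‖ ≤ 2 * e :=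
    norm_le_of_entries fun i j => by
      fin_cases i <;> fin_cases j <;> simp [hl, ha, hb, hc]
  have he : 0 ≤ e := (norm_nonneg _).trans ha
  calc _ ≤ ‖baseFrame l w‖ * ‖(!![a, (b + 1) / l; c, -a] : Matrix (Fin 2) (Fin 2) ℂ)‖ *
        ‖baseFrameInv l w‖ := (norm_mul_le _ _).trans
          (mul_le_mul_of_nonneg_right (norm_mul_le _ _) (norm_nonneg _))
    _ ≤ (1 + s) * (2 * e) * (1 + s) := by gcongr
    _ = _ := by ring

theorem norm_singularPart_le {l p q r z w : ℂ} {t d : ℝ} (hl : ‖l‖ = 1) (hw : ‖w‖ = t)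
    (hz : ‖z‖ = t⁻¹) (hp : ‖p‖ ≤ d) (hq : ‖q‖ ≤ d) (hr : ‖r‖ ≤ d) :
    ‖singularPart l p q r z w‖ ≤ (t⁻¹ + 1 + t) * (1 + t) ^ 2 * d := by
  have ht : 0 ≤ t := hw ▸ norm_nonneg w
  have h1 : ‖p * z + q + r * w‖ ≤ (t⁻¹ + 1 + t) * d := by
    refine norm_add₃_le.trans ?_
    rw [norm_mul, norm_mul, hw, hz]
    calc _ ≤ d * t⁻¹ + d + d * t := by gcongr
      _ = _ := by ring
  have h2 : ‖(!![w / l, -1 / l ^ 2; w ^ 2, -w / l] : Matrix (Fin 2) (Fin 2) ℂ)‖ ≤ (1 + t) ^ 2 :=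
    norm_le_of_rows fun i => by
      fin_cases i <;> simp [hl, hw] <;> nlinarith
  have h3 : 0 ≤ t⁻¹ := inv_nonneg.2 ht
  have hd : 0 ≤ d := (norm_nonneg _).trans hp
  rw [singularPart, norm_smul]
  calc _ ≤ (t⁻¹ + 1 + t) * d * (1 + t) ^ 2 := by gcongr
    _ = _ := by ring

/-- A primitive of the singular part along `z = exp ζ`. -/
def singularPrimitive (l p q r ζ : ℂ) : Matrix (Fin 2) (Fin 2) ℂ :=
  !![(p * Complex.exp ζ + q * ζ - r * Complex.exp (-ζ)) / l,
    -((p / 2 * Complex.exp ζ ^ 2 + q * Complex.exp ζ + r * ζ) / l ^ 2);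
    p * ζ - q * Complex.exp (-ζ) - r / 2 * Complex.exp (-ζ) ^ 2,
    -((p * Complex.exp ζ + q * ζ - r * Complex.exp (-ζ)) / l)]

theorem hasDerivAt_exp_neg (ζ : ℂ) :
    HasDerivAt (fun x => Complex.exp (-x)) (-Complex.exp (-ζ)) ζ := by
  simpa using (hasDerivAt_neg ζ).cexp

theorem exp_mul_exp_neg (ζ : ℂ) : Complex.exp ζ * Complex.exp (-ζ) = 1 := by
  rw [← Complex.exp_add, add_neg_cancel, Complex.exp_zero]

theorem hasDerivAt_singularPrimitive (l p q r ζ : ℂ) :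
    HasDerivAt (singularPrimitive l p q r)
      (Complex.exp ζ • singularPart l p q r (Complex.exp ζ) (Complex.exp (-ζ))) ζ := by
  have hz := Complex.hasDerivAt_exp ζ
  have hw := hasDerivAt_exp_neg ζ
  have hi := hasDerivAt_id ζ
  have hzw := exp_mul_exp_neg ζ
  have h00 : HasDerivAt (fun x => (p * Complex.exp x + q * x - r * Complex.exp (-x)) / l)
      ((p * Complex.exp ζ + q * 1 - r * -Complex.exp (-ζ)) / l) ζ :=
    (((hz.const_mul p).add (hi.const_mul q)).sub (hw.const_mul r)).div_const l
  have h01 : HasDerivAt (fun x => -((p / 2 * Complex.exp x ^ 2 + q * Complex.exp x + r * x) / l ^ 2))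
      (-((p / 2 * (2 * Complex.exp ζ * Complex.exp ζ) + q * Complex.exp ζ + r * 1) / l ^ 2)) ζ := by
    have hz2 : HasDerivAt (fun x => Complex.exp x ^ 2) (2 * Complex.exp ζ * Complex.exp ζ) ζ := by
      exact (hz.fun_pow 2).congr_deriv (by simp)
    exact ((((hz2.const_mul _).add (hz.const_mul q)).add (hi.const_mul r)).div_const _).neg
  have h10 : HasDerivAt (fun x => p * x - q * Complex.exp (-x) - r / 2 * Complex.exp (-x) ^ 2)
      (p * 1 - q * -Complex.exp (-ζ) - r / 2 * (2 * Complex.exp (-ζ) * -Complex.exp (-ζ))) ζ := by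
    have hw2 : HasDerivAt (fun x => Complex.exp (-x) ^ 2)
        (2 * Complex.exp (-ζ) * -Complex.exp (-ζ)) ζ := by
      exact (hw.fun_pow 2).congr_deriv (by simp)
    exact ((hi.const_mul p).sub (hw.const_mul q)).sub (hw2.const_mul _)
  refine hasDerivAt_matrix fun i j => ?_
  fin_cases i <;> fin_cases j
  · refine h00.congr_deriv ?_
    simp [singularPart]
    linear_combination (-(p * Complex.exp ζ + q + r * Complex.exp (-ζ)) / l) * hzw
  · refine h01.congr_deriv ?_
    simp [singularPart]
    linear_combination (r / l ^ 2) * hzw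
  · refine h10.congr_deriv ?_
    simp [singularPart]
    linear_combination (-p * Complex.exp ζ * Complex.exp (-ζ) - p - q * Complex.exp (-ζ)
      - r * Complex.exp (-ζ) ^ 2) * hzw
  · refine h00.neg.congr_deriv ?_
    simp [singularPart]
    linear_combination ((p * Complex.exp ζ + q + r * Complex.exp (-ζ)) / l) * hzw

/-- Only the terms linear in $\zeta$ change over a period, and their coefficients form the residue
matrix. -/
theorem singularPrimitive_sub (l p q r ζ : ℂ) :
    singularPrimitive l p q r (ζ + 2 * Real.pi * Complex.I) - singularPrimitive l p q r ζ =
      (2 * Real.pi * Complex.I : ℂ) • singularResidue l p q r := by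
  have h1 : Complex.exp (ζ + 2 * Real.pi * Complex.I) = Complex.exp ζ := Complex.exp_periodic ζ
  have h2 : Complex.exp (-(ζ + 2 * Real.pi * Complex.I)) = Complex.exp (-ζ) := by
    rw [Complex.exp_neg, h1, Complex.exp_neg]
  ext i j
  fin_cases i <;> fin_cases j <;>
    simp only [singularPrimitive, singularResidue, h1, h2] <;> simp <;> ring

theorem hasDerivAt_gaugeFrame (l g ζ : ℂ) :
    HasDerivAt (fun x => gaugeFrame l g (Complex.exp x) (Complex.exp (-x)))
      !![0, -Complex.exp ζ / l; -(l * (1 + g) * Complex.exp (-ζ)), 0] ζ := by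
  refine hasDerivAt_matrix fun i j => ?_
  fin_cases i <;> fin_cases j
  · exact hasDerivAt_const ζ (1 : ℂ)
  · exact (Complex.hasDerivAt_exp ζ).neg.div_const l
  · refine ((hasDerivAt_exp_neg ζ).const_mul (l * (1 + g))).congr_deriv ?_
    simp
  · exact hasDerivAt_const ζ (-g)

end Frames

/-! ### Monodromy estimates at a fixed loop parameter -/

section Estimate

theorem mem_segment_period {ζ₀ ζ : ℂ} (h : ζ ∈ segment ℝ ζ₀ (ζ₀ + 2 * Real.pi * Complex.I)) :
    ζ.re = ζ₀.re ∧ ‖ζ - ζ₀‖ ≤ 2 * Real.pi := by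
  rw [segment_eq_image'] at h
  obtain ⟨θ, ⟨h0, h1⟩, rfl⟩ := h
  have hpi := Real.pi_pos
  constructor
  · simp
  · simp [abs_of_pos hpi, abs_of_nonneg h0]
    nlinarith

theorem isCompact_segment (x y : ℂ) : IsCompact (segment ℝ x y) := by
  rw [segment_eq_image']
  exact isCompact_Icc.image (by fun_prop)

theorem differentiableOn_regularPart {l : ℂ} {a b c : ℂ → ℂ} {U : Set ℂ}
    (ha : DifferentiableOn ℂ a U) (hb : DifferentiableOn ℂ b U) (hc : DifferentiableOn ℂ c U)
    (hU : IsOpen U) :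
    DifferentiableOn ℂ (fun w => regularPart l (a w) (b w) (c w) w) U := by
  intro w hw
  have hnh := hU.mem_nhds hw
  have ha' := (ha.differentiableAt hnh).hasDerivAt
  have hb' := (hb.differentiableAt hnh).hasDerivAt
  have hc' := (hc.differentiableAt hnh).hasDerivAt
  have hi := hasDerivAt_id w
  have e1 : HasDerivAt (fun w => baseFrame l w) !![0, 0; 0, 1] w :=
    hasDerivAt_matrix fun i j => by
      fin_cases i <;> fin_cases j
      · exact hasDerivAt_const w _
      · exact hasDerivAt_const w _
      · exact hasDerivAt_const w _
      · exact hi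
  have e2 : HasDerivAt (fun w => baseFrameInv l w) !![1, 0; 0, 0] w :=
    hasDerivAt_matrix fun i j => by
      fin_cases i <;> fin_cases j
      · exact hi
      · exact hasDerivAt_const w _
      · exact hasDerivAt_const w _
      · exact hasDerivAt_const w _
  have e3 : HasDerivAt (fun w => (!![a w, (b w + 1) / l; c w, -a w] : Matrix (Fin 2) (Fin 2) ℂ))
      !![deriv a w, deriv b w / l; deriv c w, -deriv a w] w :=
    hasDerivAt_matrix fun i j => by
      fin_cases i <;> fin_cases j
      · exact ha'
      · exact (hb'.add_const 1).div_const l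
      · exact hc'
      · exact ha'.neg
  exact ((e1.mul e3).mul e2).differentiableAt.differentiableWithinAt

/-- First order expansion of the monodromy of `Φ`, in the frame `gaugeFrame`, for a potential with
regular part `κ` and singular part with coefficients `p, q, r`. -/
theorem norm_monodromy_sub_residue_le {t s c₀ c₁ c₂ e d : ℝ} {l g p q r ζ₀ : ℂ}
    {κ Φ ξ : ℂ → Matrix (Fin 2) (Fin 2) ℂ} {N : Matrix (Fin 2) (Fin 2) ℂ}
    (ht : 0 < t) (hts : t < s) (hc₀ : 0 ≤ c₀) (hc₁ : t⁻¹ * ((t⁻¹ + 1 + t) * (1 + t) ^ 2) = c₁)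
    (hc₂ : t * c₀ + c₁ + c₀ * s * (1 - t / s)⁻¹ = c₂) (he : 0 ≤ e)
    (b0 : c₀ * s * e ≤ 1 / 2) (b2 : c₂ * e ≤ 1 / 2) (b3 : c₂ * (2 * Real.pi) * e ≤ 1 / 2)
    (hl : ‖l‖ = 1) (hζ₀ : Real.exp (-ζ₀.re) = t)
    (hκd : DiffContOnCl ℂ κ (Metric.ball 0 s)) (hκb : ∀ w : ℂ, ‖w‖ ≤ s → ‖κ w‖ ≤ c₀ * e)
    (hp : ‖p‖ ≤ d) (hq : ‖q‖ ≤ d) (hr : ‖r‖ ≤ d) (hde : d ≤ e)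
    (hgauge : ∀ z w : ℂ, z * w = 1 → ‖w‖ = t →
      z • (ξ w * gaugeFrame l g z w) + !![0, -z / l; -(l * (1 + g) * w), 0] =
        gaugeFrame l g z w * (-w • κ w + z • singularPart l p q r z w))
    (hΦ : ∀ ζ, ζ.re = ζ₀.re →
      HasDerivAt Φ (Complex.exp ζ • (Φ ζ * ξ (Complex.exp (-ζ)))) ζ)
    (hmon : Φ (ζ₀ + 2 * Real.pi * Complex.I) = (1 + N) * Φ ζ₀) :
    ‖N * (Φ ζ₀ * gaugeFrame l g (Complex.exp ζ₀) (Complex.exp (-ζ₀))) -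
      (Φ ζ₀ * gaugeFrame l g (Complex.exp ζ₀) (Complex.exp (-ζ₀))) *
        ((2 * Real.pi * Complex.I : ℂ) • singularResidue l p q r)‖ ≤
      (8 * (2 * Real.pi) ^ 2 + 4 * (2 * Real.pi)) * (c₂ * e) * (c₁ * d) *
        ‖Φ ζ₀ * gaugeFrame l g (Complex.exp ζ₀) (Complex.exp (-ζ₀))‖ := by
  have hs : 0 < s := ht.trans hts
  have hts1 : 0 < 1 - t / s := sub_pos.2 ((div_lt_one hs).2 hts)
  have hd0 : 0 ≤ d := (norm_nonneg _).trans hp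
  have p₁ : 0 ≤ c₁ := by rw [← hc₁]; positivity
  have p₂ : 0 ≤ c₂ := by rw [← hc₂]; positivity
  -- `Q` is a function of $w=e^{-\zeta}$ on a full disk around $w=0$, hence single valued: the
  -- regular part contributes no monodromy.
  obtain ⟨Q, hQ⟩ := exists_linear_ode_solution (e := c₀ * e) hs (by positivity) hκd
    (fun w hw => hκb w (mem_sphere_zero_iff_norm.1 hw).le) (by linarith)
  have hwn : ∀ ζ ∈ segment ℝ ζ₀ (ζ₀ + 2 * Real.pi * Complex.I), ‖Complex.exp (-ζ)‖ = t :=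
    fun ζ hζ => by rw [Complex.norm_exp, Complex.neg_re, (mem_segment_period hζ).1, hζ₀]
  have hzn : ∀ ζ ∈ segment ℝ ζ₀ (ζ₀ + 2 * Real.pi * Complex.I), ‖Complex.exp ζ‖ = t⁻¹ :=
    fun ζ hζ => by
      rw [Complex.norm_exp, (mem_segment_period hζ).1, ← hζ₀, Real.exp_neg, inv_inv]
  obtain ⟨H, hH⟩ : ∃ H : ℂ → Matrix (Fin 2) (Fin 2) ℂ,
    H = fun ζ => gaugeFrame l g (Complex.exp ζ) (Complex.exp (-ζ)) := ⟨_, rfl⟩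
  obtain ⟨S, hS⟩ : ∃ S : ℂ → Matrix (Fin 2) (Fin 2) ℂ, S = fun ζ =>
    Complex.exp ζ • singularPart l p q r (Complex.exp ζ) (Complex.exp (-ζ)) := ⟨_, rfl⟩
  obtain ⟨k, hk⟩ : ∃ k : ℂ → Matrix (Fin 2) (Fin 2) ℂ, k = fun ζ =>
    -Complex.exp (-ζ) • κ (Complex.exp (-ζ)) + S ζ := ⟨_, rfl⟩
  have hΘ : ∀ ζ ∈ segment ℝ ζ₀ (ζ₀ + 2 * Real.pi * Complex.I),
      HasDerivAt (fun ζ => Φ ζ * H ζ) (Φ ζ * H ζ * k ζ) ζ := fun ζ hζ => by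
    have h1 := (hΦ ζ (mem_segment_period hζ).1).mul (hasDerivAt_gaugeFrame l g ζ)
    rw [hH]
    refine h1.congr_deriv ?_
    have h2 := hgauge _ _ (exp_mul_exp_neg ζ) (hwn ζ hζ)
    rw [mul_assoc (Φ ζ), hk, hS]
    beta_reduce
    rw [← h2, smul_mul_assoc, mul_assoc, ← mul_smul_comm, ← mul_add]
  have hSb : ∀ ζ ∈ segment ℝ ζ₀ (ζ₀ + 2 * Real.pi * Complex.I), ‖S ζ‖ ≤ c₁ * d := fun ζ hζ => by
    rw [hS]
    beta_reduce
    rw [norm_smul, hzn ζ hζ, ← hc₁, mul_assoc]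
    exact mul_le_mul_of_nonneg_left
      (norm_singularPart_le hl (hwn ζ hζ) (hzn ζ hζ) hp hq hr) (by positivity)
  have hkb : ∀ ζ ∈ segment ℝ ζ₀ (ζ₀ + 2 * Real.pi * Complex.I), ‖k ζ‖ ≤ c₂ * e := fun ζ hζ => by
    have h1 : ‖-Complex.exp (-ζ) • κ (Complex.exp (-ζ))‖ ≤ t * (c₀ * e) := by
      rw [norm_smul, norm_neg, hwn ζ hζ]
      exact mul_le_mul_of_nonneg_left (hκb _ ((hwn ζ hζ).trans_le hts.le)) ht.le
    have h2 : c₁ * d ≤ c₁ * e := mul_le_mul_of_nonneg_left hde p₁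
    have h3 : 0 ≤ c₀ * s * (1 - t / s)⁻¹ * e := by positivity
    rw [hk]
    refine (norm_add_le _ _).trans ((add_le_add h1 (hSb ζ hζ)).trans ?_)
    rw [← hc₂]
    linarith
  have hball : ∀ ζ ∈ segment ℝ ζ₀ (ζ₀ + 2 * Real.pi * Complex.I),
      Complex.exp (-ζ) ∈ Metric.ball (0 : ℂ) s := fun ζ hζ => by
    rw [mem_ball_zero_iff, hwn ζ hζ]; exact hts
  -- Since $dw=-w\,d\zeta$, the derivative of $Q$ cancels the $\kappa$ term of `k`, and only the
  -- singular part survives between $\Phi H$ and $Q$.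
  have hT : ∀ ζ ∈ segment ℝ ζ₀ (ζ₀ + 2 * Real.pi * Complex.I),
      HasDerivAt (fun ζ => Φ ζ * H ζ * Q (Complex.exp (-ζ)))
      (Φ ζ * H ζ * S ζ * Q (Complex.exp (-ζ))) ζ := fun ζ hζ => by
    have h1 := (hΘ ζ hζ).mul ((hQ _ (hball ζ hζ)).1.scomp ζ (hasDerivAt_exp_neg ζ))
    refine h1.congr_deriv ?_
    simp only [hk, Function.comp_apply, mul_add, add_mul, smul_mul_assoc, mul_smul_comm, neg_smul,
      smul_neg, neg_neg, mul_neg, neg_mul, mul_assoc]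
    abel
  have hQ1 : ∀ ζ ∈ segment ℝ ζ₀ (ζ₀ + 2 * Real.pi * Complex.I),
      ‖Q (Complex.exp (-ζ)) - 1‖ ≤ c₂ * e := fun ζ hζ => by
    have h1 := (hQ _ (hball ζ hζ)).2
    rw [hwn ζ hζ] at h1
    have h3 : 0 ≤ (t * c₀ + c₁) * e := by positivity
    refine h1.trans ?_
    rw [← hc₂]
    linarith
  have hper : Complex.exp (ζ₀ + 2 * Real.pi * Complex.I) = Complex.exp ζ₀ := Complex.exp_periodic ζ₀
  have hper' : Complex.exp (-(ζ₀ + 2 * Real.pi * Complex.I)) = Complex.exp (-ζ₀) := by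
    rw [Complex.exp_neg, hper, Complex.exp_neg]
  have hHper : H (ζ₀ + 2 * Real.pi * Complex.I) = H ζ₀ := by
    rw [hH]; beta_reduce; rw [hper, hper']
  have hN : Φ (ζ₀ + 2 * Real.pi * Complex.I) * H (ζ₀ + 2 * Real.pi * Complex.I) - Φ ζ₀ * H ζ₀ =
      N * (Φ ζ₀ * H ζ₀) := by
    rw [hmon, hHper, add_mul, one_mul, add_mul, add_sub_cancel_left, mul_assoc]
  have hJ : ∀ ζ ∈ segment ℝ ζ₀ (ζ₀ + 2 * Real.pi * Complex.I),
      HasDerivAt (singularPrimitive l p q r) (S ζ) ζ := fun ζ _ => by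
    rw [hS]; exact hasDerivAt_singularPrimitive l p q r ζ
  have key := norm_monodromy_sub_le (Θ := fun ζ => Φ ζ * H ζ) (Q := fun ζ => Q (Complex.exp (-ζ)))
    (isCompact_segment _ _) (convex_segment _ _) (left_mem_segment ℝ _ _) (right_mem_segment ℝ _ _)
    (fun ζ hζ => (mem_segment_period hζ).2) hΘ hkb (by positivity) b2 (by linarith) hT
    hJ hSb (by positivity) hQ1 (by rw [hper']) hN
  rw [singularPrimitive_sub, hH] at key
  exact key

/-- Consequences of the expansion `N V = V (2πi X) + …` for a matrix `N` in the real span of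
`SU(2)`. -/
theorem residue_estimates {K τ d : ℝ} {l p q r : ℂ} {V V' N : Matrix (Fin 2) (Fin 2) ℂ}
    (hl : ‖l‖ = 1) (hVV' : V * V' = 1) (hV'V : V' * V = 1) (hVK : ‖V‖ * ‖V'‖ ≤ K)
    (hp : ‖p‖ ≤ d) (hq : ‖q‖ ≤ d) (hr : ‖r‖ ≤ d) (hd : ‖p‖ = d ∨ ‖q‖ = d ∨ ‖r‖ = d)
    (hN0 : N 1 1 = conj (N 0 0)) (hN1 : N 1 0 = -conj (N 0 1))
    (hNV : ‖N * V - V * ((2 * Real.pi * Complex.I : ℂ) • singularResidue l p q r)‖ ≤ τ * d * ‖V‖)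
    (hτ0 : 0 ≤ τ) (hτ : 100 * K ^ 2 * (K * τ) ≤ 1) (hτ1 : K * τ ≤ 1) :
    d ≤ K * ‖N‖ ∧ ‖N‖ ≤ 20 * K * d ∧ (0 < d → 0 < ((q ^ 2 - p * r) / l ^ 2).re) := by
  have hd0 : 0 ≤ d := (norm_nonneg _).trans hp
  have hK : 0 ≤ K := (by positivity : 0 ≤ ‖V‖ * ‖V'‖).trans hVK
  obtain ⟨X, hX⟩ : ∃ X, X = (2 * Real.pi * Complex.I : ℂ) • singularResidue l p q r := ⟨_, rfl⟩
  obtain ⟨E, hE⟩ : ∃ E, E = V' * (N * V - V * X) := ⟨_, rfl⟩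
  have hEeq : V' * N * V = X + E := by
    rw [hE, mul_sub, ← mul_assoc V' V, hV'V, one_mul, mul_assoc, add_sub_cancel]
  have hEn : ‖E‖ ≤ K * τ * d := by
    rw [← hX] at hNV
    rw [hE]
    calc _ ≤ ‖V'‖ * (τ * d * ‖V‖) :=
          (norm_mul_le _ _).trans (mul_le_mul_of_nonneg_left hNV (norm_nonneg _))
      _ = ‖V‖ * ‖V'‖ * (τ * d) := by ring
      _ ≤ K * (τ * d) := mul_le_mul_of_nonneg_right hVK (mul_nonneg hτ0 hd0)
      _ = _ := by ring
  have hx : ‖q / l‖ = ‖q‖ := by rw [norm_div, hl, div_one]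
  have hy : ‖-r / l ^ 2‖ = ‖r‖ := by rw [norm_div, norm_pow, hl, norm_neg, one_pow, div_one]
  have hEeq' := hEeq
  rw [hX] at hEeq'
  obtain ⟨f1, f2⟩ := re_pos_of_conj_near (d := d) (τ := K * τ) hVV' hVK hN0 hN1
    (hx.trans_le hq) (hy.trans_le hr) hp (by rw [hx, hy]; tauto) hEeq' hEn hτ
  refine ⟨f1, ?_, fun h => ?_⟩
  · have hXn : ‖X‖ ≤ 16 * d := by
      rw [hX, norm_smul]
      have h1 : ‖(2 * Real.pi * Complex.I : ℂ)‖ ≤ 8 := by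
        simp [abs_of_pos Real.pi_pos]
        linarith [Real.pi_lt_four]
      have h2 : ‖singularResidue l p q r‖ ≤ 2 * d := norm_le_of_entries fun i j => by
        fin_cases i <;> fin_cases j
        · exact hx.trans_le hq
        · exact hy.trans_le hr
        · exact hp
        · exact (norm_neg _).trans_le (hx.trans_le hq)
      have := mul_le_mul h1 h2 (norm_nonneg _) (by norm_num)
      linarith
    have hNeq : N = V * (X + E) * V' := by
      rw [← hEeq, ← mul_assoc, ← mul_assoc, hVV', one_mul, mul_assoc, hVV', mul_one]
    have hEn' : ‖E‖ ≤ d := hEn.trans (mul_le_of_le_one_left hd0 hτ1)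
    rw [hNeq]
    calc _ ≤ ‖V‖ * ‖X + E‖ * ‖V'‖ := (norm_mul_le _ _).trans
          (mul_le_mul_of_nonneg_right (norm_mul_le _ _) (norm_nonneg _))
      _ = ‖V‖ * ‖V'‖ * ‖X + E‖ := by ring
      _ ≤ K * (16 * d + d) := mul_le_mul hVK
          ((norm_add_le _ _).trans (add_le_add hXn hEn')) (norm_nonneg _) hK
      _ ≤ _ := by nlinarith [mul_nonneg hK hd0]
  · have := f2 h
    have e : (q / l) ^ 2 + -r / l ^ 2 * p = (q ^ 2 - p * r) / l ^ 2 := by ring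
    rwa [e] at this

/-- Collects finitely many smallness requirements, so that each constant below is chosen once from
an explicit list. -/
theorem exists_small_constant {ι : Type*} (S : Finset ι) (c : ι → ℝ) :
    ∃ e : ℝ, 0 < e ∧ ∀ i ∈ S, c i * e ≤ 1 / 2 := by
  refine ⟨(2 * (1 + ∑ i ∈ S, |c i|))⁻¹, ?_, fun i hi => ?_⟩
  · have := Finset.sum_nonneg (fun i (_ : i ∈ S) => abs_nonneg (c i))
    positivity
  · have h1 := Finset.sum_nonneg (fun i (_ : i ∈ S) => abs_nonneg (c i))
    have h2 := Finset.single_le_sum (f := fun i => |c i|) (fun i _ => abs_nonneg (c i)) hi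
    have h3 := le_abs_self (c i)
    have h4 : 0 < 2 * (1 + ∑ i ∈ S, |c i|) := by linarith
    rw [← div_eq_mul_inv, div_le_iff₀ h4]
    linarith

/-- First order expansion of the monodromy at a fixed value of the loop variable. -/
theorem exists_monodromy_estimate {t s R K : ℝ} (ht : 0 < t) (hts : t < s) (hsR : s < R) :
    ∃ e > 0, ∀ (l g p q r ζ₀ : ℂ) (a b c : ℂ → ℂ) (Φ : ℂ → Matrix (Fin 2) (Fin 2) ℂ)
      (A B C : ℂ → ℂ) (V' N : Matrix (Fin 2) (Fin 2) ℂ) (d : ℝ),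
      ‖l‖ = 1 → Real.exp (-ζ₀.re) = t →
      DifferentiableOn ℂ a (Metric.ball 0 R) → DifferentiableOn ℂ b (Metric.ball 0 R) →
      DifferentiableOn ℂ c (Metric.ball 0 R) →
      (∀ w, ‖w‖ ≤ s → ‖a w‖ ≤ e ∧ ‖b w + 1‖ ≤ e ∧ ‖c w‖ ≤ e) →
      ‖p‖ ≤ d → ‖q‖ ≤ d → ‖r‖ ≤ d → (‖p‖ = d ∨ ‖q‖ = d ∨ ‖r‖ = d) → d ≤ e →
      (∀ w, ‖w‖ = t → A w = -(w ^ 2 * a w) - w * (g * B w + 1) ∧ B w = -b w ∧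
        C w = 2 * l * g * w * A w + l * g ^ 2 * w ^ 2 * B w + l * g * w ^ 2 + p * w + q * w ^ 2 +
          r * w ^ 3 - w ^ 4 * c w) →
      (∀ ζ, ζ.re = ζ₀.re → HasDerivAt Φ (Complex.exp ζ • (Φ ζ *
        !![A (Complex.exp (-ζ)), l⁻¹ * B (Complex.exp (-ζ)); C (Complex.exp (-ζ)),
          -A (Complex.exp (-ζ))])) ζ) →
      Φ ζ₀ * gaugeFrame l g (Complex.exp ζ₀) (Complex.exp (-ζ₀)) * V' = 1 →
      V' * (Φ ζ₀ * gaugeFrame l g (Complex.exp ζ₀) (Complex.exp (-ζ₀))) = 1 →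
      ‖Φ ζ₀ * gaugeFrame l g (Complex.exp ζ₀) (Complex.exp (-ζ₀))‖ * ‖V'‖ ≤ K →
      Φ (ζ₀ + 2 * Real.pi * Complex.I) = (1 + N) * Φ ζ₀ →
      N 1 1 = conj (N 0 0) → N 1 0 = -conj (N 0 1) →
      d ≤ K * ‖N‖ ∧ ‖N‖ ≤ 20 * K * d ∧ (0 < d → 0 < ((q ^ 2 - p * r) / l ^ 2).re) := by
  have hs : 0 < s := ht.trans hts
  have hts1 : 0 < 1 - t / s := sub_pos.2 ((div_lt_one hs).2 hts)
  obtain ⟨c₀, hc₀⟩ : ∃ c₀ : ℝ, 2 * (1 + s) ^ 2 = c₀ := ⟨_, rfl⟩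
  obtain ⟨c₁, hc₁⟩ : ∃ c₁ : ℝ, t⁻¹ * ((t⁻¹ + 1 + t) * (1 + t) ^ 2) = c₁ := ⟨_, rfl⟩
  obtain ⟨c₂, hc₂⟩ : ∃ c₂ : ℝ, t * c₀ + c₁ + c₀ * s * (1 - t / s)⁻¹ = c₂ := ⟨_, rfl⟩
  obtain ⟨c₃, hc₃⟩ : ∃ c₃ : ℝ,
    (8 * (2 * Real.pi) ^ 2 + 4 * (2 * Real.pi)) * (c₂ * c₁) = c₃ := ⟨_, rfl⟩
  have p₀ : 0 ≤ c₀ := by rw [← hc₀]; positivity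
  have p₁ : 0 ≤ c₁ := by rw [← hc₁]; positivity
  have p₂ : 0 ≤ c₂ := by rw [← hc₂]; positivity
  have p₃ : 0 ≤ c₃ := by rw [← hc₃]; positivity
  -- The entry $c_0s$ serves the power series solution, $c_2$ and $2\pi c_2$ the perturbation
  -- estimate over a path of length $2\pi$. The last two make the relative error $Kc_3e$ small
  -- enough for the positivity and for the upper bound on $\|N\|$.
  obtain ⟨e, he0, hes⟩ := exists_small_constant Finset.univ
    ![1, c₀ * s, c₂, c₂ * (2 * Real.pi), 100 * K ^ 2 * (K * c₃), K * c₃]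
  have b0 : c₀ * s * e ≤ 1 / 2 := hes 1 (Finset.mem_univ _)
  have b2 : c₂ * e ≤ 1 / 2 := hes 2 (Finset.mem_univ _)
  have b3 : c₂ * (2 * Real.pi) * e ≤ 1 / 2 := hes 3 (Finset.mem_univ _)
  have b4 : 100 * K ^ 2 * (K * c₃) * e ≤ 1 / 2 := hes 4 (Finset.mem_univ _)
  have b5 : K * c₃ * e ≤ 1 / 2 := hes 5 (Finset.mem_univ _)
  refine ⟨e, he0, ?_⟩
  intro l g p q r ζ₀ a b c Φ A B C V' N d hl hζ₀ ha hb hc hbound hp hq hr hd hde hABC hΦ hVV' hV'V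
    hVK hmon hN0 hN1
  have hl0 : l ≠ 0 := norm_pos_iff.1 (by rw [hl]; exact one_pos)
  have hd0 : 0 ≤ d := (norm_nonneg _).trans hp
  have hκd : DiffContOnCl ℂ (fun w => regularPart l (a w) (b w) (c w) w) (Metric.ball 0 s) := by
    refine DifferentiableOn.diffContOnCl ?_
    rw [closure_ball (0 : ℂ) hs.ne']
    exact (differentiableOn_regularPart ha hb hc Metric.isOpen_ball).mono
      (Metric.closedBall_subset_ball hsR)
  have hκb : ∀ w : ℂ, ‖w‖ ≤ s → ‖regularPart l (a w) (b w) (c w) w‖ ≤ c₀ * e := fun w hw => by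
    rw [← hc₀]
    exact norm_regularPart_le hl hw (hbound w hw).1 (hbound w hw).2.1 (hbound w hw).2.2
  have key := norm_monodromy_sub_residue_le (g := g)
    (ξ := fun w => !![A w, l⁻¹ * B w; C w, -A w]) ht hts p₀ hc₁ hc₂ he0.le b0 b2 b3 hl hζ₀ hκd hκb
    hp hq hr hde (fun z w hzw hw => by
      obtain ⟨hA, hB, hC⟩ := hABC w hw
      exact gauge_identity hl0 hzw hA hB hC) hΦ hmon
  refine residue_estimates (τ := c₃ * e) hl hVV' hV'V hVK hp hq hr hd hN0 hN1 (key.trans_eq ?_)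
    (by positivity) (by linarith) (by linarith)
  rw [← hc₃]
  ring

end Estimate

end DPW

end

/-! ### Choice of the gauge and Taylor expansion at infinity -/

noncomputable section

open scoped Matrix.Norms.Operator ComplexConjugate

namespace DPW

variable {ρ : ℝ} [hρ : Fact (1 < ρ)]

theorem Wiener.mulL_one_right {g : Wiener ρ} (hg : g.IsNonneg) : Wiener.mulL g 1 = g := by
  rw [Wiener.mulL_comm hg Wiener.isNonneg_one, Wiener.mulL_one]
  rfl

theorem Wiener.norm_mulL_apply_le {g f : Wiener ρ} {x y : ℝ} (hg : ‖g‖ ≤ x) (hf : ‖f‖ ≤ y) :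
    ‖Wiener.mulL g f‖ ≤ x * y :=
  ((Wiener.mulL g).le_opNorm f).trans (mul_le_mul (g.norm_mulL_le.trans hg) hf (norm_nonneg _)
    ((norm_nonneg _).trans hg))

theorem Wiener.norm_shift_apply_le {f : Wiener ρ} {y : ℝ} (hf : ‖f‖ ≤ y) :
    ‖Wiener.shift f‖ ≤ ρ * y :=
  (Wiener.shift.le_opNorm f).trans (mul_le_mul Wiener.norm_shift_le hf (norm_nonneg _)
    Wiener.radius_pos.le)

/-- The data of the gauged potential at infinity: the coefficient `g` of the gauge, the coefficients
`p, q, r` of the singular part and the entries `a, b = -B, c` of the regular part. -/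
structure IsGaugeData (R : ℝ) (A B C : ℂ → Wiener ρ) (g p q r : Wiener ρ)
    (a c : ℂ → Wiener ρ) : Prop where
  nonneg_g : g.IsNonneg
  nonneg_p : p.IsNonneg
  nonneg_q : q.IsNonneg
  nonneg_r : r.IsNonneg
  holo_a : DifferentiableOn ℂ a (Metric.ball 0 R)
  holo_c : DifferentiableOn ℂ c (Metric.ball 0 R)
  nonneg_a : ∀ w ∈ Metric.ball (0 : ℂ) R, (a w).IsNonneg
  nonneg_c : ∀ w ∈ Metric.ball (0 : ℂ) R, (c w).IsNonneg
  eq_A : ∀ w, A w = -(w ^ 2 • a w) - w • (Wiener.mulL g (B w) + 1)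
  eq_C : ∀ w, C w = w • ((2 : ℂ) • Wiener.shift (Wiener.mulL g (A w)) +
    w • Wiener.shift (Wiener.mulL g (Wiener.mulL g (B w) + 1)) +
      p + w • q + w ^ 2 • r - w ^ 3 • c w)
  coeff_p : p.coeff 0 = (dslope C 0 0).coeff 0
  coeff_q : q.coeff 0 = (dslope (dslope C 0) 0 0).coeff 0

/-- The element $g$ is forced by asking that $A(w)/w+gB(w)+1$ vanish at $w=0$, that is
$B(0)g=-(1+A'(0))$, solvable because $B(0)$ is near $1$. Then $p,q,r$ are the first three Taylor
coefficients of $C(w)/w$ minus the terms coming from $g$. Those terms are multiples of $\lambda$, so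
$p^0$ and $q^0$ depend on $C$ alone. -/
theorem exists_gaugeData {R s e : ℝ} (hs : 0 < s) (hsR : s < R) (he : 0 < e) :
    ∃ η > 0, ∀ A B C : ℂ → Wiener ρ,
      DifferentiableOn ℂ A (Metric.ball 0 R) → DifferentiableOn ℂ B (Metric.ball 0 R) →
      DifferentiableOn ℂ C (Metric.ball 0 R) →
      (∀ w ∈ Metric.ball (0 : ℂ) R, (A w).IsNonneg) →
      (∀ w ∈ Metric.ball (0 : ℂ) R, (B w).IsNonneg) →
      (∀ w ∈ Metric.ball (0 : ℂ) R, (C w).IsNonneg) → A 0 = 0 → C 0 = 0 →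
      (∀ w, ‖w‖ ≤ s → ‖A w‖ ≤ η ∧ ‖B w - 1‖ ≤ η ∧ ‖C w‖ ≤ η) →
      ∃ g p q r a c, IsGaugeData R A B C g p q r a c ∧ ‖g + 1‖ ≤ 1 ∧
        ‖p‖ ≤ e ∧ ‖q‖ ≤ e ∧ ‖r‖ ≤ e ∧
        ∀ w, ‖w‖ ≤ s → ‖a w‖ ≤ e ∧ ‖B w - 1‖ ≤ e ∧ ‖c w‖ ≤ e := by
  have hR : 0 < R := hs.trans hsR
  -- The products $k_1\eta,k_2\eta,k_3\eta$ will bound $g+1$, the diagonal remainder `N` and the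
  -- lower left remainder `G`.
  obtain ⟨k₁, hk₁⟩ : ∃ k₁ : ℝ, 2 * (2 / s + 1) = k₁ := ⟨_, rfl⟩
  obtain ⟨k₂, hk₂⟩ : ∃ k₂ : ℝ, 2 / s + 2 + k₁ = k₂ := ⟨_, rfl⟩
  obtain ⟨k₃, hk₃⟩ : ∃ k₃ : ℝ, 2 / s + 4 * ρ + s * (ρ * (2 * (2 + k₁))) = k₃ := ⟨_, rfl⟩
  obtain ⟨η, hη, hsmall⟩ := exists_small_constant Finset.univ
    ![1, k₁, (1 / e), 2 * k₂ / s / e, k₃ / e, 2 * k₃ / s / e, 2 * (2 * k₃ / s) / s / e,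
      2 * (2 * (2 * k₃ / s) / s) / s / e]
  have b0 : 1 * η ≤ 1 / 2 := hsmall 0 (Finset.mem_univ _)
  have b1 : k₁ * η ≤ 1 / 2 := hsmall 1 (Finset.mem_univ _)
  have hdiv : ∀ x : ℝ, x / e * η ≤ 1 / 2 → x * η ≤ e := fun x hx => by
    rw [div_mul_eq_mul_div, div_le_iff₀ he] at hx
    linarith
  have b2 : 1 * η ≤ e := hdiv _ (hsmall 2 (Finset.mem_univ _))
  have b3 : 2 * k₂ / s * η ≤ e := hdiv _ (hsmall 3 (Finset.mem_univ _))
  have b4 : k₃ * η ≤ e := hdiv _ (hsmall 4 (Finset.mem_univ _))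
  have b5 : 2 * k₃ / s * η ≤ e := hdiv _ (hsmall 5 (Finset.mem_univ _))
  have b6 : 2 * (2 * k₃ / s) / s * η ≤ e := hdiv _ (hsmall 6 (Finset.mem_univ _))
  have b7 : 2 * (2 * (2 * k₃ / s) / s) / s * η ≤ e := hdiv _ (hsmall 7 (Finset.mem_univ _))
  refine ⟨η, hη, fun A B C hA hB hC hAn hBn hCn hA0 hC0 hb => ?_⟩
  have h0R : (0 : ℂ) ∈ Metric.ball (0 : ℂ) R := Metric.mem_ball_self hR
  have h0s : ‖(0 : ℂ)‖ ≤ s := by rw [norm_zero]; exact hs.le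
  have hA1b : ∀ w : ℂ, ‖w‖ ≤ s → ‖dslope A 0 w‖ ≤ 2 * η / s := fun w hw =>
    norm_dslope_le hs hsR hA (fun w hw => (hb w hw).1) hw
  have hC1b : ∀ w : ℂ, ‖w‖ ≤ s → ‖dslope C 0 w‖ ≤ 2 * η / s := fun w hw =>
    norm_dslope_le hs hsR hC (fun w hw => (hb w hw).2.2) hw
  have hA1d := differentiableOn_dslope_zero hR hA
  have hC1d := differentiableOn_dslope_zero hR hC
  have hA1n := isNonneg_dslope hR hA hAn
  have hC1n := isNonneg_dslope hR hC hCn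
  obtain ⟨g, hgn, hg⟩ := Wiener.exists_mulL_eq (b := B 0) (v := -(1 + dslope A 0 0))
    (Wiener.isNonneg_one.add (hA1n 0 h0R)).neg (by
      rw [norm_sub_rev]; linarith [(hb 0 h0s).2.1])
  have hg1 : ‖g + 1‖ ≤ k₁ * η := by
    -- Rewriting the equation for $g$ with a small coefficient in front of $g$ lets the right side
    -- be absorbed.
    have e1 : g + 1 = -dslope A 0 0 - Wiener.mulL (B 0 - 1) g := by
      rw [Wiener.mulL_sub, Wiener.mulL_one, sub_apply, hg,
        one_apply_eq_self]
      abel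
    have h1 : ‖Wiener.mulL (B 0 - 1) g‖ ≤ η * ‖g‖ :=
      Wiener.norm_mulL_apply_le (hb 0 h0s).2.1 le_rfl
    have h2 : ‖g‖ ≤ ‖g + 1‖ + 1 := by
      have := norm_sub_le (g + 1) 1
      rwa [add_sub_cancel_right, Wiener.norm_one'] at this
    have h3 : ‖g + 1‖ ≤ 2 * η / s + η * ‖g‖ := by
      rw [e1]
      refine (norm_sub_le _ _).trans (add_le_add ?_ h1)
      rw [norm_neg]
      exact hA1b 0 h0s
    have h4 : η * ‖g‖ ≤ η * (‖g + 1‖ + 1) := mul_le_mul_of_nonneg_left h2 hη.le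
    have h5 : η * ‖g + 1‖ ≤ 1 / 2 * ‖g + 1‖ :=
      mul_le_mul_of_nonneg_right (by linarith) (norm_nonneg _)
    have h6 : k₁ * η = 2 * (2 * η / s + η) := by rw [← hk₁]; ring
    linarith
  have hg2 : ‖g‖ ≤ 2 := by
    have := norm_sub_le (g + 1) 1
    rw [add_sub_cancel_right, Wiener.norm_one'] at this
    linarith
  have hgB : ∀ w : ℂ, ‖w‖ ≤ s → ‖Wiener.mulL g (B w) + 1‖ ≤ (2 + k₁) * η := fun w hw => by
    have e1 : Wiener.mulL g (B w) + 1 = Wiener.mulL g (B w - 1) + (g + 1) := by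
      rw [map_sub, Wiener.mulL_one_right hgn]
      abel
    rw [e1]
    have := Wiener.norm_mulL_apply_le hg2 (hb w hw).2.1
    refine (norm_add_le _ _).trans ?_
    linarith
  obtain ⟨N, hN⟩ : ∃ N : ℂ → Wiener ρ, N = fun w => dslope A 0 w + (Wiener.mulL g (B w) + 1) :=
    ⟨_, rfl⟩
  have hNd : DifferentiableOn ℂ N (Metric.ball 0 R) := by
    rw [hN]
    exact hA1d.add (((Wiener.mulL g).differentiable.comp_differentiableOn hB).add_const 1)
  have hNn : ∀ w ∈ Metric.ball (0 : ℂ) R, (N w).IsNonneg := fun w hw => by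
    rw [hN]
    exact (hA1n w hw).add (((hBn w hw).mulL g).add Wiener.isNonneg_one)
  have hN0 : N 0 = 0 := by
    rw [hN]
    beta_reduce
    rw [Wiener.mulL_comm hgn (hBn 0 h0R), hg]
    abel
  have hNb : ∀ w : ℂ, ‖w‖ ≤ s → ‖N w‖ ≤ k₂ * η := fun w hw => by
    rw [hN]
    refine (norm_add_le _ _).trans ((add_le_add (hA1b w hw) (hgB w hw)).trans_eq ?_)
    rw [← hk₂]
    ring
  obtain ⟨G, hG⟩ : ∃ G : ℂ → Wiener ρ, G = fun w => dslope C 0 w -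
      ((2 : ℂ) • Wiener.shift (Wiener.mulL g (A w)) +
        w • Wiener.shift (Wiener.mulL g (Wiener.mulL g (B w) + 1))) := ⟨_, rfl⟩
  have hGd : DifferentiableOn ℂ G (Metric.ball 0 R) := by
    rw [hG]
    have h1 : DifferentiableOn ℂ (fun w => Wiener.shift (Wiener.mulL g (A w)))
        (Metric.ball 0 R) :=
      (Wiener.shift ∘L Wiener.mulL g).differentiable.comp_differentiableOn hA
    have h2 : DifferentiableOn ℂ
        (fun w => Wiener.shift (Wiener.mulL g (Wiener.mulL g (B w) + 1))) (Metric.ball 0 R) :=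
      (Wiener.shift ∘L Wiener.mulL g).differentiable.comp_differentiableOn
        (((Wiener.mulL g).differentiable.comp_differentiableOn hB).add_const 1)
    exact hC1d.sub ((h1.const_smul (2 : ℂ)).add (differentiableOn_id.smul h2))
  have hsn : ∀ w ∈ Metric.ball (0 : ℂ) R,
      (Wiener.mulL g (A w)).IsNonneg ∧ (Wiener.mulL g (Wiener.mulL g (B w) + 1)).IsNonneg :=
    fun w hw => ⟨(hAn w hw).mulL g, (((hBn w hw).mulL g).add Wiener.isNonneg_one).mulL g⟩
  have hGn : ∀ w ∈ Metric.ball (0 : ℂ) R, (G w).IsNonneg := fun w hw => by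
    rw [hG]
    exact (hC1n w hw).sub (((hsn w hw).1.shift.smul 2).add ((hsn w hw).2.shift.smul w))
  have hGb : ∀ w : ℂ, ‖w‖ ≤ s → ‖G w‖ ≤ k₃ * η := fun w hw => by
    have h1 : ‖(2 : ℂ) • Wiener.shift (Wiener.mulL g (A w))‖ ≤ 2 * (ρ * (2 * η)) := by
      rw [norm_smul, Complex.norm_two]
      exact mul_le_mul_of_nonneg_left (Wiener.norm_shift_apply_le
        (Wiener.norm_mulL_apply_le hg2 (hb w hw).1)) zero_le_two
    have h2 : ‖w • Wiener.shift (Wiener.mulL g (Wiener.mulL g (B w) + 1))‖ ≤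
        s * (ρ * (2 * ((2 + k₁) * η))) := by
      rw [norm_smul]
      exact mul_le_mul hw (Wiener.norm_shift_apply_le
        (Wiener.norm_mulL_apply_le hg2 (hgB w hw))) (norm_nonneg _) hs.le
    rw [hG]
    refine (norm_sub_le _ _).trans ((add_le_add (hC1b w hw)
      ((norm_add_le _ _).trans (add_le_add h1 h2))).trans_eq ?_)
    rw [← hk₃]
    ring
  have hG2d := differentiableOn_dslope_zero hR hGd
  have hG3d := differentiableOn_dslope_zero hR hG2d
  have hG2b : ∀ w : ℂ, ‖w‖ ≤ s → ‖dslope G 0 w‖ ≤ 2 * k₃ / s * η := fun w hw =>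
    (norm_dslope_le hs hsR hGd hGb hw).trans_eq (by ring)
  have hG3b : ∀ w : ℂ, ‖w‖ ≤ s → ‖dslope (dslope G 0) 0 w‖ ≤ 2 * (2 * k₃ / s) / s * η :=
    fun w hw => (norm_dslope_le hs hsR hG2d hG2b hw).trans_eq (by ring)
  have hG2n := isNonneg_dslope hR hGd hGn
  have hG3n := isNonneg_dslope hR hG2d hG2n
  have hcoeff : ∀ w ∈ Metric.ball (0 : ℂ) R, (G w).coeff 0 = (dslope C 0 w).coeff 0 :=
    fun w hw => by
      have h1 := Wiener.coeff_zero_shift (hsn w hw).1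
      have h2 := Wiener.coeff_zero_shift (hsn w hw).2
      rw [hG]
      beta_reduce
      rw [← Wiener.coeffL_apply, map_sub, map_add, map_smul, map_smul, Wiener.coeffL_apply,
        Wiener.coeffL_apply, Wiener.coeffL_apply, h1, h2]
      simp
  refine ⟨g, G 0, dslope G 0 0, dslope (dslope G 0) 0 0, fun w => -dslope N 0 w,
    fun w => -dslope (dslope (dslope G 0) 0) 0 w, ⟨hgn, hGn 0 h0R, hG2n 0 h0R, hG3n 0 h0R,
      (differentiableOn_dslope_zero hR hNd).neg, (differentiableOn_dslope_zero hR hG3d).neg,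
      fun w hw => (isNonneg_dslope hR hNd hNn w hw).neg,
      fun w hw => (isNonneg_dslope hR hG3d hG3n w hw).neg, fun w => ?_, fun w => ?_,
      hcoeff 0 h0R, ?_⟩, by linarith, (hGb 0 h0s).trans b4, (hG2b 0 h0s).trans b5,
      (hG3b 0 h0s).trans b6, fun w hw => ⟨?_, ?_, ?_⟩⟩
  · have h1 := dslope_zero_eq A w
    have h2 := dslope_zero_eq N w
    rw [hA0, zero_add] at h1
    rw [hN0, zero_add, hN] at h2
    beta_reduce at h2
    rw [h1, eq_sub_of_add_eq h2, hN, smul_neg, neg_neg, sq, mul_smul, smul_sub]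
  · have h1 := dslope_zero_eq C w
    have h2 := dslope_zero_eq G w
    rw [hC0, zero_add] at h1
    rw [dslope_zero_eq (dslope G 0) w, dslope_zero_eq (dslope (dslope G 0) 0) w] at h2
    have h3 : dslope C 0 w = G w + ((2 : ℂ) • Wiener.shift (Wiener.mulL g (A w)) +
        w • Wiener.shift (Wiener.mulL g (Wiener.mulL g (B w) + 1))) := by
      rw [hG, sub_add_cancel]
    rw [h1, h3, h2]
    module
  · rw [coeff_dslope hR hGd, coeff_dslope hR hC1d, dslope_same, dslope_same]
    refine Filter.EventuallyEq.deriv_eq ?_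
    filter_upwards [Metric.ball_mem_nhds (0 : ℂ) hR] with w hw using hcoeff w hw
  · rw [norm_neg]
    exact (norm_dslope_le hs hsR hNd hNb hw).trans (le_of_eq_of_le (by ring) b3)
  · exact (hb w hw).2.1.trans (by linarith)
  · rw [norm_neg]
    exact (norm_dslope_le hs hsR hG3d hG3b hw).trans (le_of_eq_of_le (by ring) b7)

end DPW

end

/-! ### Evaluation of the gauge data and extension to infinity -/

noncomputable section

open scoped Matrix.Norms.Operator ComplexConjugate

namespace DPW

section

variable {ρ : ℝ} [hρ : Fact (1 < ρ)] {R : ℝ} {A B C a c : ℂ → Wiener ρ} {g p q r : Wiener ρ}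

theorem Wiener.evalNonneg_one {l : ℂ} (hl : ‖l‖ < ρ) :
    Wiener.evalNonneg l (1 : Wiener ρ) = 1 := by
  rw [← Wiener.eval_eq_evalNonneg Wiener.isNonneg_one hl, Wiener.eval_one]

theorem Wiener.differentiableOn_eval_comp {F : ℂ → Wiener ρ} {U : Set ℂ} {l : ℂ}
    (hF : DifferentiableOn ℂ F U) (hn : ∀ w ∈ U, (F w).IsNonneg) (hl : ‖l‖ < ρ) :
    DifferentiableOn ℂ (fun w => (F w).eval l) U :=
  ((Wiener.evalNonneg l).differentiable.comp_differentiableOn hF).congr fun w hw =>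
    Wiener.eval_eq_evalNonneg (hn w hw) hl

theorem IsGaugeData.eval_A (h : IsGaugeData R A B C g p q r a c) {w l : ℂ}
    (hw : w ∈ Metric.ball (0 : ℂ) R) (hl : ‖l‖ < ρ) (hA : (A w).IsNonneg)
    (hB : (B w).IsNonneg) :
    (A w).eval l = -(w ^ 2 * (a w).eval l) - w * (g.eval l * (B w).eval l + 1) := by
  rw [Wiener.eval_eq_evalNonneg hA hl, Wiener.eval_eq_evalNonneg hB hl,
    Wiener.eval_eq_evalNonneg (h.nonneg_a w hw) hl, Wiener.eval_eq_evalNonneg h.nonneg_g hl,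
    h.eq_A w]
  simp only [map_sub, map_neg, map_smul, smul_eq_mul, map_add (Wiener.evalNonneg l),
    Wiener.evalNonneg_mulL g hB hl, Wiener.evalNonneg_one hl]

theorem IsGaugeData.eval_C (h : IsGaugeData R A B C g p q r a c) {w l : ℂ}
    (hw : w ∈ Metric.ball (0 : ℂ) R) (hl : ‖l‖ < ρ) (hA : (A w).IsNonneg)
    (hB : (B w).IsNonneg) (hC : (C w).IsNonneg) :
    (C w).eval l = 2 * l * g.eval l * w * (A w).eval l +
      l * g.eval l ^ 2 * w ^ 2 * (B w).eval l + l * g.eval l * w ^ 2 + p.eval l * w +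
      q.eval l * w ^ 2 + r.eval l * w ^ 3 - w ^ 4 * (c w).eval l := by
  have hB1 : (Wiener.mulL g (B w) + 1).IsNonneg := (hB.mulL g).add Wiener.isNonneg_one
  have e1 := Wiener.evalNonneg_shift (hA.mulL g) hl
  have e2 := Wiener.evalNonneg_shift (hB1.mulL g) hl
  rw [Wiener.evalNonneg_mulL g hA hl] at e1
  rw [Wiener.evalNonneg_mulL g hB1 hl, map_add (Wiener.evalNonneg l),
    Wiener.evalNonneg_mulL g hB hl, Wiener.evalNonneg_one hl] at e2
  rw [Wiener.eval_eq_evalNonneg hA hl, Wiener.eval_eq_evalNonneg hB hl,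
    Wiener.eval_eq_evalNonneg hC hl, Wiener.eval_eq_evalNonneg (h.nonneg_c w hw) hl,
    Wiener.eval_eq_evalNonneg h.nonneg_g hl, Wiener.eval_eq_evalNonneg h.nonneg_p hl,
    Wiener.eval_eq_evalNonneg h.nonneg_q hl, Wiener.eval_eq_evalNonneg h.nonneg_r hl]
  have e3 := congrArg (Wiener.evalNonneg l) (h.eq_C w)
  rw [map_smul, map_sub, map_add (Wiener.evalNonneg l), map_add (Wiener.evalNonneg l),
    map_add (Wiener.evalNonneg l), map_add (Wiener.evalNonneg l), map_smul, map_smul, map_smul,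
    map_smul, map_smul, e1, e2] at e3
  simp only [smul_eq_mul] at e3
  rw [e3]
  ring

/-- If the singular part vanishes, the gauged potential extends to infinity. -/
theorem IsGaugeData.extendsAtInfty (hR : 0 < R)
    (h : IsGaugeData R A B C g 0 0 0 a c) {α β γ : ℂ → Wiener ρ}
    (hα : ∀ z ∈ puncturedDiskInfty R, α z = A z⁻¹) (hβ : ∀ z ∈ puncturedDiskInfty R, β z = B z⁻¹)
    (hγ : ∀ z ∈ puncturedDiskInfty R, γ z = C z⁻¹)
    (hB : DifferentiableOn ℂ B (Metric.ball 0 R))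
    (hAn : ∀ w ∈ Metric.ball (0 : ℂ) R, (A w).IsNonneg)
    (hBn : ∀ w ∈ Metric.ball (0 : ℂ) R, (B w).IsNonneg)
    (hCn : ∀ w ∈ Metric.ball (0 : ℂ) R, (C w).IsNonneg) :
    ExtendsAtInfty ρ R (gaugeAction (potential α β γ)
      fun z l => !![z, 0; l * g.eval l, z⁻¹]) := by
  refine ⟨a, fun w => -B w, c, ⟨h.holo_a, hB.neg, h.holo_c, h.nonneg_a,
    fun w hw => (hBn w hw).neg, h.nonneg_c⟩, fun z hz l hl0 hl => ?_⟩
  obtain ⟨hw, hz0⟩ := inv_mem_ball hR hz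
  have hEA := h.eval_A hw hl (hAn _ hw) (hBn _ hw)
  have hEC := h.eval_C hw hl (hAn _ hw) (hBn _ hw) (hCn _ hw)
  have h0 : (0 : Wiener ρ).eval l = 0 := by simp [Wiener.eval, Wiener.coeff_zero]
  rw [h0] at hEC
  have hEb : (-B z⁻¹).eval l = -(B z⁻¹).eval l := by
    rw [Wiener.eval_eq_evalNonneg (hBn _ hw).neg hl, Wiener.eval_eq_evalNonneg (hBn _ hw) hl,
      map_neg]
  have hinv : (!![z, 0; l * g.eval l, z⁻¹] : Matrix (Fin 2) (Fin 2) ℂ)⁻¹ =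
      !![z⁻¹, 0; -(l * g.eval l), z] := by
    refine Matrix.inv_eq_right_inv ?_
    ext i j
    fin_cases i <;> fin_cases j <;> simp [hz0, mul_comm]
  have hder : (Matrix.of fun i j => deriv
      (fun x => (!![x, 0; l * g.eval l, x⁻¹] : Matrix (Fin 2) (Fin 2) ℂ) i j) z) =
      !![1, 0; 0, -(z ^ 2)⁻¹] := by
    ext i j
    fin_cases i <;> fin_cases j <;> simp
  rw [gaugeAction, hder, hinv, potential, hα z hz, hβ z hz, hγ z hz, potential, hEb, hEC, hEA]
  ext i j
  fin_cases i <;> fin_cases j <;> simp <;> field_simp <;> ring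

theorem isGauge_gauge (hR : 0 < R) (hg : g.IsNonneg) :
    IsGauge ρ (puncturedDiskInfty R) fun z l => !![z, 0; l * g.eval l, z⁻¹] := by
  refine ⟨fun i j => ?_, fun z hz l _ => ?_, fun z _ => by simp⟩
  · have hgd : DifferentiableOn ℂ (fun p : ℂ × ℂ => g.eval p.2)
        (puncturedDiskInfty R ×ˢ Metric.ball 0 ρ) :=
      (Wiener.differentiableOn_eval hg).comp differentiableOn_snd fun p hp => hp.2
    fin_cases i <;> fin_cases j
    · exact differentiableOn_fst
    · exact differentiableOn_const _
    · exact differentiableOn_snd.mul hgd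
    · exact differentiableOn_fst.inv fun p hp => (inv_mem_ball hR hp.1).2
  · simp [Matrix.det_fin_two, (inv_mem_ball hR hz).2]

end

/-! ### Vanishing of the singular part -/

section

variable {ρ : ℝ} [hρ : Fact (1 < ρ)]

/-- With determinant one the adjugate is the inverse, hence the conjugate transpose. The resulting
relations are real linear and hold for the identity, so they pass to $M-1$. -/
theorem specialUnitary_entries {M : Matrix (Fin 2) (Fin 2) ℂ}
    (hM : M ∈ Matrix.specialUnitaryGroup (Fin 2) ℂ) :
    M 1 1 = conj (M 0 0) ∧ M 1 0 = -conj (M 0 1) := by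
  obtain ⟨h1, h2⟩ := Matrix.mem_specialUnitaryGroup_iff.1 hM
  have h3 : M * star M = 1 := (Unitary.mem_iff.1 h1).2
  have h4 : M.adjugate * M = 1 := by rw [Matrix.adjugate_mul, h2, one_smul]
  have h5 : M.adjugate = star M := by
    rw [← mul_one M.adjugate, ← h3, ← mul_assoc, h4, one_mul]
  rw [Matrix.adjugate_fin_two] at h5
  have h6 := congrFun (congrFun h5 0) 0
  have h7 := congrFun (congrFun h5 1) 0
  simp [Matrix.star_apply] at h6 h7
  exact ⟨h6, by rw [← h7, neg_neg]⟩

theorem exists_norm_le_entry (A : Matrix (Fin 2) (Fin 2) ℂ) :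
    ∃ ij : Fin 2 × Fin 2, ‖A‖ ≤ 2 * ‖A ij.1 ij.2‖ := by
  obtain ⟨ij, h⟩ := Finite.exists_max fun ij : Fin 2 × Fin 2 => ‖A ij.1 ij.2‖
  exact ⟨ij, norm_le_of_entries fun i j => h (i, j)⟩

theorem norm_adjugate_le {A : Matrix (Fin 2) (Fin 2) ℂ} {x : ℝ} (h : ∀ i j, ‖A i j‖ ≤ x) :
    ‖A.adjugate‖ ≤ 2 * x := by
  rw [Matrix.adjugate_fin_two]
  refine norm_le_of_entries fun i j => ?_
  fin_cases i <;> fin_cases j <;> simp [h]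

theorem det_gaugeFrame {l g z w : ℂ} (hl : l ≠ 0) (hzw : z * w = 1) :
    (gaugeFrame l g z w).det = 1 := by
  rw [gaugeFrame, Matrix.det_fin_two_of]
  field_simp
  linear_combination (1 + g) * hzw

theorem norm_gaugeFrame_entry_le {l g z w : ℂ} {t : ℝ} (hl : ‖l‖ = 1) (hg : ‖1 + g‖ ≤ 1)
    (hw : ‖w‖ = t) (hz : ‖z‖ = t⁻¹) (i j : Fin 2) :
    ‖gaugeFrame l g z w i j‖ ≤ 2 + t + t⁻¹ := by
  have ht : 0 ≤ t := hw ▸ norm_nonneg w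
  have ht' : 0 ≤ t⁻¹ := inv_nonneg.2 ht
  have hg' : ‖g‖ ≤ 2 := by
    have := norm_sub_le (1 + g) 1
    rw [add_sub_cancel_left, norm_one] at this
    linarith
  have hgt : ‖1 + g‖ * t ≤ t := mul_le_of_le_one_left ht hg
  fin_cases i <;> fin_cases j <;> simp [gaugeFrame, hl, hw, hz] <;> linarith

/-- The vanishing of the singular part, from the Monodromy Problem and the residue conditions, for
a potential close to the unperturbed one. -/
theorem singular_part_eq_zero {t s R x : ℝ} (ht : 0 < t) (hts : t < s) (hsR : s < R)
    (hx : 0 ≤ x) :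
    ∃ e > 0, ∀ (A B C a c : ℂ → Wiener ρ) (g p q r : Wiener ρ)
      (Φ : ℂ → Matrix (Fin 2) (Fin 2) (Wiener ρ)) (α β γ : ℂ → Wiener ρ) (ζ₀ : ℂ),
      IsGaugeData R A B C g p q r a c → ‖g + 1‖ ≤ 1 → ‖p‖ ≤ e → ‖q‖ ≤ e → ‖r‖ ≤ e →
      (∀ w, ‖w‖ ≤ s → ‖a w‖ ≤ e ∧ ‖B w - 1‖ ≤ e ∧ ‖c w‖ ≤ e) →
      DifferentiableOn ℂ B (Metric.ball 0 R) →
      (∀ w ∈ Metric.ball (0 : ℂ) R, (A w).IsNonneg) →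
      (∀ w ∈ Metric.ball (0 : ℂ) R, (B w).IsNonneg) →
      (∀ w ∈ Metric.ball (0 : ℂ) R, (C w).IsNonneg) →
      (∀ z ∈ puncturedDiskInfty R, α z = A z⁻¹) → (∀ z ∈ puncturedDiskInfty R, β z = B z⁻¹) →
      (∀ z ∈ puncturedDiskInfty R, γ z = C z⁻¹) →
      Real.exp (-ζ₀.re) = t → ζ₀ ∈ universalCover R →
      IsSolution R (potential α β γ) Φ → SolvesMonodromyProblem Φ ζ₀ →
      (∀ i j, ‖Φ ζ₀ i j‖ ≤ x) → p.coeff 0 = 0 → (q.coeff 0).re = 0 → p = 0 ∧ q = 0 ∧ r = 0 := by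
  have hR : 0 < R := ht.trans (hts.trans hsR)
  obtain ⟨y, hy⟩ : ∃ y : ℝ, 2 + t + t⁻¹ = y := ⟨_, rfl⟩
  have hy0 : 0 ≤ y := by rw [← hy]; positivity
  -- `K` bounds $\|V\|\,\|V^{-1}\|$ for $V=\Phi(\zeta_0)H$, uniformly on the circle: the inverse is
  -- a product of adjugates, and each factor $2$ converts an entry bound into a norm bound.
  obtain ⟨K, hK⟩ : ∃ K : ℝ, (2 * x * (2 * y)) * (2 * y * (2 * x)) = K := ⟨_, rfl⟩
  have hK0 : 0 ≤ K := by rw [← hK]; positivity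
  obtain ⟨e₀, he₀, hest⟩ := exists_monodromy_estimate (K := K) ht hts hsR
  -- The second bound gives $\|M(1)-1\|\le1$, which rules out $M(1)=-1$.
  refine ⟨min e₀ (20 * K + 1)⁻¹, by positivity, ?_⟩
  intro A B C a c g p q r Φ α β γ ζ₀ hdata hg hp hq hr hbound hB hAn hBn hCn hα hβ hγ hζt hζ₀ hΦ
    hmon hΦx hp0 hq0
  have hpe := hp.trans (min_le_left _ _)
  have hqe := hq.trans (min_le_left _ _)
  have hre := hr.trans (min_le_left _ _)
  have hpK := hp.trans (min_le_right _ _)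
  have hqK := hq.trans (min_le_right _ _)
  have hrK := hr.trans (min_le_right _ _)
  obtain ⟨d, hd⟩ : ∃ d : ℂ → ℝ, d = fun l => max ‖p.eval l‖ (max ‖q.eval l‖ ‖r.eval l‖) :=
    ⟨_, rfl⟩
  have hdp : ∀ l, ‖p.eval l‖ ≤ d l := fun l => by rw [hd]; exact le_max_left _ _
  have hdq : ∀ l, ‖q.eval l‖ ≤ d l := fun l => by
    rw [hd]; exact (le_max_left _ _).trans (le_max_right _ _)
  have hdr : ∀ l, ‖r.eval l‖ ≤ d l := fun l => by
    rw [hd]; exact (le_max_right _ _).trans (le_max_right _ _)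
  have hdmem : ∀ l, ‖p.eval l‖ = d l ∨ ‖q.eval l‖ = d l ∨ ‖r.eval l‖ = d l := fun l => by
    rw [hd]
    beta_reduce
    rcases max_choice ‖p.eval l‖ (max ‖q.eval l‖ ‖r.eval l‖) with h | h
    · exact Or.inl h.symm
    · rw [h]
      rcases max_choice ‖q.eval l‖ ‖r.eval l‖ with h' | h'
      · exact Or.inr (Or.inl h'.symm)
      · exact Or.inr (Or.inr h'.symm)
  have hdle : ∀ {l : ℂ} {u : ℝ}, ‖l‖ = 1 → ‖p‖ ≤ u → ‖q‖ ≤ u → ‖r‖ ≤ u → d l ≤ u :=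
    fun {l u} hl h1 h2 h3 => by
      rw [hd]
      exact max_le ((p.norm_eval_le hl).trans h1)
        (max_le ((q.norm_eval_le hl).trans h2) ((r.norm_eval_le hl).trans h3))
  have main : ∀ l : ℂ, ‖l‖ = 1 → d l ≤ K * ‖monodromy Φ ζ₀ l - 1‖ ∧
      ‖monodromy Φ ζ₀ l - 1‖ ≤ 20 * K * d l ∧
      (0 < d l → 0 < ((q.eval l ^ 2 - p.eval l * r.eval l) / l ^ 2).re) := by
    intro l hl
    have hl' : ‖l‖ < ρ := Wiener.norm_lt_radius hl
    have hl0 : l ≠ 0 := norm_pos_iff.1 (by rw [hl]; exact one_pos)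
    have hinb : ∀ w : ℂ, ‖w‖ ≤ s → w ∈ Metric.ball (0 : ℂ) R := fun w hw =>
      mem_ball_zero_iff.2 (hw.trans_lt hsR)
    have hB1 : ∀ w : ℂ, ‖w‖ ≤ s → ‖-(B w).eval l + 1‖ ≤ ‖B w - 1‖ := fun w hw => by
      have h1 := Wiener.norm_eval_le (B w - 1) hl
      rw [Wiener.eval_eq_evalNonneg ((hBn w (hinb w hw)).sub Wiener.isNonneg_one) hl', map_sub,
        Wiener.evalNonneg_one hl', ← Wiener.eval_eq_evalNonneg (hBn w (hinb w hw)) hl'] at h1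
      rwa [neg_add_eq_sub, norm_sub_rev]
    have hg1 : ‖1 + g.eval l‖ ≤ 1 := by
      have h1 := (Wiener.norm_eval_le (g + 1) hl).trans hg
      rwa [Wiener.eval_eq_evalNonneg (hdata.nonneg_g.add Wiener.isNonneg_one) hl',
        map_add (Wiener.evalNonneg l), Wiener.evalNonneg_one hl',
        ← Wiener.eval_eq_evalNonneg hdata.nonneg_g hl', add_comm] at h1
    have hwt : ‖Complex.exp (-ζ₀)‖ = t := by rw [Complex.norm_exp, Complex.neg_re, hζt]
    have hzt : ‖Complex.exp ζ₀‖ = t⁻¹ := by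
      rw [Complex.norm_exp, ← hζt, Real.exp_neg, inv_inv]
    obtain ⟨F, hF⟩ : ∃ F, F = evalMatrix (Φ ζ₀) l := ⟨_, rfl⟩
    obtain ⟨H, hH⟩ : ∃ H, H = gaugeFrame l (g.eval l) (Complex.exp ζ₀) (Complex.exp (-ζ₀)) :=
      ⟨_, rfl⟩
    have hFe : ∀ i j, ‖F i j‖ ≤ x := fun i j => by
      rw [hF]
      exact (Wiener.norm_eval_le _ hl).trans (hΦx i j)
    have hHe : ∀ i j, ‖H i j‖ ≤ y := fun i j => by
      rw [hH, ← hy]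
      exact norm_gaugeFrame_entry_le hl hg1 hwt hzt i j
    have hFdet : F.det = 1 := by rw [hF]; exact hΦ.det_eq_one ζ₀ hζ₀ l hl
    have hHdet : H.det = 1 := by rw [hH]; exact det_gaugeFrame hl0 (exp_mul_exp_neg ζ₀)
    have hF1 : F * F.adjugate = 1 := by rw [Matrix.mul_adjugate, hFdet, one_smul]
    have hF2 : F.adjugate * F = 1 := by rw [Matrix.adjugate_mul, hFdet, one_smul]
    have hH1 : H * H.adjugate = 1 := by rw [Matrix.mul_adjugate, hHdet, one_smul]
    have hH2 : H.adjugate * H = 1 := by rw [Matrix.adjugate_mul, hHdet, one_smul]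
    have hnorm : ‖F * H‖ * ‖H.adjugate * F.adjugate‖ ≤ K := by
      rw [← hK]
      refine mul_le_mul ((norm_mul_le _ _).trans (mul_le_mul (norm_le_of_entries hFe)
        (norm_le_of_entries hHe) (norm_nonneg _) (by positivity)))
        ((norm_mul_le _ _).trans (mul_le_mul (norm_adjugate_le hHe)
        (norm_adjugate_le hFe) (norm_nonneg _) (by positivity))) (norm_nonneg _) (by positivity)
    obtain ⟨hM11, hM10⟩ := specialUnitary_entries (hmon.unitary l hl)
    refine hest l (g.eval l) (p.eval l) (q.eval l) (r.eval l) ζ₀ (fun w => (a w).eval l)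
      (fun w => -(B w).eval l) (fun w => (c w).eval l) (fun ζ => evalMatrix (Φ ζ) l)
      (fun w => (A w).eval l) (fun w => (B w).eval l) (fun w => (C w).eval l)
      (H.adjugate * F.adjugate) (monodromy Φ ζ₀ l - 1) (d l) hl hζt
      (Wiener.differentiableOn_eval_comp hdata.holo_a hdata.nonneg_a hl')
      (Wiener.differentiableOn_eval_comp hB hBn hl').neg
      (Wiener.differentiableOn_eval_comp hdata.holo_c hdata.nonneg_c hl')
      (fun w hw => ⟨?_, ?_, ?_⟩) (hdp l) (hdq l) (hdr l) (hdmem l) (hdle hl hpe hqe hre)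
      (fun w hw => ⟨?_, (neg_neg _).symm, ?_⟩) (fun ζ hζ => ?_) ?_ ?_ ?_ ?_ ?_ ?_
    · exact ((Wiener.norm_eval_le _ hl).trans (hbound w hw).1).trans (min_le_left _ _)
    · exact ((hB1 w hw).trans (hbound w hw).2.1).trans (min_le_left _ _)
    · exact ((Wiener.norm_eval_le _ hl).trans (hbound w hw).2.2).trans (min_le_left _ _)
    · have hw' := hinb w (hw.trans_le hts.le)
      exact hdata.eval_A hw' hl' (hAn w hw') (hBn w hw')
    · have hw' := hinb w (hw.trans_le hts.le)
      exact hdata.eval_C hw' hl' (hAn w hw') (hBn w hw') (hCn w hw')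
    · have hζU : ζ ∈ universalCover R := by
        change -Real.log R < ζ.re
        rw [hζ]
        exact hζ₀
      have hz : Complex.exp ζ ∈ puncturedDiskInfty R := by
        change R⁻¹ < ‖Complex.exp ζ‖
        rw [Complex.norm_exp, hζ, ← inv_inv (Real.exp ζ₀.re), ← Real.exp_neg, hζt]
        exact (inv_lt_inv₀ hR ht).2 (hts.trans hsR)
      refine hasDerivAt_matrix fun i j => (hΦ.hasDerivAt ζ hζU l hl i j).congr_deriv ?_
      rw [potential, hα _ hz, hβ _ hz, hγ _ hz, Complex.exp_neg, Matrix.smul_apply, smul_eq_mul,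
        mul_comm]
    · rw [← hF, ← hH, mul_assoc, ← mul_assoc H, hH1, one_mul, hF1]
    · rw [← hF, ← hH, mul_assoc, ← mul_assoc F.adjugate, hF2, one_mul, hH2]
    · rw [← hF, ← hH]
      exact hnorm
    · rw [add_sub_cancel, monodromy, ← hF, mul_assoc _ F⁻¹ F, Matrix.nonsing_inv_mul F (by
        rw [hFdet]; exact isUnit_one), mul_one]
    · simp [hM11]
    · simp [hM10]
  have hmon1 : monodromy Φ ζ₀ 1 = 1 := by
    rcases hmon.eq_pm_one with h | h
    · exact h
    · exfalso
      obtain ⟨-, h2, -⟩ := main 1 norm_one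
      have h3 := hdle (l := 1) norm_one hpK hqK hrK
      have h4 := norm_entry_le (monodromy Φ ζ₀ 1 - 1) 0 0
      have h5 : ‖(monodromy Φ ζ₀ 1 - 1) 0 0‖ = 2 := by
        rw [h]
        simp
        norm_num
      rw [h5] at h4
      have h6 : 20 * K * d 1 ≤ 20 * K * (20 * K + 1)⁻¹ :=
        mul_le_mul_of_nonneg_left h3 (by positivity)
      have h7 : 20 * K * (20 * K + 1)⁻¹ ≤ 1 := by
        rw [← div_eq_mul_inv, div_le_one (by positivity)]
        linarith
      linarith
  have hd1 : d 1 = 0 := by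
    have h1 := (main 1 norm_one).1
    rw [hmon1, sub_self, norm_zero, mul_zero] at h1
    exact le_antisymm h1 ((norm_nonneg _).trans (hdp 1))
  have hz : ∀ {u : Wiener ρ}, (∀ l, ‖u.eval l‖ ≤ d l) → u.eval 1 = 0 := fun {u} hu =>
    norm_le_zero_iff.1 ((hu 1).trans hd1.le)
  have hball1 : Metric.ball (0 : ℂ) ρ ∈ 𝓝 (1 : ℂ) :=
    Metric.isOpen_ball.mem_nhds (by simpa using hρ.out)
  -- On the circle $|u|\le d\le K\|M-1\|$, and $M-1$ vanishes at $1$ together with its derivative.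
  have hz' : ∀ {u : Wiener ρ}, u.IsNonneg → (∀ l, ‖u.eval l‖ ≤ d l) → deriv u.eval 1 = 0 :=
    fun {u} hun hu => by
      refine deriv_eq_zero_of_norm_le_on_circle (C := K * 2)
        (N := fun (ij : Fin 2 × Fin 2) l => monodromy Φ ζ₀ l ij.1 ij.2 -
          (1 : Matrix (Fin 2) (Fin 2) ℂ) ij.1 ij.2)
        ((Wiener.differentiableOn_eval hun).differentiableAt hball1) (hz hu)
        (fun ij => (hmon.deriv_eq_zero ij.1 ij.2).sub_const _)
        (fun ij => by rw [hmon1, sub_self]) fun l hl => ?_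
      obtain ⟨ij, hij⟩ := exists_norm_le_entry (monodromy Φ ζ₀ l - 1)
      refine ⟨ij, (hu l).trans ((main l hl).1.trans ?_)⟩
      rw [mul_assoc]
      exact mul_le_mul_of_nonneg_left hij hK0
  have hcirc := eq_zero_on_circle_of_re_pos hρ.out (Wiener.differentiableOn_eval hdata.nonneg_p)
    (Wiener.differentiableOn_eval hdata.nonneg_q) (Wiener.differentiableOn_eval hdata.nonneg_r)
    (hz hdp) (hz hdq) (hz hdr) (hz' hdata.nonneg_p hdp) (hz' hdata.nonneg_q hdq)
    (hz' hdata.nonneg_r hdr)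
    (by rw [Wiener.eval_zero_eq_coeff hdata.nonneg_p, hp0])
    (by rw [Wiener.eval_zero_eq_coeff hdata.nonneg_q, hq0])
    fun l hl hne => by
      refine (main l hl).2.2 (lt_of_le_of_ne ((norm_nonneg _).trans (hdp l)) fun h0 => hne ?_)
      exact ⟨norm_le_zero_iff.1 (h0 ▸ hdp l), norm_le_zero_iff.1 (h0 ▸ hdq l),
        norm_le_zero_iff.1 (h0 ▸ hdr l)⟩
  exact ⟨Wiener.eq_zero_of_eval_eq_zero hdata.nonneg_p fun l hl => (hcirc l hl).1,
    Wiener.eq_zero_of_eval_eq_zero hdata.nonneg_q fun l hl => (hcirc l hl).2.1,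
    Wiener.eq_zero_of_eval_eq_zero hdata.nonneg_r fun l hl => (hcirc l hl).2.2⟩

end

end DPW

end

/-! ### Assembly for small $t$ -/

theorem mainTheorem5 (ρ : ℝ) [Fact (1 < ρ)] (R ε : ℝ) (hR : 0 < R) (hε : 0 < ε)
    (α β γ : ℝ → ℂ → DPW.Wiener ρ)
    (Φ : ℝ → ℂ → Matrix (Fin 2) (Fin 2) (DPW.Wiener ρ))
    (ζ₀ : ℂ) (hζ₀ : ζ₀ ∈ DPW.universalCover R)
    -- a `C¹` family of DPW potentials on `D^*(∞,R)`
    (hξ : ∀ t ∈ Set.Ioo (-ε) ε, DPW.IsPotential (DPW.puncturedDiskInfty R) (α t) (β t) (γ t))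
    (hα : ContDiffOn ℝ 1 (fun p : ℝ × ℂ => α p.1 p.2)
      (Set.Ioo (-ε) ε ×ˢ DPW.puncturedDiskInfty R))
    (hβ : ContDiffOn ℝ 1 (fun p : ℝ × ℂ => β p.1 p.2)
      (Set.Ioo (-ε) ε ×ˢ DPW.puncturedDiskInfty R))
    (hγ : ContDiffOn ℝ 1 (fun p : ℝ × ℂ => γ p.1 p.2)
      (Set.Ioo (-ε) ε ×ˢ DPW.puncturedDiskInfty R))
    -- poles of multiplicity at most `(1 2; 1 1)` at `∞`
    (hpα : ∀ t ∈ Set.Ioo (-ε) ε, DPW.PoleAtInftyLE 1 (α t))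
    (hpβ : ∀ t ∈ Set.Ioo (-ε) ε, DPW.PoleAtInftyLE 2 (β t))
    (hpγ : ∀ t ∈ Set.Ioo (-ε) ε, DPW.PoleAtInftyLE 1 (γ t))
    -- the potential at `t = 0`
    (hξ₀ : ∀ z ∈ DPW.puncturedDiskInfty R, ∀ l : ℂ, ‖l‖ = 1 →
      DPW.potential (α 0) (β 0) (γ 0) z l = !![0, l⁻¹; 0, 0])
    -- a `C¹` family of solutions on the universal cover
    (hΦ : ∀ t ∈ Set.Ioo (-ε) ε, DPW.IsSolution R (DPW.potential (α t) (β t) (γ t)) (Φ t))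
    (hΦC : ∀ i j, ContDiffOn ℝ 1 (fun p : ℝ × ℂ => Φ p.1 p.2 i j)
      (Set.Ioo (-ε) ε ×ˢ DPW.universalCover R))
    (hΦ₀ : ∃ ρ' : ℝ, ρ < ρ' ∧ DPW.HolomorphicInAnnulus ρ' (Φ 0 ζ₀))
    (hmon : ∀ t ∈ Set.Ioo (-ε) ε, DPW.SolvesMonodromyProblem (Φ t) ζ₀)
    (hres : ∀ t ∈ Set.Ioo (-ε) ε, DPW.residueInfty (fun z => (γ t z).coeff 0) = 0)
    (hres' : ∀ t ∈ Set.Ioo (-ε) ε, (DPW.residueInfty (fun z => z * (γ t z).coeff 0)).re = 0) :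
    ∀ᶠ t in nhds (0 : ℝ), ∃ (g : DPW.Wiener ρ) (G : ℂ → ℂ → Matrix (Fin 2) (Fin 2) ℂ),
      g.IsNonneg ∧
      (∀ z l : ℂ, G z l = !![z, 0; l * g.eval l, z⁻¹]) ∧
      DPW.IsGauge ρ (DPW.puncturedDiskInfty R) G ∧
      DPW.ExtendsAtInfty ρ R (DPW.gaugeAction (DPW.potential (α t) (β t) (γ t)) G) := by
  have h0mem : (0 : ℝ) ∈ Set.Ioo (-ε) ε := ⟨by linarith, hε⟩
  have ht : 0 < Real.exp (-ζ₀.re) := Real.exp_pos _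
  have htR : Real.exp (-ζ₀.re) < R := by
    rw [← Real.lt_log_iff_exp_lt hR]
    have : -Real.log R < ζ₀.re := hζ₀
    linarith
  -- Along the path from $\zeta_0$ to $\zeta_0+2\pi i$ one has $|w|=e^{-\operatorname{Re}\zeta_0}$;
  -- the disk $|w|\le s$ contains this loop and infinity.
  obtain ⟨s, hts, hsR⟩ := exists_between htR
  have hs : 0 < s := ht.trans hts
  obtain ⟨x, hx⟩ : ∃ x : ℝ, (∑ i, ∑ j, ‖Φ 0 ζ₀ i j‖) + 1 = x := ⟨_, rfl⟩
  have hx0 : 0 ≤ x := by rw [← hx]; positivity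
  obtain ⟨e, he, hzero⟩ := DPW.singular_part_eq_zero (ρ := ρ) ht hts hsR hx0
  obtain ⟨η, hη, hdata⟩ := DPW.exists_gaugeData (ρ := ρ) hs hsR he
  -- The potential at $t=0$ is prescribed only for $|\lambda|=1$, which determines elements of
  -- $\mathcal W^{\ge0}$.
  have hα0 : ∀ z ∈ DPW.puncturedDiskInfty R, α 0 z = 0 := fun z hz =>
    DPW.Wiener.eq_zero_of_eval_eq_zero ((hξ 0 h0mem).nonneg_α z hz) fun l hl => by
      simpa [DPW.potential] using congrFun (congrFun (hξ₀ z hz l hl) 0) 0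
  have hγ0 : ∀ z ∈ DPW.puncturedDiskInfty R, γ 0 z = 0 := fun z hz =>
    DPW.Wiener.eq_zero_of_eval_eq_zero ((hξ 0 h0mem).nonneg_γ z hz) fun l hl => by
      simpa [DPW.potential] using congrFun (congrFun (hξ₀ z hz l hl) 1) 0
  have hβ0 : ∀ z ∈ DPW.puncturedDiskInfty R, β 0 z = 1 := fun z hz => by
    have hn := (hξ 0 h0mem).nonneg_β z hz
    refine sub_eq_zero.1 (DPW.Wiener.eq_zero_of_eval_eq_zero
      (hn.sub DPW.Wiener.isNonneg_one) fun l hl => ?_)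
    have hl' := DPW.Wiener.norm_lt_radius (ρ := ρ) hl
    have hl0 : l ≠ 0 := norm_pos_iff.1 (by rw [hl]; exact one_pos)
    have h1 : l⁻¹ * (β 0 z).eval l = l⁻¹ := by
      simpa [DPW.potential] using congrFun (congrFun (hξ₀ z hz l hl) 0) 1
    rw [DPW.Wiener.eval_eq_evalNonneg (hn.sub DPW.Wiener.isNonneg_one) hl', map_sub,
      DPW.Wiener.evalNonneg_one hl', ← DPW.Wiener.eval_eq_evalNonneg hn hl', sub_eq_zero]
    exact mul_left_cancel₀ (inv_ne_zero hl0) (h1.trans (mul_one _).symm)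
  have hKU : Metric.sphere (0 : ℂ) s⁻¹ ⊆ DPW.puncturedDiskInfty R := fun z hz => by
    change R⁻¹ < ‖z‖
    rw [mem_sphere_zero_iff_norm.1 hz]
    exact (inv_lt_inv₀ hR hs).2 hsR
  have hK : IsCompact (Metric.sphere (0 : ℂ) s⁻¹) := isCompact_sphere _ _
  have hΦev : ∀ᶠ t in nhds (0 : ℝ), ∀ i j, ‖Φ t ζ₀ i j‖ ≤ x := by
    refine eventually_all.2 fun i => eventually_all.2 fun j => ?_
    have h1 := DPW.eventually_norm_sub_lt (f := fun t ζ => Φ t ζ i j) hε one_pos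
      (isCompact_singleton (x := ζ₀)) (by simpa using hζ₀) (hΦC i j).continuousOn
    filter_upwards [h1] with t h
    have h2 := h ζ₀ rfl
    have h3 := norm_sub_norm_le (Φ t ζ₀ i j) (Φ 0 ζ₀ i j)
    have h4 : ‖Φ 0 ζ₀ i j‖ ≤ ∑ i, ∑ j, ‖Φ 0 ζ₀ i j‖ :=
      (Finset.single_le_sum (f := fun j => ‖Φ 0 ζ₀ i j‖) (fun _ _ => norm_nonneg _)
        (Finset.mem_univ j)).trans (Finset.single_le_sum (f := fun i => ∑ j, ‖Φ 0 ζ₀ i j‖)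
        (fun _ _ => Finset.sum_nonneg fun _ _ => norm_nonneg _) (Finset.mem_univ i))
    linarith
  filter_upwards [isOpen_Ioo.mem_nhds h0mem, hΦev,
    DPW.eventually_norm_sub_lt hε hη hK hKU hα.continuousOn,
    DPW.eventually_norm_sub_lt hε hη hK hKU hβ.continuousOn,
    DPW.eventually_norm_sub_lt hε hη hK hKU hγ.continuousOn] with t htε hΦx hαt hβt hγt
  have hpot := hξ t htε
  obtain ⟨A, hA, hAα, hA0, hAn⟩ := DPW.exists_extension_of_pole one_le_two hR hpot.holo_α
    (hpα t htε) hpot.nonneg_α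
  obtain ⟨B, hB, hBβ, -, hBn⟩ := DPW.exists_extension_of_pole le_rfl hR hpot.holo_β
    (hpβ t htε) hpot.nonneg_β
  obtain ⟨C, hC, hCγ, hC0, hCn⟩ := DPW.exists_extension_of_pole one_le_two hR hpot.holo_γ
    (hpγ t htε) hpot.nonneg_γ
  have hinv : ∀ w : ℂ, ‖w‖ = s → w⁻¹ ∈ Metric.sphere (0 : ℂ) s⁻¹ := fun w hw => by
    rw [mem_sphere_zero_iff_norm, norm_inv, hw]
  have hbA : ∀ w : ℂ, ‖w‖ = s → ‖A w‖ ≤ η := fun w hw => by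
    have h1 := hinv w hw
    have h2 := hαt _ h1
    rw [hAα _ (hKU h1), hα0 _ (hKU h1), sub_zero, inv_inv] at h2
    exact h2.le
  have hbB : ∀ w : ℂ, ‖w‖ = s → ‖B w - 1‖ ≤ η := fun w hw => by
    have h1 := hinv w hw
    have h2 := hβt _ h1
    rw [hBβ _ (hKU h1), hβ0 _ (hKU h1), inv_inv] at h2
    exact h2.le
  have hbC : ∀ w : ℂ, ‖w‖ = s → ‖C w‖ ≤ η := fun w hw => by
    have h1 := hinv w hw
    have h2 := hγt _ h1
    rw [hCγ _ (hKU h1), hγ0 _ (hKU h1), sub_zero, inv_inv] at h2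
    exact h2.le
  obtain ⟨g, p, q, r, a, c, hd, hg, hp, hq, hr, hbound⟩ := hdata A B C hA hB hC hAn hBn hCn
    (hA0 le_rfl) (hC0 le_rfl) fun w hw =>
      ⟨DPW.norm_le_on_closedBall hs hsR hA hbA hw,
        DPW.norm_le_on_closedBall hs hsR (hB.sub_const 1) hbB hw,
        DPW.norm_le_on_closedBall hs hsR hC hbC hw⟩
  have hC1 := DPW.differentiableOn_dslope_zero hR hC
  have hp0 : p.coeff 0 = 0 := by
    have h1 := DPW.residueInfty_eq hR (f := fun z => (γ t z).coeff 0)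
      (F := fun w => (C w).coeff 0)
      ((DPW.Wiener.coeffL 0).differentiable.comp_differentiableOn hC)
      (by rw [hC0 le_rfl, DPW.Wiener.coeff_zero]) (fun z hz => by rw [hCγ z hz])
    rw [hres t htε] at h1
    rw [hd.coeff_p, DPW.coeff_dslope hR hC, dslope_same]
    exact neg_eq_zero.1 h1.symm
  -- Here $z\gamma^0$ is the slope of $C^0$ at $w=1/z$. The residue formula needs this slope to
  -- vanish at $w=0$, which is the first residue condition.
  have hq0 : (q.coeff 0).re = 0 := by
    have h1 := DPW.residueInfty_eq hR (f := fun z => z * (γ t z).coeff 0)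
      (F := fun w => (dslope C 0 w).coeff 0)
      ((DPW.Wiener.coeffL 0).differentiable.comp_differentiableOn hC1)
      (by rw [← hd.coeff_p, hp0]) (fun z hz => by
        have hz0 := (DPW.inv_mem_ball hR hz).2
        rw [hCγ z hz, DPW.dslope_zero_eq C z⁻¹, hC0 le_rfl, zero_add, DPW.Wiener.coeff_smul,
          mul_inv_cancel_left₀ hz0])
    have h2 := hres' t htε
    rw [h1, Complex.neg_re, neg_eq_zero] at h2
    rw [hd.coeff_q, DPW.coeff_dslope hR hC1, dslope_same]
    exact h2
  obtain ⟨rfl, rfl, rfl⟩ := hzero A B C a c g p q r (Φ t) (α t) (β t) (γ t) ζ₀ hd hg hp hq hr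
    hbound hB hAn hBn hCn hAα hBβ hCγ rfl hζ₀ (hΦ t htε) (hmon t htε) hΦx hp0 hq0
  exact ⟨g, fun z l => !![z, 0; l * g.eval l, z⁻¹], hd.nonneg_g, fun _ _ => rfl,
    DPW.isGauge_gauge hR hd.nonneg_g,
    hd.extendsAtInfty hR hAα hBβ hCγ hB hAn hBn hCn⟩
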